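/- **Setting.** Let $d\ge 2$, let $\theta\in M_d(\mathbb R)$ be antisymmetric, and let $A_\theta$ be the unital $*$-algebra generated by unitaries $U_1,\dots,U_d$ with $U_kU_l=e^{2\pi i\theta_{kl}}U_lU_k$. Put $U^n:=U_1^{n_1}\cdots U_d^{n_d}$ for $n\in\mathbb Z^d$, and $\tau(\sum_n c_nU^n):=c_0$. Let $L_2(\mathbb T^d_\theta)$ be the completion of $A_\theta$ for $\langle a,b\rangle=\tau(a^*b)$, let $C(\mathbb T^d_\theta)$ be the norm closure of $A_\theta$ acting on $L_2(\mathbb T^d_\theta)$ by left multiplication, and let $D_i(\sum_n c_nU^n):=\sum_n n_ic_nU^n$. Let $C^\infty(\mathbb T^d_\theta)=\bigcap_\alpha\operatorname{dom}D^\alpha$ be the algebra of elements $\sum_n c_nU^n$ with rapidly decreasing coefficients. Let $x,a_1,\dots,a_d,a\in C^\infty(\mathbb T^d_\theta)$ with $x$ positive and invertible, and $$P=x\sum_{i=1}^dD_i^2+\sum_{i=1}^da_iD_i+a .$$ **Embedding.** Suppose that $\theta$ and $N$ are such that there is an inclusion $C(\mathbb T^d_\theta)\subseteq M_N(C(\mathbb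 T^d))$, i.e. a unital injective $*$-homomorphism, which carries $C^\infty(\mathbb T^d_\theta)$ into $M_N(C^\infty(\mathbb T^d))$ and $D_i$ to $-i\partial_i$ ($\partial_i$ being the derivative in the $i$-th angular coordinate, so that $-i\partial_i$ multiplies the character of frequency $n\in\mathbb Z^d$ by $n_i$). Fix such an inclusion. **Mappings $\mathbf T$.** Let $T^x_\phi(V_1,\dots,V_n)=\int_\Omega a_0(x,\lambda)V_1a_1(x,\lambda)\cdots V_na_n(x,\lambda)\,d\lambda$ denote the multiple operator integral with symbol $\phi(\alpha_0,\dots,\alpha_n)=\int_\Omega a_0(\alpha_0,\lambda)\cdots a_n(\alpha_n,\lambda)\,d\lambda$, and $f^{[n]}$ the $n$-th divided difference of $f$. Let $\mathcal X$ be the free left $C^\infty(\mathbb T^d_\theta)$-module on the monomials $\mathbf D^\alpha$ in commuting symbols $\mathbf D_1,\dots,\mathbf D_d$. Let $\mathbf T^{x,m}_f:\mathcal X^m\to C^\infty(\mathbb T^d_\theta)$ be the multilinear maps determined by $\mathbf T^{x,m}_f(b_1,\dots,b_m)=T^x_{f^{[m]}}(b_1,\dots,b_m)$ for $b_j\in C^\infty(\mathbb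 T^d_\theta)$, $$\begin{aligned}\mathbf T^{x,m}_f(\mathbf B_1,\dots,\mathbf B_k\mathbf D_i,b_{k+1},\dots,b_m)={}&\mathbf T^{x,m+1}_f(\mathbf B_1,\dots,\mathbf B_k,D_ix,b_{k+1},\dots,b_m)\\&+\mathbf T^{x,m}_f(\mathbf B_1,\dots,\mathbf B_k,D_ib_{k+1},b_{k+2},\dots,b_m)\\&+\mathbf T^{x,m}_f(\mathbf B_1,\dots,\mathbf B_k,b_{k+1}\mathbf D_i,b_{k+2},\dots,b_m)\quad(k<m)\end{aligned}$$ and $\mathbf T^{x,m}_f(\mathbf B_1,\dots,\mathbf B_m\mathbf D_i)=\mathbf T^{x,m+1}_f(\mathbf B_1,\dots,\mathbf B_m,D_ix)$. Let $\mathbf A_i=2x\mathbf D_i+a_i$ and $\mathbf P=x\sum_i\mathbf D_i^2+\sum_ia_i\mathbf D_i+a$ in $\mathcal X$. For $\mathscr A\subseteq\{1,\dots,m\}$ and $\iota:\mathscr A\to\{1,\dots,d\}$ let $\mathbf W^{\mathscr A,\iota}_j=\mathbf A_{\iota(j)}$ if $j\in\mathscr A$ and $\mathbf W^{\mathscr A,\iota}_j=\mathbf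 P$ otherwise, and let $c_d^{(\iota)}$ be the mean of $\prod_{j\in\mathscr A}u_{\iota(j)}$ over $u$ in the unit sphere $\mathbb S^{d-1}$. For even $k\ge0$ let $F_{k,d}$ be any $\frac k2$-th order primitive of $\alpha\mapsto\alpha^{-d/2}$ on $(0,\infty)$. **Iochum–Masson integrals.** For $\xi\in\mathbb R^d$ let $W^{\mathscr A}_j(\xi)=\sum_i\xi_i(2xD_i+a_i)$ if $j\in\mathscr A$ and $W^{\mathscr A}_j(\xi)=P$ otherwise. For matrix-valued differential operators $B_1,\dots,B_m$ on $C^\infty(\mathbb T^d;\mathbb C^N)$ and $v\in\mathbb C^N$ let $$f_m(\xi)[B_1\otimes\cdots\otimes B_m]v=\int_{0\le s_m\le\dots\le s_1\le1}e^{(s_1-1)|\xi|^2x}B_1e^{(s_2-s_1)|\xi|^2x}B_2\cdots B_me^{-s_m|\xi|^2x}(1\otimes v)\,ds,$$ where $1\otimes v$ is the constant section $v$ (for $m=0$ this is $e^{-|\xi|^2x}v$); thus $f_m(\xi)[\cdots]$ is an $M_N(\mathbb C)$-valued function on $\mathbb T^d$. **Local invariants.** Let $I_k(P)=\int_{\mathbb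 R^d}\mathrm{Corr}_k(s)\,ds$ (weak integral), where $\mathrm{Corr}_k(s)=\frac1{2\pi}\lim_{\Lambda\to\infty}\int_{-\Lambda}^{\Lambda}\mathrm{corr}_k(s,i\lambda)e^{i\lambda}\,d\lambda$ for $s\ne0$ (weak operator topology) and, with $R=(x|s|^2+z)^{-1}$, $$\mathrm{corr}_k(s,z)=\sum_{\frac k2\le m\le k}(-1)^m\sum_{\substack{\mathscr A\subseteq\{1,\dots,m\}\\|\mathscr A|=2m-k}}R\,W_1^{\mathscr A}(s)\big(R\,W_2^{\mathscr A}(s)(R\cdots W_m^{\mathscr A}(s)(R)\cdots)\big).$$ **Theorem 10.3.** For every even $k\ge0$, every $m$ with $\frac k2\le m\le k$, and every $\mathscr A\subseteq\{1,\dots,m\}$ with $|\mathscr A|=2m-k$, $$(-1)^{\frac k2}\pi^{\frac d2}\sum_{\iota:\mathscr A\to\{1,\dots,d\}}c_d^{(\iota)}\,\mathbf T^{x,m}_{F_{k,d}}(\mathbf W_1^{\mathscr A,\iota},\dots,\mathbf W_m^{\mathscr A,\iota})=\int_{\mathbb R^d}(-1)^mf_m(\xi)[W_1^{\mathscr A}(\xi)\otimes\cdots\otimes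 W_m^{\mathscr A}(\xi)]\,d\xi .$$ Here the left-hand side is an element of $C^\infty(\mathbb T^d_\theta)\subseteq M_N(C^\infty(\mathbb T^d))$, the equality is one of $M_N(\mathbb C)$-valued functions on $\mathbb T^d$, and all the integrals converge absolutely at every point of $\mathbb T^d$. Consequently the main formula for $I_k(P)$ reproduces the Iochum–Masson formula for all even $k$ and all $d\ge2$: $I_k(P)$ exists, lies in $C^\infty(\mathbb T^d_\theta)$, and $$\begin{aligned}I_k(P)&=(-1)^{\frac k2}\pi^{\frac d2}\sum_{\frac k2\le m\le k}\ \sum_{\substack{\mathscr A\subseteq\{1,\dots,m\}\\|\mathscr A|=2m-k}}\ \sum_{\iota:\mathscr A\to\{1,\dots,d\}}c_d^{(\iota)}\,\mathbf T^{x,m}_{F_{k,d}}(\mathbf W_1^{\mathscr A,\iota},\dots,\mathbf W_m^{\mathscr A,\iota})\\&=\int_{\mathbb R^d}\sum_{\frac k2\le m\le k}(-1)^m\sum_{\substack{\mathscr A\subseteq\{1,\dots,m\}\\|\mathscr A|=2m-k}}f_m(\xi)[W_1^{\mathscr A}(\xi)\otimes\cdots\otimes W_m^{\mathscr A}(\xi)]\,d\xi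 .\end{aligned}$$ -/

import Mathlib

open MeasureTheory Filter Topology

namespace NCTorus

noncomputable section

/-- `L₂(𝕋^d_θ)`: the elements `Uⁿ`, `n ∈ ℤ^d`, form an orthonormal basis, so that this Hilbert space
is `ℓ²(ℤ^d)`; the basis vector at `n` stands for `Uⁿ`, and the one at `0` for the unit `1`. -/
abbrev L2 (d : ℕ) := lp (fun _ : Fin d → ℤ => ℂ) 2

/-- Bounded operators on `L₂(𝕋^d_θ)`. -/
abbrev Op (d : ℕ) := L2 d →L[ℂ] L2 d

/-- The cocycle with `U^m Uⁿ = phase θ m n • U^(m+n)`, where `U^n = U₁^{n₁} ⋯ U_d^{n_d}` and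
`U_k U_l = e^{2πiθ_{kl}} U_l U_k`: each `U_l` of `Uⁿ` is moved to the left past the `U_k`, `k > l`,
of `U^m`. -/
def phase {d : ℕ} (θ : Matrix (Fin d) (Fin d) ℝ) (m n : Fin d → ℤ) : ℂ :=
  Complex.exp (((2 * Real.pi * ∑ k, ∑ l, if l < k then θ k l * m k * n l else 0 : ℝ) : ℂ)
    * Complex.I)

theorem norm_phase {d : ℕ} (θ : Matrix (Fin d) (Fin d) ℝ) (m n : Fin d → ℤ) :
    ‖phase θ m n‖ = 1 := Complex.norm_exp_ofReal_mul_I _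

theorem memlp_twist {d : ℕ} (θ : Matrix (Fin d) (Fin d) ℝ) (m : Fin d → ℤ) (g : L2 d) :
    Memℓp (fun n => phase θ m (n - m) * g (n - m)) 2 := by
  have h2 : 0 < (2 : ENNReal).toReal := by norm_num
  rw [memℓp_gen_iff h2]
  have := (lp.memℓp g).summable h2
  simpa [norm_phase, Function.comp_def] using
    (Equiv.subRight m).summable_iff.mpr this

/-- The unitary `λ_l(U^m)`, left multiplication by `U^m` on `L₂(𝕋^d_θ)`. -/
def U {d : ℕ} (θ : Matrix (Fin d) (Fin d) ℝ) (m : Fin d → ℤ) : Op d :=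
  LinearIsometry.toContinuousLinearMap
    { toFun := fun g => ⟨fun n => phase θ m (n - m) * g (n - m), memlp_twist θ m g⟩
      map_add' := fun g h => by
        ext n
        exact mul_add _ _ _
      map_smul' := fun c g => by
        ext n
        simp [mul_left_comm]
      norm_map' := fun g => by
        have h2 : 0 < (2 : ENNReal).toReal := by norm_num
        have key : ‖(⟨fun n => phase θ m (n - m) * g (n - m), memlp_twist θ m g⟩ : L2 d)‖
            ^ (2 : ENNReal).toReal = ‖g‖ ^ (2 : ENNReal).toReal := by
          rw [lp.norm_rpow_eq_tsum h2, lp.norm_rpow_eq_tsum h2]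
          simpa [norm_phase] using
            (Equiv.subRight m).tsum_eq (fun n => ‖g n‖ ^ (2 : ENNReal).toReal)
        simpa using key }

theorem U_apply {d : ℕ} (θ : Matrix (Fin d) (Fin d) ℝ) (m : Fin d → ℤ) (g : L2 d)
    (n : Fin d → ℤ) : U θ m g n = phase θ m (n - m) * g (n - m) := rfl

theorem norm_U_le {d : ℕ} (θ : Matrix (Fin d) (Fin d) ℝ) (m : Fin d → ℤ) : ‖U θ m‖ ≤ 1 :=
  LinearIsometry.norm_toContinuousLinearMap_le _

/-- The C⋆-algebra `C(𝕋^d_θ)`: the norm closure, in the bounded operators on `L₂(𝕋^d_θ)`, of the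
⋆-algebra `A_θ` spanned by the `U^n`. An element `a` is identified with `λ_l(a)` throughout. -/
def cTorus {d : ℕ} (θ : Matrix (Fin d) (Fin d) ℝ) : StarSubalgebra ℂ (Op d) :=
  (StarAlgebra.adjoin ℂ (Set.range (U θ))).topologicalClosure

/-- The unit `1` of the noncommutative torus as a vector of `L₂(𝕋^d_θ)`. -/
def vac (d : ℕ) : L2 d := lp.single 2 0 1

/-- The Fourier coefficient `c_n = ⟨Uⁿ, a⟩ = τ((Uⁿ)* a)` of `a = ∑ c_n Uⁿ`. -/
def coeff {d : ℕ} (n : Fin d → ℤ) : Op d →L[ℂ] ℂ :=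
  (innerSL ℂ (lp.single 2 n 1 : L2 d)).comp (ContinuousLinearMap.apply ℂ (L2 d) (vac d))

theorem coeff_apply {d : ℕ} (n : Fin d → ℤ) (a : Op d) : coeff n a = a (vac d) n := by
  simp [coeff, lp.inner_single_left]

theorem coeff_U {d : ℕ} (θ : Matrix (Fin d) (Fin d) ℝ) (n m : Fin d → ℤ) :
    coeff n (U θ m) = if n = m then 1 else 0 := by
  rw [coeff_apply, U_apply, vac, lp.single_apply]
  split_ifs with h
  · subst h
    simp [phase]
  · rw [Pi.single_eq_of_ne (by rwa [sub_ne_zero]), mul_zero]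

/-- `C^∞(𝕋^d_θ) = ⋂_α dom D^α`: the elements `a = ∑ c_n Uⁿ` with `∑ |n^α c_n|² < ∞` for every
multi-index `α`. -/
def smoothTorus {d : ℕ} (θ : Matrix (Fin d) (Fin d) ℝ) : Submodule ℂ (Op d) where
  carrier := {a | a ∈ cTorus θ ∧ ∀ α : Fin d → ℕ,
    Memℓp (fun n : Fin d → ℤ => (∏ i, (n i : ℂ) ^ α i) * coeff n a) 2}
  zero_mem' := ⟨zero_mem _, fun α => by simpa using zero_mem_ℓp'⟩
  add_mem' := fun {a b} ha hb => ⟨add_mem ha.1 hb.1, fun α => by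
    simp only [map_add, mul_add]
    exact (ha.2 α).add (hb.2 α)⟩
  smul_mem' := fun c a ha => ⟨(cTorus θ).smul_mem ha.1 c, fun α => by
    simpa only [map_smul, smul_eq_mul, mul_left_comm] using (ha.2 α).const_mul c⟩

/-- `D_i (∑ c_n Uⁿ) = ∑ n_i c_n Uⁿ`, as a function on all bounded operators (it is used on elements of
`C^∞(𝕋^d_θ)` only, where the series converges in norm). -/
def derivOp {d : ℕ} (θ : Matrix (Fin d) (Fin d) ℝ) (i : Fin d) (a : Op d) : Op d :=
  ∑' n : Fin d → ℤ, ((n i : ℂ) * coeff n a) • U θ n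

theorem summable_weight (d : ℕ) : Summable fun n : Fin d → ℤ => ∏ i, (1 + (n i : ℝ) ^ 2)⁻¹ := by
  induction d with
  | zero => exact .of_finite
  | succ d ih =>
    have h1 : Summable fun n : ℤ => (1 + (n : ℝ) ^ 2)⁻¹ := by
      refine Summable.of_norm_bounded_eventually 
        (g := fun n : ℤ => 1 / (n : ℝ) ^ 2) (Real.summable_one_div_int_pow.mpr one_lt_two) ?_
      filter_upwards [(Set.finite_singleton (0 : ℤ)).compl_mem_cofinite] with n hn
      have hn' : (n : ℝ) ≠ 0 := by simpa using hn
      rw [Real.norm_of_nonneg (by positivity), one_div]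
      have : 0 < (n : ℝ) ^ 2 := by positivity
      gcongr
      linarith
    have h := Summable.mul_of_nonneg h1 ih (fun _ => by positivity)
      (fun _ => by simp only [Pi.zero_apply]; positivity)
    rw [← (Fin.consEquiv (fun _ : Fin (d + 1) => ℤ)).summable_iff]
    refine h.congr fun n => ?_
    simp [Fin.prod_univ_succ, mul_comm]

theorem summable_deriv {d : ℕ} {θ : Matrix (Fin d) (Fin d) ℝ} (i : Fin d) {a : Op d}
    (ha : a ∈ smoothTorus θ) :
    Summable fun n : Fin d → ℤ => ((n i : ℂ) * coeff n a) • U θ n := by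
  have hb : ∀ α : Fin d → ℕ, ∃ C : ℝ, ∀ n : Fin d → ℤ,
      ‖(∏ i, (n i : ℂ) ^ α i) * coeff n a‖ ≤ C := fun α => by
    obtain ⟨C, hC⟩ := ((ha.2 α).of_exponent_ge le_top).bddAbove
    exact ⟨C, fun n => hC ⟨n, rfl⟩⟩
  choose C hC using hb
  let e : Finset (Fin d) → Fin d → ℕ := fun s j => (if j ∈ s then 2 else 0) + if j = i then 1 else 0
  refine Summable.of_norm_bounded
    ((summable_weight d).mul_left (∑ s ∈ (Finset.univ : Finset (Fin d)).powerset, C (e s)))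
    fun n => ?_
  have hw : 0 < ∏ j, (1 + (n j : ℝ) ^ 2) := Finset.prod_pos fun _ _ => by positivity
  rw [Finset.prod_inv_distrib, ← div_eq_mul_inv, le_div_iff₀ hw, norm_smul]
  calc ‖(n i : ℂ) * coeff n a‖ * ‖U θ n‖ * ∏ j, (1 + (n j : ℝ) ^ 2)
      ≤ ‖(n i : ℂ) * coeff n a‖ * 1 * ∏ j, (1 + (n j : ℝ) ^ 2) := by
        gcongr
        exact norm_U_le θ n
    _ = ∑ s ∈ (Finset.univ : Finset (Fin d)).powerset,
          ‖(∏ j, (n j : ℂ) ^ e s j) * coeff n a‖ := by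
        rw [Finset.prod_one_add, Finset.mul_sum]
        refine Finset.sum_congr rfl fun s _ => ?_
        simp only [e, pow_add, Finset.prod_mul_distrib, norm_mul, norm_prod, norm_pow,
          pow_ite, pow_zero, Finset.prod_ite_mem, Finset.univ_inter, Finset.prod_ite_eq',
          Finset.mem_univ, if_true, pow_one]
        simp
        ring
    _ ≤ _ := Finset.sum_le_sum fun s _ => hC (e s) n

theorem coeff_deriv {d : ℕ} {θ : Matrix (Fin d) (Fin d) ℝ} (i : Fin d) {a : Op d}
    (ha : a ∈ smoothTorus θ) (n : Fin d → ℤ) :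
    coeff n (derivOp θ i a) = (n i : ℂ) * coeff n a := by
  rw [derivOp, (coeff n).map_tsum (summable_deriv i ha), tsum_eq_single n]
  · simp [coeff_U]
  · intro m hm
    simp [coeff_U, hm.symm]

theorem deriv_mem {d : ℕ} {θ : Matrix (Fin d) (Fin d) ℝ} (i : Fin d) {a : Op d}
    (ha : a ∈ smoothTorus θ) : derivOp θ i a ∈ smoothTorus θ := by
  refine ⟨?_, fun α => ?_⟩
  · have hcl : IsClosed ((cTorus θ : StarSubalgebra ℂ (Op d)) : Set (Op d)) :=
      StarSubalgebra.isClosed_topologicalClosure _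
    refine hcl.mem_of_tendsto (summable_deriv i ha).hasSum (.of_forall fun s => ?_)
    exact sum_mem fun n _ => (cTorus θ).smul_mem (StarSubalgebra.le_topologicalClosure _
      (StarAlgebra.subset_adjoin ℂ _ ⟨n, rfl⟩)) _
  · convert ha.2 (α + Pi.single i 1) using 2 with n
    rw [coeff_deriv i ha]
    simp only [Pi.add_apply, pow_add, Finset.prod_mul_distrib, Pi.single_apply, pow_ite, pow_one,
      pow_zero, Finset.prod_ite_eq', Finset.mem_univ, if_true, mul_assoc]

/-- The derivation `D_i` of `C^∞(𝕋^d_θ)`. -/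
def D {d : ℕ} (θ : Matrix (Fin d) (Fin d) ℝ) (i : Fin d) : smoothTorus θ →ₗ[ℂ] smoothTorus θ where
  toFun a := ⟨derivOp θ i a, deriv_mem i a.2⟩
  map_add' a b := by
    ext1
    simp only [derivOp, Submodule.coe_add, map_add, mul_add, add_smul]
    exact (summable_deriv i a.2).tsum_add (summable_deriv i b.2)
  map_smul' c a := by
    ext1
    simp only [derivOp, Submodule.coe_smul, map_smul, smul_eq_mul, mul_left_comm _ c,
      mul_smul c, RingHom.id_apply]
    exact (summable_deriv i a.2).tsum_const_smul c
/-! ### Multiple operator integrals -/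

/-- The divided difference `f^{[n]}(α₀, …, α_n)`, by Newton's recursion
`f^{[n]}(α₀, …, α_n) = g^{[n-1]}(α₁, …, α_n)`, `g(β) = (f(β) - f(α₀)) / (β - α₀)`, `g(α₀) = f'(α₀)`.
For `f` smooth near the arguments this includes coinciding arguments. -/
def divDiff : (n : ℕ) → (ℝ → ℝ) → (Fin (n + 1) → ℝ) → ℝ
  | 0, f, α => f (α 0)
  | n + 1, f, α => divDiff n (dslope f (α 0)) (Fin.tail α)

/-- A separation of variables
`φ(α₀, …, α_n) = ∫_Ω a₀(α₀, p) ⋯ a_n(α_n, p) dμ(p)` on `spec(x)^{n+1}`, over a finite measure space,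
with bounded measurable `a_j` that are continuous in the first variable. -/
structure SeparatedSymbol {d : ℕ} (x : Op d) (n : ℕ) (φ : (Fin (n + 1) → ℝ) → ℂ) where
  Ω : Type
  [mΩ : MeasurableSpace Ω]
  μ : Measure Ω
  [finite_measure : IsFiniteMeasure μ]
  factor : Fin (n + 1) → ℝ → Ω → ℂ
  measurable_factor : ∀ j, Measurable (Function.uncurry (factor j))
  bounded_factor : ∃ C : ℝ, ∀ j α p, ‖factor j α p‖ ≤ C
  continuous_factor : ∀ j p, Continuous fun α => factor j α p
  symbol_eq : ∀ α : Fin (n + 1) → ℝ, (∀ j, α j ∈ spectrum ℝ x) →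
    φ α = ∫ p, ∏ j, factor j (α j) p ∂μ

/-- `∫_Ω a₀(x, p) V₁ a₁(x, p) ⋯ V_n a_n(x, p) dμ(p)` for self-adjoint `x`, where `a_j(x, p)` is given
by the functional calculus. -/
def SeparatedSymbol.integral {d : ℕ} {x : Op d} {n : ℕ} {φ : (Fin (n + 1) → ℝ) → ℂ}
    (r : SeparatedSymbol x n φ) (V : Fin n → Op d) : Op d :=
  letI := r.mΩ
  ∫ p, cfc (fun z : ℂ => r.factor 0 z.re p) x *
    (List.ofFn fun j : Fin n => V j * cfc (fun z : ℂ => r.factor j.succ z.re p) x).prod ∂r.μ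

open Classical in
/-- The multiple operator integral `T^x_φ(V₁, …, V_n)`. The integral does not depend on the chosen
separation of variables, only on `φ`. -/
def moi {d : ℕ} (x : Op d) {n : ℕ} (φ : (Fin (n + 1) → ℝ) → ℂ) (V : Fin n → Op d) : Op d :=
  if h : Nonempty (SeparatedSymbol x n φ) then h.some.integral V else 0

/-! ### The recursive mappings `𝐓` -/

/-- The free left `C^∞(𝕋^d_θ)`-module `𝒳` on the formal symbols `𝐃^α`: the formal differential
operators `∑_α b_α 𝐃^α`. -/
abbrev FormalOp {d : ℕ} (θ : Matrix (Fin d) (Fin d) ℝ) := (Fin d → ℕ) →₀ smoothTorus θ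

/-- If `K w` is `𝐓(𝐁₁, …, 𝐁_k, w)` for lists `w = (b_{k+1}, …, b_m)` in `C^∞(𝕋^d_θ)`, then
`leibniz θ x i K w` is `𝐓(𝐁₁, …, 𝐁_k 𝐃_i, w)`:
`𝐓(…, 𝐁_k 𝐃_i) = 𝐓(…, 𝐁_k, D_i x)` and
`𝐓(…, 𝐁_k 𝐃_i, b_{k+1}, …) = 𝐓(…, 𝐁_k, D_i x, b_{k+1}, …) + 𝐓(…, 𝐁_k, D_i b_{k+1}, …)
  + 𝐓(…, 𝐁_k, b_{k+1} 𝐃_i, …)`. -/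
def leibniz {d : ℕ} (θ : Matrix (Fin d) (Fin d) ℝ) (x : smoothTorus θ) (i : Fin d) :
    (List (smoothTorus θ) → Op d) → List (smoothTorus θ) → Op d
  | K, [] => K [D θ i x]
  | K, b :: w => K (D θ i x :: b :: w) + K (D θ i b :: w) +
      leibniz θ x i (fun w' => K (b :: w')) w

theorem D_comm {d : ℕ} {θ : Matrix (Fin d) (Fin d) ℝ} (i j : Fin d) (b : smoothTorus θ) :
    D θ i (D θ j b) = D θ j (D θ i b) := by
  ext1
  change derivOp θ i (derivOp θ j b) = derivOp θ j (derivOp θ i b)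
  conv_lhs => rw [derivOp]
  conv_rhs => rw [derivOp]
  refine tsum_congr fun n => ?_
  rw [coeff_deriv j b.2 n, coeff_deriv i b.2 n, mul_left_comm]

theorem leibniz_zero {d : ℕ} {θ : Matrix (Fin d) (Fin d) ℝ} (x : smoothTorus θ) (i : Fin d)
    (w : List (smoothTorus θ)) : leibniz θ x i (fun _ => 0) w = 0 := by
  induction w with
  | nil => rfl
  | cons b w ih => simp [leibniz, ih]

theorem leibniz_add {d : ℕ} {θ : Matrix (Fin d) (Fin d) ℝ} (x : smoothTorus θ) (i : Fin d)
    (w : List (smoothTorus θ)) : ∀ K K' : List (smoothTorus θ) → Op d,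
    leibniz θ x i (fun w => K w + K' w) w = leibniz θ x i K w + leibniz θ x i K' w := by
  induction w with
  | nil => intros; rfl
  | cons b w ih =>
    intro K K'
    simp only [leibniz, ih]
    abel

theorem leibniz_sum {d : ℕ} {θ : Matrix (Fin d) (Fin d) ℝ} (x : smoothTorus θ) (i : Fin d)
    (w : List (smoothTorus θ)) {κ : Type*} (s : Finset κ) (K : κ → List (smoothTorus θ) → Op d) :
    leibniz θ x i (fun w => ∑ c ∈ s, K c w) w = ∑ c ∈ s, leibniz θ x i (K c) w := by
  classical
  induction s using Finset.induction_on with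
  | empty => simpa using leibniz_zero x i w
  | insert c s hc ih => simp only [Finset.sum_insert hc, leibniz_add, ih]

theorem leibniz_comm {d : ℕ} {θ : Matrix (Fin d) (Fin d) ℝ} (x : smoothTorus θ) (i j : Fin d)
    (w : List (smoothTorus θ)) : ∀ K : List (smoothTorus θ) → Op d,
    leibniz θ x i (leibniz θ x j K) w = leibniz θ x j (leibniz θ x i K) w := by
  induction w with
  | nil =>
    intro K
    simp only [leibniz, D_comm i j]
    abel
  | cons b w ih =>
    intro K
    simp only [leibniz, leibniz_add, ih, D_comm i j]
    abel

/-- `leibniz` for a monomial `𝐃^α` in place of `𝐃_i`; the order of the factors is immaterial. -/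
def leibnizPow {d : ℕ} (θ : Matrix (Fin d) (Fin d) ℝ) (x : smoothTorus θ) (α : Fin d → ℕ)
    (K : List (smoothTorus θ) → Op d) : List (smoothTorus θ) → Op d :=
  (List.finRange d).foldr (fun i K' => (leibniz θ x i)^[α i] K') K

theorem leibnizPow_add_single {d : ℕ} {θ : Matrix (Fin d) (Fin d) ℝ} (x : smoothTorus θ)
    (α : Fin d → ℕ) (i : Fin d) (K : List (smoothTorus θ) → Op d) :
    leibnizPow θ x (α + Pi.single i 1) K = leibniz θ x i (leibnizPow θ x α K) := by
  have comm : ∀ (j : Fin d) (n : ℕ) (K : List (smoothTorus θ) → Op d),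
      (leibniz θ x j)^[n] (leibniz θ x i K) = leibniz θ x i ((leibniz θ x j)^[n] K) := by
    intro j n K
    have : Function.Commute (leibniz θ x i) (leibniz θ x j) := fun K => by
      funext w
      exact leibniz_comm x i j w K
    exact ((this.iterate_right n) K).symm
  have fold : ∀ L : List (Fin d), L.Nodup →
      L.foldr (fun j K' => (leibniz θ x j)^[(α + Pi.single i 1 : Fin d → ℕ) j] K') K =
        if i ∈ L then leibniz θ x i (L.foldr (fun j K' => (leibniz θ x j)^[α j] K') K)
        else L.foldr (fun j K' => (leibniz θ x j)^[α j] K') K := by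
    intro L
    induction L with
    | nil => simp
    | cons j L ih =>
      intro hL
      have hL' := List.nodup_cons.mp hL
      rw [List.foldr_cons, List.foldr_cons, ih hL'.2]
      by_cases h : i = j
      · subst h
        simp [hL'.1, Function.iterate_succ_apply']
      · simp only [Pi.add_apply, Pi.single_apply, Ne.symm h, if_false, add_zero, List.mem_cons, h,
          false_or]
        split_ifs
        · rw [comm]
        · rfl
  simpa [leibnizPow] using fold _ (List.nodup_finRange d)

/-- `𝐓_f^{x,m}(𝐁₁, …, 𝐁_k, b_{k+1}, …, b_m)`, where the first argument lists `𝐁_k, …, 𝐁₁` (in this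
order) and the second one lists `b_{k+1}, …, b_m ∈ C^∞(𝕋^d_θ)`. For `k = 0` it is
`T^x_{f^{[m]}}(b₁, …, b_m)`. -/
def bTAux {d : ℕ} (θ : Matrix (Fin d) (Fin d) ℝ) (f : ℝ → ℝ) (x : smoothTorus θ) :
    List (FormalOp θ) → List (smoothTorus θ) → Op d
  | [], w => moi (x : Op d) (fun α => ((divDiff w.length f α : ℝ) : ℂ)) fun j => (w.get j : Op d)
  | B :: Bs, w => B.sum fun α b => leibnizPow θ x α (fun w' => bTAux θ f x Bs (b :: w')) w

/-- The recursion for `𝐁𝐃_i = ∑ b_α 𝐃^α 𝐃_i` in place of `𝐁 = ∑ b_α 𝐃^α`. -/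
theorem bTAux_mul_D {d : ℕ} {θ : Matrix (Fin d) (Fin d) ℝ} (f : ℝ → ℝ) (x : smoothTorus θ)
    (B : FormalOp θ) (i : Fin d) (Bs : List (FormalOp θ)) (w : List (smoothTorus θ)) :
    bTAux θ f x (B.mapDomain (· + Pi.single i 1) :: Bs) w =
      leibniz θ x i (bTAux θ f x (B :: Bs)) w := by
  change Finsupp.sum _ _ = leibniz θ x i (fun w => ∑ α ∈ B.support, _) w
  rw [leibniz_sum, Finsupp.sum_mapDomain_index_inj (add_left_injective _)]
  exact Finset.sum_congr rfl fun α _ => congrFun (leibnizPow_add_single x α i _) w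

/-- The multilinear mapping `𝐓_f^{x,m}(𝐁₁, …, 𝐁_m)`. -/
def bT {d m : ℕ} (θ : Matrix (Fin d) (Fin d) ℝ) (f : ℝ → ℝ) (x : smoothTorus θ)
    (B : Fin m → FormalOp θ) : Op d :=
  bTAux θ f x (List.ofFn B).reverse []

/-! ### The main formula -/

/-- `𝐀_i = 2x𝐃_i + a_i`. -/
def formalA {d : ℕ} {θ : Matrix (Fin d) (Fin d) ℝ} (x : smoothTorus θ) (a : Fin d → smoothTorus θ)
    (i : Fin d) : FormalOp θ :=
  Finsupp.single (Pi.single i 1) ((2 : ℂ) • x) + Finsupp.single 0 (a i)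

/-- `𝐏 = x ∑ 𝐃_i² + ∑ a_i 𝐃_i + a₀`. -/
def formalP {d : ℕ} {θ : Matrix (Fin d) (Fin d) ℝ} (x : smoothTorus θ) (a : Fin d → smoothTorus θ)
    (a₀ : smoothTorus θ) : FormalOp θ :=
  ∑ i, Finsupp.single (Pi.single i 2) x + ∑ i, Finsupp.single (Pi.single i 1) (a i) +
    Finsupp.single 0 a₀

/-- `𝐖_j^{𝒜,ι}`: it is `𝐀_{ι(j)}` for `j ∈ 𝒜` and `𝐏` otherwise. -/
def formalW {d m : ℕ} {θ : Matrix (Fin d) (Fin d) ℝ} (x : smoothTorus θ)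
    (a : Fin d → smoothTorus θ) (a₀ : smoothTorus θ) (𝒜 : Finset (Fin m))
    (ι : {j // j ∈ 𝒜} → Fin d) (j : Fin m) : FormalOp θ :=
  if h : j ∈ 𝒜 then formalA x a (ι ⟨j, h⟩) else formalP x a a₀

/-- `c_d^{(ι)}`: the mean of `∏_{j ∈ 𝒜} u_{ι(j)}` over the unit sphere of `ℝ^d`. -/
def sphereMean {d m : ℕ} {𝒜 : Finset (Fin m)} (ι : {j // j ∈ 𝒜} → Fin d) : ℝ :=
  ⨍ u : Metric.sphere (0 : EuclideanSpace ℝ (Fin d)) 1,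
    ∏ j, (u : EuclideanSpace ℝ (Fin d)) (ι j)
      ∂(volume : Measure (EuclideanSpace ℝ (Fin d))).toSphere

/-- `F` is a primitive of order `k/2` (`k` even) of `α ↦ α^{-d/2}` on `(0, ∞)`. -/
def IsPowerPrimitive (k d : ℕ) (F : ℝ → ℝ) : Prop :=
  ContDiffOn ℝ (k / 2 : ℕ) F (Set.Ioi 0) ∧
    ∀ α : ℝ, 0 < α → iteratedDeriv (k / 2) F α = α ^ (-(d : ℝ) / 2)

/-- `(-1)^{k/2} π^{d/2} ∑_{ι : 𝒜 → {1,…,d}} c_d^{(ι)} 𝐓_F^{x,m}(𝐖₁^{𝒜,ι}, …, 𝐖_m^{𝒜,ι})`. -/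
def mainSummand {d m : ℕ} (θ : Matrix (Fin d) (Fin d) ℝ) (x : smoothTorus θ)
    (a : Fin d → smoothTorus θ) (a₀ : smoothTorus θ) (k : ℕ) (F : ℝ → ℝ) (𝒜 : Finset (Fin m)) :
    Op d :=
  (((-1) ^ (k / 2) * Real.pi ^ ((d : ℝ) / 2) : ℝ) : ℂ) •
    ∑ ι : {j // j ∈ 𝒜} → Fin d, (sphereMean ι : ℂ) • bT θ F x (formalW x a a₀ 𝒜 ι)

/-- The main formula: the sum of `mainSummand` over `k/2 ≤ m ≤ k` and `𝒜 ⊆ {1,…,m}` with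
`|𝒜| = 2m - k`. -/
def mainFormula {d : ℕ} (θ : Matrix (Fin d) (Fin d) ℝ) (x : smoothTorus θ)
    (a : Fin d → smoothTorus θ) (a₀ : smoothTorus θ) (k : ℕ) (F : ℝ → ℝ) : Op d :=
  ∑ m ∈ Finset.Icc (k / 2) k, ∑ 𝒜 ∈ Finset.powersetCard (2 * m - k) (Finset.univ : Finset (Fin m)),
    mainSummand θ x a a₀ k F 𝒜

/-! ### The operators `V(ξ)`, `P` and `W_j^𝒜(ξ)`

They act on a space `M` (elements of the noncommutative torus, or sections over the torus) with given
multiplications `X`, `A i`, `A₀` by `x`, `a_i`, `a₀` and derivations `∂ i`. -/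

/-- `V(ξ) = ∑ ξ_i A_i`, `A_i = 2xD_i + a_i`. -/
def opV {M : Type*} [AddCommGroup M] [Module ℂ M] {d : ℕ} (X : M → M) (A : Fin d → M → M)
    (del : Fin d → M → M) (ξ : EuclideanSpace ℝ (Fin d)) (g : M) : M :=
  ∑ i, (ξ i : ℂ) • ((2 : ℂ) • X (del i g) + A i g)

/-- `P = x ∑ D_i² + ∑ a_i D_i + a₀`. -/
def opP {M : Type*} [AddCommGroup M] {d : ℕ} (X : M → M) (A : Fin d → M → M) (A₀ : M → M)
    (del : Fin d → M → M) (g : M) : M :=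
  X (∑ i, del i (del i g)) + ∑ i, A i (del i g) + A₀ g

/-- `W_j^𝒜(ξ)`: it is `V(ξ)` for `j ∈ 𝒜` and `P` otherwise. -/
def opW {M : Type*} [AddCommGroup M] [Module ℂ M] {d m : ℕ} (X : M → M) (A : Fin d → M → M)
    (A₀ : M → M) (del : Fin d → M → M) (𝒜 : Finset (Fin m)) (ξ : EuclideanSpace ℝ (Fin d))
    (j : Fin m) : M → M :=
  if j ∈ 𝒜 then opV X A del ξ else opP X A A₀ del

/-! ### Local invariants -/

/-- `corr_k(s, z) = R ∑_m (-1)^m ∑_𝒜 W₁^𝒜(s)(R W₂^𝒜(s)(R ⋯ W_m^𝒜(s)(R 1)))`, with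
`R = (x|s|² + z)⁻¹`, over `k/2 ≤ m ≤ k` and `𝒜 ⊆ {1,…,m}` with `|𝒜| = 2m - k`. -/
def resolventCorr {d : ℕ} (θ : Matrix (Fin d) (Fin d) ℝ) (x : smoothTorus θ)
    (a : Fin d → smoothTorus θ) (a₀ : smoothTorus θ) (k : ℕ) (s : EuclideanSpace ℝ (Fin d))
    (z : ℂ) : Op d :=
  let R : Op d := Ring.inverse (((‖s‖ ^ 2 : ℝ) : ℂ) • (x : Op d) + z • 1)
  R * ∑ m ∈ Finset.Icc (k / 2) k,
    ∑ 𝒜 ∈ Finset.powersetCard (2 * m - k) (Finset.univ : Finset (Fin m)),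
      (-1 : ℂ) ^ m • (List.ofFn fun (j : Fin m) (g : Op d) =>
        opW (fun g => (x : Op d) * g) (fun i g => (a i : Op d) * g) (fun g => (a₀ : Op d) * g)
          (derivOp θ) 𝒜 s j (R * g)).foldr (fun T g => T g) 1

/-- `I` is the local invariant `I_k(P) = ∫_{ℝ^d} Corr_k(s) ds` of
`P = x ∑ D_i² + ∑ a_i D_i + a₀`, where `Corr_k(s) = (2π)⁻¹ ∫_{-∞}^∞ corr_k(s, iλ) e^{iλ} dλ`,
`∫_{-∞}^∞ = lim_N ∫_{-N}^N` in the weak operator topology, and the integral over `s` is a weak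
integral. -/
def IsLocalInvariant {d : ℕ} (θ : Matrix (Fin d) (Fin d) ℝ) (x : smoothTorus θ)
    (a : Fin d → smoothTorus θ) (a₀ : smoothTorus θ) (k : ℕ) (I : Op d) : Prop :=
  ∃ Corr : EuclideanSpace ℝ (Fin d) → Op d,
    (∀ s, s ≠ 0 → ∀ u w : L2 d,
      Tendsto (fun N : ℝ => (1 / (2 * Real.pi) : ℂ) * ∫ l in (-N)..N,
          inner ℂ w (resolventCorr θ x a a₀ k s (Complex.I * l) u) * Complex.exp (Complex.I * l))
        atTop (𝓝 (inner ℂ w (Corr s u)))) ∧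
    ∀ u w : L2 d, Integrable (fun s => inner ℂ w (Corr s u)) ∧
      ∫ s, inner ℂ w (Corr s u) = inner ℂ w (I u)

/-! ### Matrix-valued functions on the torus and the Iochum–Masson integrals -/

open scoped ContDiff in
/-- Smoothness of a function on `𝕋^d = (ℝ/ℤ)^d`, through its periodic lift to `ℝ^d`. -/
def TorusSmooth {d : ℕ} {E : Type*} [NormedAddCommGroup E] [NormedSpace ℝ E]
    (g : UnitAddTorus (Fin d) → E) : Prop :=
  ContDiff ℝ ∞ fun y : Fin d → ℝ => g fun i => (y i : UnitAddCircle)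

/-- `D_i = -i ∂_i` on functions on `𝕋^d`, with `∂_i` taken in the angle `2πt_i`, so that
`D_i e^{2πi n·t} = n_i e^{2πi n·t}`. -/
def torusD {d : ℕ} {E : Type*} [NormedAddCommGroup E] [NormedSpace ℂ E] (i : Fin d)
    (g : UnitAddTorus (Fin d) → E) (t : UnitAddTorus (Fin d)) : E :=
  (2 * Real.pi * Complex.I : ℂ)⁻¹ •
    deriv (fun s : ℝ => g (t + Pi.single i (s : UnitAddCircle))) 0

/-- `C^∞(𝕋^d_θ) ⊆ C(𝕋^d_θ)`. -/
def toC {d : ℕ} {θ : Matrix (Fin d) (Fin d) ℝ} (b : smoothTorus θ) : cTorus θ := ⟨b, b.2.1⟩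

/-- The ⋆-homomorphism `Φ : C(𝕋^d_θ) → M_N(C(𝕋^d))` maps `C^∞(𝕋^d_θ)` into `M_N(C^∞(𝕋^d))` and carries
`D_i` to `-i ∂_i`. -/
def PreservesSmooth {d N : ℕ} {θ : Matrix (Fin d) (Fin d) ℝ}
    (Φ : cTorus θ →⋆ₐ[ℂ] Matrix (Fin N) (Fin N) C(UnitAddTorus (Fin d), ℂ)) : Prop :=
  ∀ (b : smoothTorus θ) (p q : Fin N), TorusSmooth (Φ (toC b) p q) ∧
    ∀ i t, Φ (toC (D θ i b)) p q t = torusD i (Φ (toC b) p q) t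

/-- The value at `t ∈ 𝕋^d` of the matrix-valued function `Φ(b)`. -/
def matrixAt {d N : ℕ} {θ : Matrix (Fin d) (Fin d) ℝ}
    (Φ : cTorus θ →⋆ₐ[ℂ] Matrix (Fin N) (Fin N) C(UnitAddTorus (Fin d), ℂ)) (b : smoothTorus θ)
    (t : UnitAddTorus (Fin d)) : Matrix (Fin N) (Fin N) ℂ :=
  Matrix.of fun p q => Φ (toC b) p q t

/-- Functions `𝕋^d → ℂ^N`, the sections of the trivial bundle. -/
abbrev Sec (d N : ℕ) := UnitAddTorus (Fin d) → Fin N → ℂ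

/-- Pointwise multiplication of a section by a matrix-valued function. -/
def matMul {d N : ℕ} (X : UnitAddTorus (Fin d) → Matrix (Fin N) (Fin N) ℂ) (g : Sec d N) :
    Sec d N :=
  fun t => (X t).mulVec (g t)

/-- `e^{rX} g` for a section `g`. -/
def expMul {d N : ℕ} (X : UnitAddTorus (Fin d) → Matrix (Fin N) (Fin N) ℂ) (r : ℝ) (g : Sec d N) :
    Sec d N :=
  matMul (fun t => NormedSpace.exp ((r : ℂ) • X t)) g

/-- `Δ_m = {s ∈ ℝ^m : 0 ≤ s_m ≤ ⋯ ≤ s_1 ≤ 1}`. -/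
def simplex (m : ℕ) : Set (Fin m → ℝ) :=
  {s | (∀ j, 0 ≤ s j ∧ s j ≤ 1) ∧ Antitone s}

/-- The sequence `s₀ = 1, s₁, …, s_m, s_{m+1} = 0`. -/
def extSeq {m : ℕ} (s : Fin m → ℝ) : Fin (m + 2) → ℝ :=
  Fin.cons 1 (Fin.snoc s 0)

/-- The integrand
`e^{(s₁-1)|ξ|²X} B₁ e^{(s₂-s₁)|ξ|²X} B₂ ⋯ B_m e^{(s_{m+1}-s_m)|ξ|²X} (1 ⊗ v)`. -/
def imIntegrand {d N m : ℕ} (X : UnitAddTorus (Fin d) → Matrix (Fin N) (Fin N) ℂ)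
    (ξ : EuclideanSpace ℝ (Fin d)) (B : Fin m → Sec d N → Sec d N) (v : Fin N → ℂ)
    (s : Fin m → ℝ) : Sec d N :=
  let r : Fin (m + 1) → ℝ := fun j => (extSeq s j.succ - extSeq s j.castSucc) * ‖ξ‖ ^ 2
  (List.ofFn fun (j : Fin m) (g : Sec d N) => expMul X (r j.castSucc) (B j g)).foldr
    (fun T g => T g) (expMul X (r (Fin.last m)) fun _ => v)

/-- `f_m(ξ)[B₁ ⊗ ⋯ ⊗ B_m] v`, a `ℂ^N`-valued function on `𝕋^d`. -/
def imF {d N m : ℕ} (X : UnitAddTorus (Fin d) → Matrix (Fin N) (Fin N) ℂ)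
    (ξ : EuclideanSpace ℝ (Fin d)) (B : Fin m → Sec d N → Sec d N) (v : Fin N → ℂ) : Sec d N :=
  fun t => ∫ s in simplex m, imIntegrand X ξ B v s t

/-- `W_j^𝒜(ξ)` as a matrix-valued differential operator on `𝕋^d`. -/
def imW {d N m : ℕ} {θ : Matrix (Fin d) (Fin d) ℝ}
    (Φ : cTorus θ →⋆ₐ[ℂ] Matrix (Fin N) (Fin N) C(UnitAddTorus (Fin d), ℂ)) (x : smoothTorus θ)
    (a : Fin d → smoothTorus θ) (a₀ : smoothTorus θ) (𝒜 : Finset (Fin m))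
    (ξ : EuclideanSpace ℝ (Fin d)) : Fin m → Sec d N → Sec d N :=
  opW (matMul (matrixAt Φ x)) (fun i => matMul (matrixAt Φ (a i))) (matMul (matrixAt Φ a₀)) torusD
    𝒜 ξ

end

end NCTorus

namespace NCTorus

noncomputable section

variable {d : ℕ} {θ : Matrix (Fin d) (Fin d) ℝ}

/-! ### Smooth elements -/

/-! Both sides are integrals over ξ ∈ ℝ^d of one object: the mapping 𝐓 for the function e^{-t·},
taken at t = |ξ|². It is called `chain` below.

From the left-hand side to `chain`. Since y^{-d/2} = π^{-d/2} ∫ e^{-y|ξ|²} dξ, all derivatives of F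
of order n ≥ k/2 are Gaussian moments up to constants. The Hermite–Genocchi formula
(`divDiff_eq_setIntegral`) then gives F^{[n]} = (-1)^{k/2} π^{-d/2} ∫ |ξ|^{-k} (e^{-|ξ|²·})^{[n]}
dξ, and the choice of the primitive is invisible. A multiple operator integral depends on its symbol
only (`moi_eq_integral`), so it is the same superposition (`moi_divDiff_eq`). The recursion for 𝐓
only adds up finitely many initial values, so the integral passes through it (`bT_eq_integral`). In
polar coordinates c_d^{(ι)} |ξ|^{2m-k} may be replaced by ∏ ξ_{ι(j)} against radial functions, and
summation over ι rebuilds V(ξ) = ∑ ξ_i A_i. The outcome is ∫ |ξ|^{-2m} `chain`(|ξ|²)(W₁(ξ), …,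
W_m(ξ)) dξ (`mainSummand_eq_integral`).

From `chain` to f_m(ξ). The genuine derivations D_i obey on the multiple operator integrals of
e^{-t·} the Leibniz rule that defines 𝐓 (`isLeib_expT`). Hence a formal operator B in the first slot
acts as a genuine one, and y = `chain`(B, Bs) solves y' = -xy - B(`chain`(Bs)) with y(0) = 0
(`hasDerivAt_chain`). Iterating Duhamel's formula yields (-t)^m times the integral over the simplex
of e^{-r₀x} B₁ e^{-r₁x} ⋯ B_m e^{-r_m x} (`smul_setIntegral_heatProd`). For t = |ξ|² the factor
(-|ξ|²)^m cancels |ξ|^{-2m} up to (-1)^m. Evaluation of Φ at a point of the torus is a continuous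
homomorphism and Φ intertwines the derivations, so the integral becomes f_m(ξ).

Local invariants. The transform ∫₀^∞ e^{-iλu} ⋯ du of the same differential equation yields
alternating products of resolvents and operators W (`laplaceChain_ofFn`). So corr_k(s, iλ) is the
half-line Fourier transform of u ↦ ∑ |s|^{-2m} `chain`(|s|²u); inversion at u = 1 identifies
Corr_k(s), and integration over s gives the main formula.

Two devices carry the analysis. A property of families that is stable under sums and negation passes
from the initial values to the recursion (`leib_mem`, `tMap_mem`); continuity, integrability and
decay of all derivatives are treated in this way. Smoothness is obtained without estimates of
Fourier coefficients: a set of elements of the torus that is stable under the derivations consists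
of smooth elements (`mem_smooth_of_coeff`). -/

theorem phase_add_left (l m n : Fin d → ℤ) :
    phase θ l n * phase θ m n = phase θ (l + m) n := by
  simp only [phase, ← Complex.exp_add, ← add_mul, ← Complex.ofReal_add, ← mul_add,
    ← Finset.sum_add_distrib]
  congr 4
  refine Finset.sum_congr rfl fun i _ => Finset.sum_congr rfl fun j _ => ?_
  split_ifs <;> simp [add_mul, mul_add]

theorem phase_add_right (l m n : Fin d → ℤ) :
    phase θ l m * phase θ l n = phase θ l (m + n) := by
  simp only [phase, ← Complex.exp_add, ← add_mul, ← Complex.ofReal_add, ← mul_add,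
    ← Finset.sum_add_distrib]
  congr 4
  refine Finset.sum_congr rfl fun i _ => Finset.sum_congr rfl fun j _ => ?_
  split_ifs <;> simp [mul_add]

theorem phase_ne_zero (m n : Fin d → ℤ) : phase θ m n ≠ 0 := Complex.exp_ne_zero _

theorem U_mul_U (m n : Fin d → ℤ) : U θ m * U θ n = phase θ m n • U θ (m + n) := by
  ext g p
  change phase θ m (p - m) * (phase θ n (p - m - n) * g (p - m - n)) =
    phase θ m n * (phase θ (m + n) (p - (m + n)) * g (p - (m + n)))
  rw [sub_sub, ← mul_assoc, ← mul_assoc, ← phase_add_left, ← mul_assoc, phase_add_right]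
  congr 3
  abel

theorem U_zero : U θ 0 = 1 := by
  ext g p
  change phase θ 0 (p - 0) * g (p - 0) = g p
  simp [phase]

/-- The isometry `U θ m` has a scalar multiple of `U θ (-m)` as a right inverse, and its left
inverse `star (U θ m)` must agree with that. -/
theorem star_U (m : Fin d → ℤ) : star (U θ m) = (phase θ m (-m))⁻¹ • U θ (-m) := by
  have h1 : star (U θ m) * U θ m = 1 := by
    rw [ContinuousLinearMap.star_eq_adjoint, ContinuousLinearMap.mul_def]
    exact (ContinuousLinearMap.norm_map_iff_adjoint_comp_self _).1
      fun g => by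
        unfold U
        rw [LinearIsometry.coe_toContinuousLinearMap, LinearIsometry.norm_map]
  have h2 : U θ m * ((phase θ m (-m))⁻¹ • U θ (-m)) = 1 := by
    rw [mul_smul_comm, U_mul_U, smul_smul, inv_mul_cancel₀ (phase_ne_zero _ _), one_smul,
      add_neg_cancel, U_zero]
  calc star (U θ m) = star (U θ m) * (U θ m * ((phase θ m (-m))⁻¹ • U θ (-m))) := by
        rw [h2, mul_one]
    _ = _ := by rw [← mul_assoc, h1, one_mul]

/-- Products and adjoints of the `U θ m` are scalar multiples of such elements. It follows that
trigonometric polynomials are dense in the torus, so identities between continuous functionals need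
only be checked on the `U θ m`. -/
theorem adjoin_le_span (a : Op d) (ha : a ∈ StarAlgebra.adjoin ℂ (Set.range (U θ))) :
    a ∈ Submodule.span ℂ (Set.range (U θ)) := by
  have hU : ∀ m, U θ m ∈ Submodule.span ℂ (Set.range (U θ)) := fun m =>
    Submodule.subset_span ⟨m, rfl⟩
  induction ha using StarAlgebra.adjoin_induction with
  | mem a ha => exact Submodule.subset_span ha
  | algebraMap r =>
    rw [Algebra.algebraMap_eq_smul_one, ← U_zero (θ := θ)]
    exact Submodule.smul_mem _ _ (hU 0)
  | add a b _ _ ha hb => exact add_mem ha hb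
  | mul a b h1 h2 ha hb =>
    clear h1 h2
    induction ha, hb using Submodule.span_induction₂ with
    | mem_mem a b ha hb =>
      obtain ⟨m, rfl⟩ := ha
      obtain ⟨n, rfl⟩ := hb
      rw [U_mul_U]
      exact Submodule.smul_mem _ _ (hU _)
    | zero_left => simp
    | zero_right => simp
    | add_left a b c _ _ _ h1 h2 => rw [add_mul]; exact add_mem h1 h2
    | add_right a b c _ _ _ h1 h2 => rw [mul_add]; exact add_mem h1 h2
    | smul_left r a b _ _ h => rw [smul_mul_assoc]; exact Submodule.smul_mem _ _ h
    | smul_right r a b _ _ h => rw [mul_smul_comm]; exact Submodule.smul_mem _ _ h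
  | star a h1 ha =>
    clear h1
    induction ha using Submodule.span_induction with
    | mem a ha =>
      obtain ⟨m, rfl⟩ := ha
      rw [star_U]
      exact Submodule.smul_mem _ _ (hU _)
    | zero => simp
    | add a b _ _ h1 h2 => rw [star_add]; exact add_mem h1 h2
    | smul r a _ h => rw [star_smul]; exact Submodule.smul_mem _ _ h

theorem isClosed_cTorus (θ : Matrix (Fin d) (Fin d) ℝ) : IsClosed (cTorus θ : Set (Op d)) :=
  StarSubalgebra.isClosed_topologicalClosure _

theorem U_mem_cTorus (m : Fin d → ℤ) : U θ m ∈ cTorus θ :=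
  StarSubalgebra.le_topologicalClosure _ (StarAlgebra.subset_adjoin ℂ _ ⟨m, rfl⟩)

theorem cTorus_le_closure_span (a : Op d) (ha : a ∈ cTorus θ) :
    a ∈ closure (Submodule.span ℂ (Set.range (U θ)) : Set (Op d)) :=
  closure_mono (fun b hb => adjoin_le_span b hb) ha

/-- Matrix elements of an element of the noncommutative torus in terms of its coefficients. -/
theorem apply_single {a : Op d} (ha : a ∈ cTorus θ) (m p : Fin d → ℤ) :
    a (lp.single 2 m 1) p = phase θ (p - m) m * coeff (p - m) a := by
  let ev : Op d →L[ℂ] ℂ := (innerSL ℂ (lp.single 2 p 1 : L2 d)).comp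
    (ContinuousLinearMap.apply ℂ (L2 d) (lp.single 2 m 1))
  have hev : ∀ b : Op d, ev b = b (lp.single 2 m 1) p := fun b => by
    simp [ev, lp.inner_single_left]
  have key : Set.EqOn ev (phase θ (p - m) m • coeff (p - m) : Op d →L[ℂ] ℂ)
      (Submodule.span ℂ (Set.range (U θ)) : Set (Op d)) := by
    intro b hb
    induction hb using Submodule.span_induction with
    | mem b hb =>
      obtain ⟨q, rfl⟩ := hb
      rw [hev, U_apply, lp.single_apply, _root_.smul_apply, coeff_U, smul_eq_mul]
      by_cases h : p - m = q
      · have h' : p - q = m := by rw [← h]; abel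
        simp [h, h']
      · have h' : p - q ≠ m := fun h' => h (by rw [← h']; abel)
        rw [Pi.single_eq_of_ne h', if_neg h, mul_zero, mul_zero]
    | zero => simp
    | add b c _ _ h1 h2 => rw [map_add, map_add, h1, h2]
    | smul r b _ h => rw [map_smul, map_smul, h]
  have := key.closure ev.continuous (phase θ (p - m) m • coeff (p - m) : Op d →L[ℂ] ℂ).continuous
    (cTorus_le_closure_span a ha)
  rwa [hev] at this

/-- The Fourier coefficients determine the elements of the noncommutative torus. -/
theorem eq_of_coeff {a b : Op d} (ha : a ∈ cTorus θ) (hb : b ∈ cTorus θ)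
    (h : ∀ n, coeff n a = coeff n b) : a = b := by
  refine lp.ext_continuousLinearMap (by norm_num) fun m => ?_
  ext
  rename_i p
  simp [apply_single ha, apply_single hb, h]

/-- A subset of the noncommutative torus on which all derivations act (in terms of the Fourier
coefficients) consists of smooth elements. -/
theorem mem_smooth_of_coeff {S : Set (Op d)} (hS : ∀ a ∈ S, a ∈ cTorus θ)
    (h : ∀ a ∈ S, ∀ i, ∃ a' ∈ S, ∀ n, (n i : ℂ) * coeff n a = coeff n a') {a : Op d}
    (ha : a ∈ S) : a ∈ smoothTorus θ := by
  refine ⟨hS a ha, fun α => ?_⟩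
  have h1 : ∀ (i : Fin d) (k : ℕ), ∀ a ∈ S, ∃ a' ∈ S, ∀ n,
      (n i : ℂ) ^ k * coeff n a = coeff n a' := by
    intro i k
    induction k with
    | zero => exact fun a ha => ⟨a, ha, by simp⟩
    | succ k ih =>
      intro a ha
      obtain ⟨a', ha', e'⟩ := ih a ha
      obtain ⟨a'', ha'', e''⟩ := h a' ha' i
      exact ⟨a'', ha'', fun n => by rw [← e'', ← e', pow_succ']; ring⟩
  have h2 : ∀ s : Finset (Fin d), ∃ a' ∈ S, ∀ n,
      (∏ i ∈ s, (n i : ℂ) ^ α i) * coeff n a = coeff n a' := by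
    intro s
    induction s using Finset.induction_on with
    | empty => exact ⟨a, ha, by simp⟩
    | insert i s hi ih =>
      obtain ⟨a', ha', e'⟩ := ih
      obtain ⟨a'', ha'', e''⟩ := h1 i (α i) a' ha'
      exact ⟨a'', ha'', fun n => by rw [← e'', ← e', Finset.prod_insert hi]; ring⟩
  obtain ⟨a', -, e⟩ := h2 Finset.univ
  -- The coefficients of a bounded operator `a'` are those of the vector `a' (vac d)` of ℓ², so
  -- square summability is automatic.
  have : (fun n : Fin d → ℤ => (∏ i, (n i : ℂ) ^ α i) * coeff n a) =
      fun n => a' (vac d) n := by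
    funext n
    rw [e, coeff_apply]
  rw [this]
  exact lp.memℓp _

theorem derivOp_eq {a a' : Op d} (ha : a ∈ smoothTorus θ) (ha' : a' ∈ cTorus θ) {i : Fin d}
    (h : ∀ n, (n i : ℂ) * coeff n a = coeff n a') : derivOp θ i a = a' :=
  eq_of_coeff (deriv_mem i ha).1 ha' fun n => by rw [coeff_deriv i ha, h]

/-- The product ∏ (1 + n_j²) expands into the monomials with exponent 2 on a subset of the indices,
each of which stays bounded after multiplication by the coefficients; the reciprocal of the product
is summable. -/
theorem summable_coeff {a : Op d} (ha : a ∈ smoothTorus θ) :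
    Summable fun n : Fin d → ℤ => coeff n a • U θ n := by
  have hb : ∀ α : Fin d → ℕ, ∃ C : ℝ, ∀ n : Fin d → ℤ,
      ‖(∏ i, (n i : ℂ) ^ α i) * coeff n a‖ ≤ C := fun α => by
    obtain ⟨C, hC⟩ := ((ha.2 α).of_exponent_ge le_top).bddAbove
    exact ⟨C, fun n => hC ⟨n, rfl⟩⟩
  choose C hC using hb
  let e : Finset (Fin d) → Fin d → ℕ := fun s j => if j ∈ s then 2 else 0
  refine Summable.of_norm_bounded
    ((summable_weight d).mul_left (∑ s ∈ (Finset.univ : Finset (Fin d)).powerset, C (e s)))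
    fun n => ?_
  have hw : 0 < ∏ j, (1 + (n j : ℝ) ^ 2) := Finset.prod_pos fun _ _ => by positivity
  rw [Finset.prod_inv_distrib, ← div_eq_mul_inv, le_div_iff₀ hw, norm_smul]
  calc ‖coeff n a‖ * ‖U θ n‖ * ∏ j, (1 + (n j : ℝ) ^ 2)
      ≤ ‖coeff n a‖ * 1 * ∏ j, (1 + (n j : ℝ) ^ 2) := by
        gcongr
        exact norm_U_le θ n
    _ = ∑ s ∈ (Finset.univ : Finset (Fin d)).powerset,
          ‖(∏ j, (n j : ℂ) ^ e s j) * coeff n a‖ := by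
        rw [Finset.prod_one_add, Finset.mul_sum]
        refine Finset.sum_congr rfl fun s _ => ?_
        simp only [e, norm_mul, norm_prod, norm_pow, pow_ite, pow_zero, Finset.prod_ite_mem,
          Finset.univ_inter]
        simp
        ring
    _ ≤ _ := Finset.sum_le_sum fun s _ => hC (e s) n

theorem hasSum_coeff {a : Op d} (ha : a ∈ smoothTorus θ) :
    HasSum (fun n : Fin d → ℤ => coeff n a • U θ n) a := by
  have hs := summable_coeff ha
  convert hs.hasSum using 1
  refine eq_of_coeff ha.1 ((isClosed_cTorus θ).mem_of_tendsto hs.hasSum (.of_forall fun s =>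
    sum_mem fun n _ => (cTorus θ).smul_mem (U_mem_cTorus n) _)) fun n => ?_
  rw [(coeff n).map_tsum hs, tsum_eq_single n]
  · simp [coeff_U]
  · intro m hm
    simp [coeff_U, hm.symm]

theorem hasSum_coeff_mul {a : Op d} (ha : a ∈ smoothTorus θ) (b : Op d) (n : Fin d → ℤ) :
    HasSum (fun m : Fin d → ℤ => coeff m a * (phase θ m (n - m) * coeff (n - m) b))
      (coeff n (a * b)) := by
  refine (((hasSum_coeff ha).mul_right b).mapL (coeff n)).congr_fun fun m => ?_
  rw [smul_mul_assoc, map_smul, smul_eq_mul, coeff_apply n, coeff_apply (n - m)]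
  rfl

/-- In the twisted convolution n_i splits as m_i + (n - m)_i. The rule is stated for coefficients
because `a * b` is not yet known to be smooth. -/
theorem coeff_mul_leibniz {a b : Op d} (ha : a ∈ smoothTorus θ) (hb : b ∈ smoothTorus θ)
    (i : Fin d) (n : Fin d → ℤ) : (n i : ℂ) * coeff n (a * b) =
      coeff n (derivOp θ i a * b + a * derivOp θ i b) := by
  rw [map_add]
  refine HasSum.unique ((hasSum_coeff_mul ha b n).mul_left _) ?_
  refine ((hasSum_coeff_mul (deriv_mem i ha) b n).add
    (hasSum_coeff_mul ha (derivOp θ i b) n)).congr_fun fun m => ?_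
  rw [coeff_deriv i ha, coeff_deriv i hb]
  simp only [Pi.sub_apply, Int.cast_sub]
  ring

/-- If every derivation maps `G` into the additive group generated by `G` (in terms of the Fourier
coefficients), then `G` consists of smooth elements. -/
theorem mem_smooth_of_coeff_closure {G : Set (Op d)} (hG : ∀ a ∈ G, a ∈ cTorus θ)
    (h : ∀ a ∈ G, ∀ i, ∃ a' ∈ AddSubgroup.closure G, ∀ n, (n i : ℂ) * coeff n a = coeff n a')
    {a : Op d} (ha : a ∈ G) : a ∈ smoothTorus θ := by
  refine mem_smooth_of_coeff (S := AddSubgroup.closure G) (fun c hc => ?_) (fun c hc i => ?_)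
    (AddSubgroup.subset_closure ha)
  · induction hc using AddSubgroup.closure_induction with
    | mem c hc => exact hG c hc
    | zero => exact zero_mem _
    | add a b _ _ ha hb => exact add_mem ha hb
    | neg a _ ha => exact neg_mem ha
  · change c ∈ AddSubgroup.closure G at hc
    change ∃ a' ∈ AddSubgroup.closure G, _
    induction hc using AddSubgroup.closure_induction with
    | mem c hc => exact h c hc i
    | zero => exact ⟨0, zero_mem _, by simp⟩
    | add a b _ _ ha hb =>
      obtain ⟨a', ha', ea⟩ := ha
      obtain ⟨b', hb', eb⟩ := hb
      exact ⟨a' + b', add_mem ha' hb', fun n => by rw [map_add, map_add, mul_add, ea, eb]⟩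
    | neg a _ ha =>
      obtain ⟨a', ha', ea⟩ := ha
      exact ⟨-a', neg_mem ha', fun n => by rw [map_neg, map_neg, mul_neg, ea]⟩

/-- By the Leibniz rule the derivations turn products of smooth elements into sums of such products,
which is all that the criterion above asks for. -/
theorem mul_mem_smooth {a b : Op d} (ha : a ∈ smoothTorus θ) (hb : b ∈ smoothTorus θ) :
    a * b ∈ smoothTorus θ := by
  let G : Set (Op d) := {c | ∃ a ∈ smoothTorus θ, ∃ b ∈ smoothTorus θ, a * b = c}
  refine mem_smooth_of_coeff_closure (G := G) ?_ ?_ ⟨a, ha, b, hb, rfl⟩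
  · rintro _ ⟨a, ha, b, hb, rfl⟩
    exact mul_mem ha.1 hb.1
  · rintro _ ⟨a, ha, b, hb, rfl⟩ i
    have h1 : derivOp θ i a * b ∈ G := ⟨_, deriv_mem i ha, b, hb, rfl⟩
    have h2 : a * derivOp θ i b ∈ G := ⟨a, ha, _, deriv_mem i hb, rfl⟩
    exact ⟨_, add_mem (AddSubgroup.subset_closure h1) (AddSubgroup.subset_closure h2),
      coeff_mul_leibniz ha hb i⟩

theorem one_mem_smooth : (1 : Op d) ∈ smoothTorus θ := by
  refine mem_smooth_of_coeff (S := {0, 1}) ?_ ?_ (Or.inr rfl)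
  · rintro a (rfl | rfl)
    exacts [zero_mem _, one_mem _]
  · rintro a (rfl | rfl) i
    · exact ⟨0, Or.inl rfl, by simp⟩
    · refine ⟨0, Or.inl rfl, fun n => ?_⟩
      rw [← U_zero (θ := θ), coeff_U]
      split_ifs with h
      · simp [h]
      · simp

/-- Only a product and a unit are declared; distributivity and scalar compatibility are taken from
`Op d` or from the linearity of `lmul`. -/
instance : Mul (smoothTorus θ) := ⟨fun a b => ⟨a * b, mul_mem_smooth a.2 b.2⟩⟩

instance : One (smoothTorus θ) := ⟨⟨1, one_mem_smooth⟩⟩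

@[simp] theorem coe_mul (a b : smoothTorus θ) : ((a * b : smoothTorus θ) : Op d) = a * b := rfl

@[simp] theorem coe_one : ((1 : smoothTorus θ) : Op d) = 1 := rfl

theorem D_mul (i : Fin d) (a b : smoothTorus θ) : D θ i (a * b) = D θ i a * b + a * D θ i b := by
  ext1
  exact derivOp_eq (a * b).2 (D θ i a * b + a * D θ i b).2.1 fun n =>
    coeff_mul_leibniz a.2 b.2 i n

theorem D_one (i : Fin d) : D θ i 1 = 0 := by
  ext1
  refine derivOp_eq one_mem_smooth (zero_mem _) fun n => ?_
  rw [← U_zero (θ := θ), coeff_U]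
  split_ifs with h
  · simp [h]
  · simp

/-- Left multiplication by `b`. -/
def lmul (b : smoothTorus θ) : smoothTorus θ →ₗ[ℂ] smoothTorus θ where
  toFun g := b * g
  map_add' g h := by ext1; simp [mul_add]
  map_smul' c g := by ext1; simp

@[simp] theorem lmul_apply (b g : smoothTorus θ) : lmul b g = b * g := rfl

/-! ### Integrals of families in the noncommutative torus -/

/-- In the quotient by the closed subspace the integrand vanishes. A family that is not integrable
has integral 0 by convention. -/
theorem integral_mem_of_isClosed {E Ω : Type*} [NormedAddCommGroup E] [NormedSpace ℂ E]
    [CompleteSpace E] [MeasurableSpace Ω] {μ : Measure Ω} {S : Submodule ℂ E}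
    (hS : IsClosed (S : Set E)) {f : Ω → E} (hf : ∀ p, f p ∈ S) : ∫ p, f p ∂μ ∈ S := by
  by_cases hi : Integrable f μ
  · have : IsClosed (S : Set E) := hS
    rw [← Submodule.ker_mkQ S, LinearMap.mem_ker]
    have h := (S.mkQL).integral_comp_comm hi
    have h0 : ∀ p, S.mkQL (f p) = 0 := fun p => (Submodule.Quotient.mk_eq_zero S).2 (hf p)
    simp only [h0, integral_zero] at h
    exact h.symm
  · rw [integral_undef hi]
    exact zero_mem _

theorem integral_mem_cTorus {Ω : Type*} [MeasurableSpace Ω] {μ : Measure Ω} {f : Ω → Op d}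
    (hf : ∀ p, f p ∈ cTorus θ) : ∫ p, f p ∂μ ∈ cTorus θ :=
  integral_mem_of_isClosed (S := Subalgebra.toSubmodule (cTorus θ).toSubalgebra)
    (isClosed_cTorus θ) hf

/-- The composition of the derivations `D_i` with `i` in the list `L`. -/
def DSeq (L : List (Fin d)) : smoothTorus θ →ₗ[ℂ] smoothTorus θ :=
  L.foldr (fun i T => D θ i ∘ₗ T) LinearMap.id

@[simp] theorem DSeq_nil (g : smoothTorus θ) : DSeq [] g = g := rfl

@[simp] theorem DSeq_cons (i : Fin d) (L : List (Fin d)) (g : smoothTorus θ) :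
    DSeq (i :: L) g = D θ i (DSeq L g) := rfl

theorem DSeq_concat (L : List (Fin d)) (i : Fin d) (g : smoothTorus θ) :
    DSeq (L ++ [i]) g = DSeq L (D θ i g) := by
  induction L with
  | nil => rfl
  | cons j L ih => rw [List.cons_append, DSeq_cons, ih, DSeq_cons]

/-- All derivatives of the family `g` are integrable in norm. -/
def SmoothIntegrable {Ω : Type*} [MeasurableSpace Ω] (μ : Measure Ω) (g : Ω → smoothTorus θ) :
    Prop := ∀ L : List (Fin d), Integrable (fun p => (DSeq L (g p) : Op d)) μ

theorem SmoothIntegrable.integrable {Ω : Type*} [MeasurableSpace Ω] {μ : Measure Ω}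
    {g : Ω → smoothTorus θ} (hg : SmoothIntegrable μ g) : Integrable (fun p => (g p : Op d)) μ :=
  hg []

theorem SmoothIntegrable.deriv {Ω : Type*} [MeasurableSpace Ω] {μ : Measure Ω}
    {g : Ω → smoothTorus θ} (hg : SmoothIntegrable μ g) (i : Fin d) :
    SmoothIntegrable μ fun p => D θ i (g p) := fun L => by
  simpa only [DSeq_concat] using hg (L ++ [i])

theorem coeff_integral_deriv {Ω : Type*} [MeasurableSpace Ω] {μ : Measure Ω}
    {g : Ω → smoothTorus θ} (hg : SmoothIntegrable μ g) (i : Fin d) (n : Fin d → ℤ) :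
    (n i : ℂ) * coeff n (∫ p, (g p : Op d) ∂μ) = coeff n (∫ p, (D θ i (g p) : Op d) ∂μ) := by
  rw [← (coeff n).integral_comp_comm hg.integrable, ← integral_const_mul,
    ← (coeff n).integral_comp_comm (hg.deriv i).integrable]
  exact integral_congr_ae (.of_forall fun p => (coeff_deriv i (g p).2 n).symm)

/-- The integrals of all such families form a set that is stable under the derivations, because
coefficient functionals commute with the integral. -/
theorem SmoothIntegrable.mem {Ω : Type*} [MeasurableSpace Ω] {μ : Measure Ω}
    {g : Ω → smoothTorus θ} (hg : SmoothIntegrable μ g) :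
    ∫ p, (g p : Op d) ∂μ ∈ smoothTorus θ := by
  refine mem_smooth_of_coeff
    (S := {c | ∃ g : Ω → smoothTorus θ, SmoothIntegrable μ g ∧ ∫ p, (g p : Op d) ∂μ = c})
    ?_ ?_ ⟨g, hg, rfl⟩
  · rintro _ ⟨g, -, rfl⟩
    exact integral_mem_cTorus fun p => (g p).2.1
  · rintro _ ⟨g, hg, rfl⟩ i
    exact ⟨_, ⟨_, hg.deriv i, rfl⟩, coeff_integral_deriv hg i⟩

theorem SmoothIntegrable.D_integral {Ω : Type*} [MeasurableSpace Ω] {μ : Measure Ω}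
    {g : Ω → smoothTorus θ} (hg : SmoothIntegrable μ g) (i : Fin d) :
    D θ i ⟨_, hg.mem⟩ = ⟨_, (hg.deriv i).mem⟩ := by
  ext1
  exact derivOp_eq hg.mem (hg.deriv i).mem.1 (coeff_integral_deriv hg i)

theorem SmoothIntegrable.DSeq_integral {Ω : Type*} [MeasurableSpace Ω] {μ : Measure Ω}
    {g : Ω → smoothTorus θ} (hg : SmoothIntegrable μ g) (L : List (Fin d)) :
    (DSeq L ⟨_, hg.mem⟩ : Op d) = ∫ p, (DSeq L (g p) : Op d) ∂μ := by
  induction L using List.reverseRecOn generalizing g with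
  | nil => rfl
  | append_singleton L i ih =>
    simp only [DSeq_concat]
    rw [hg.D_integral, ih (hg.deriv i)]

end

end NCTorus

namespace NCTorus

noncomputable section

variable {d : ℕ} {θ : Matrix (Fin d) (Fin d) ℝ}

/-! ### The recursive mappings with values in an arbitrary group -/

section Recursion

variable {M M' : Type*} [AddCommGroup M] [AddCommGroup M']

/-- `leibniz` for maps with values in an arbitrary commutative group. -/
def leib (x : smoothTorus θ) (i : Fin d) :
    (List (smoothTorus θ) → M) → List (smoothTorus θ) → M
  | K, [] => K [D θ i x]
  | K, b :: w => K (D θ i x :: b :: w) + K (D θ i b :: w) + leib x i (fun w' => K (b :: w')) w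

theorem leibniz_eq_leib (x : smoothTorus θ) (i : Fin d) (K : List (smoothTorus θ) → Op d) :
    leibniz θ x i K = leib x i K := by
  funext w
  induction w generalizing K with
  | nil => rfl
  | cons b w ih => simp only [leibniz, leib, ih]

/-- Only additions of values of `K` occur in the recursion. Evaluation at a parameter,
multiplication by a fixed element, D_j and the inclusion into `Op d` are all used as `φ`. -/
theorem map_leib (φ : M →+ M') (x : smoothTorus θ) (i : Fin d) (K : List (smoothTorus θ) → M)
    (w : List (smoothTorus θ)) : φ (leib x i K w) = leib x i (fun w => φ (K w)) w := by
  induction w generalizing K with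
  | nil => rfl
  | cons b w ih => simp only [leib, ih, map_add]

theorem leib_add (x : smoothTorus θ) (i : Fin d) (K K' : List (smoothTorus θ) → M)
    (w : List (smoothTorus θ)) :
    leib x i (fun w => K w + K' w) w = leib x i K w + leib x i K' w := by
  induction w generalizing K K' with
  | nil => rfl
  | cons b w ih =>
    simp only [leib, ih]
    abel

theorem leib_comm (x : smoothTorus θ) (i j : Fin d) (K : List (smoothTorus θ) → M) :
    leib x i (leib x j K) = leib x j (leib x i K) := by
  funext w
  induction w generalizing K with
  | nil =>
    simp only [leib, D_comm i j]
    abel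
  | cons b w ih =>
    simp only [leib, leib_add, ih, D_comm i j]
    abel

/-- The recursion evaluates `K` only at lists that are at least as long as the given one. With `M` a
group of families and `S` those having some analytic property, this transfers the property; the
lower bound `n` matters when it holds only for enough arguments. -/
theorem leib_mem {S : AddSubgroup M} {n : ℕ} (x : smoothTorus θ) (i : Fin d)
    {K : List (smoothTorus θ) → M} (hK : ∀ w, n ≤ w.length → K w ∈ S)
    {w : List (smoothTorus θ)} (hw : n ≤ w.length) : leib x i K w ∈ S := by
  induction w generalizing K n with
  | nil => exact hK _ (hw.trans (by simp))
  | cons b w ih =>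
    -- The map `K (b :: ·)` sees lists that are shorter by one, hence the bound `n - 1`; the
    -- truncated subtraction covers `n = 0`.
    refine add_mem (add_mem (hK _ (hw.trans (by simp))) (hK _ (by simpa using hw)))
      (ih (n := n - 1) (fun w' hw' => hK _ ?_) ?_)
    · rw [List.length_cons]; omega
    · rw [List.length_cons] at hw; omega

/-- `leib` for a sequence of indices. -/
def leibSeq (x : smoothTorus θ) (L : List (Fin d)) (K : List (smoothTorus θ) → M) :
    List (smoothTorus θ) → M := L.foldr (leib x) K

theorem map_leibSeq (φ : M →+ M') (x : smoothTorus θ) (L : List (Fin d))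
    (K : List (smoothTorus θ) → M) (w : List (smoothTorus θ)) :
    φ (leibSeq x L K w) = leibSeq x L (fun w => φ (K w)) w := by
  induction L generalizing w with
  | nil => rfl
  | cons i L ih =>
    change φ (leib x i (leibSeq x L K) w) = leib x i (leibSeq x L fun w => φ (K w)) w
    rw [map_leib]
    congr 1
    funext w
    exact ih w

theorem leibSeq_add (x : smoothTorus θ) (L : List (Fin d)) (K K' : List (smoothTorus θ) → M)
    (w : List (smoothTorus θ)) :
    leibSeq x L (fun w => K w + K' w) w = leibSeq x L K w + leibSeq x L K' w := by
  induction L generalizing w with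
  | nil => rfl
  | cons i L ih =>
    change leib x i (leibSeq x L fun w => K w + K' w) w = leib x i _ w + leib x i _ w
    rw [← leib_add]
    congr 1
    funext w
    exact ih w

theorem leibSeq_mem {S : AddSubgroup M} {n : ℕ} (x : smoothTorus θ) (L : List (Fin d))
    {K : List (smoothTorus θ) → M} (hK : ∀ w, n ≤ w.length → K w ∈ S)
    {w : List (smoothTorus θ)} (hw : n ≤ w.length) : leibSeq x L K w ∈ S := by
  induction L generalizing w with
  | nil => exact hK w hw
  | cons i L ih => exact leib_mem x i (fun w' hw' => ih hw') hw

/-- The multi-index `α` as a sequence of indices. -/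
def idx (α : Fin d → ℕ) : List (Fin d) :=
  (List.finRange d).flatMap fun i => List.replicate (α i) i

theorem foldr_idx {X : Type*} (T : Fin d → X → X) (α : Fin d → ℕ) (z : X) :
    (idx α).foldr T z = (List.finRange d).foldr (fun i z => (T i)^[α i] z) z := by
  have hrep : ∀ (i : Fin d) (k : ℕ) (z : X), (List.replicate k i).foldr T z = (T i)^[k] z := by
    intro i k z
    induction k with
    | zero => rfl
    | succ k ih => rw [List.replicate_succ, List.foldr_cons, ih, Function.iterate_succ_apply']
  unfold idx
  induction List.finRange d with
  | nil => rfl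
  | cons i L ih => rw [List.flatMap_cons, List.foldr_append, ih, hrep, List.foldr_cons]

theorem idx_zero : idx (0 : Fin d → ℕ) = [] := by
  simp [idx]

theorem idx_single (i : Fin d) (k : ℕ) : idx (Pi.single i k) = List.replicate k i := by
  have : ∀ L : List (Fin d), L.Nodup →
      L.flatMap (fun j => List.replicate ((Pi.single i k : Fin d → ℕ) j) j) =
        if i ∈ L then List.replicate k i else [] := by
    intro L hL
    induction L with
    | nil => rfl
    | cons j L ih =>
      rw [List.nodup_cons] at hL
      rw [List.flatMap_cons, ih hL.2]
      by_cases h : i = j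
      · subst h
        simp [hL.1]
      · rw [Pi.single_eq_of_ne (Ne.symm h)]
        simp [h]
  simpa [idx] using this _ (List.nodup_finRange d)

/-- The recursive mappings `𝐓` with initial values `K` in an arbitrary commutative group. -/
def tMap (x : smoothTorus θ) (K : List (smoothTorus θ) → M) :
    List (FormalOp θ) → List (smoothTorus θ) → M
  | [], w => K w
  | B :: Bs, w => B.sum fun α b => leibSeq x (idx α) (fun w' => tMap x K Bs (b :: w')) w

/-- The list `idx α` runs through the indices in the order in which `leibnizPow` applies them. -/
theorem bTAux_eq_tMap (f : ℝ → ℝ) (x : smoothTorus θ) (Bs : List (FormalOp θ))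
    (w : List (smoothTorus θ)) :
    bTAux θ f x Bs w = tMap x (fun w =>
      moi (x : Op d) (fun α => ((divDiff w.length f α : ℝ) : ℂ)) fun j => (w.get j : Op d)) Bs w := by
  induction Bs generalizing w with
  | nil => rfl
  | cons B Bs ih =>
    have h : ∀ i, (leibniz θ x i) = leib (M := Op d) x i := fun i =>
      funext (leibniz_eq_leib x i)
    simp only [bTAux, tMap, leibnizPow, leibSeq, foldr_idx, ih, h]

theorem map_tMap (φ : M →+ M') (x : smoothTorus θ) (K : List (smoothTorus θ) → M)
    (Bs : List (FormalOp θ)) (w : List (smoothTorus θ)) :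
    φ (tMap x K Bs w) = tMap x (fun w => φ (K w)) Bs w := by
  induction Bs generalizing w with
  | nil => rfl
  | cons B Bs ih => simp only [tMap, Finsupp.sum, map_sum, map_leibSeq, ih]

/-- Each formal operator leaves its coefficient as one more argument, and derivations never shorten
the list; so `K` is only evaluated at lists of length at least `Bs.length + w.length`. -/
theorem tMap_mem {S : AddSubgroup M} {n : ℕ} (x : smoothTorus θ)
    {K : List (smoothTorus θ) → M} (hK : ∀ w, n ≤ w.length → K w ∈ S)
    {Bs : List (FormalOp θ)} {w : List (smoothTorus θ)} (hw : n ≤ Bs.length + w.length) :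
    tMap x K Bs w ∈ S := by
  induction Bs generalizing w with
  | nil => exact hK w (by simpa using hw)
  | cons B Bs ih =>
    refine sum_mem fun α _ => leibSeq_mem (n := w.length) x _ (fun w' hw' => ih ?_) le_rfl
    rw [List.length_cons] at hw ⊢
    omega

theorem tMap_eval {Ω : Type*} (x : smoothTorus θ) (K : Ω → List (smoothTorus θ) → M)
    (Bs : List (FormalOp θ)) (w : List (smoothTorus θ)) (p : Ω) :
    tMap x (fun w p => K p w) Bs w p = tMap x (K p) Bs w :=
  map_tMap (Pi.evalAddMonoidHom (fun _ : Ω => M) p) x (fun w p => K p w) Bs w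

/-- A relation between a family and a second object, such as its derivative or its integral, is a
subgroup of pairs. Running the recursion on pairs and projecting transfers the relation. -/
theorem tMap_pair_fst {Ω : Type*} (x : smoothTorus θ) (K : Ω → List (smoothTorus θ) → M)
    (K' : List (smoothTorus θ) → M') (Bs : List (FormalOp θ)) (w : List (smoothTorus θ)) (p : Ω) :
    (tMap x (fun w => ((fun p => K p w, K' w) : (Ω → M) × M')) Bs w).1 p = tMap x (K p) Bs w :=
  map_tMap (M := (Ω → M) × M') ((Pi.evalAddMonoidHom (fun _ : Ω => M) p).comp
    (AddMonoidHom.fst (Ω → M) M')) x (fun w => (fun p => K p w, K' w)) Bs w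

theorem tMap_pair_snd {Ω : Type*} (x : smoothTorus θ) (K : Ω → List (smoothTorus θ) → M)
    (K' : List (smoothTorus θ) → M') (Bs : List (FormalOp θ)) (w : List (smoothTorus θ)) :
    (tMap x (fun w => ((fun p => K p w, K' w) : (Ω → M) × M')) Bs w).2 = tMap x K' Bs w :=
  map_tMap (AddMonoidHom.snd (Ω → M) M') x (fun w => (fun p => K p w, K' w)) Bs w

theorem leib_pair_fst {Ω : Type*} (x : smoothTorus θ) (i : Fin d)
    (K : Ω → List (smoothTorus θ) → M)
    (K' : List (smoothTorus θ) → M') (w : List (smoothTorus θ)) (p : Ω) :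
    (leib x i (fun w => ((fun p => K p w, K' w) : (Ω → M) × M')) w).1 p = leib x i (K p) w :=
  map_leib (M := (Ω → M) × M') ((Pi.evalAddMonoidHom (fun _ : Ω => M) p).comp
    (AddMonoidHom.fst (Ω → M) M')) x i (fun w => (fun p => K p w, K' w)) w

theorem leib_pair_snd {Ω : Type*} (x : smoothTorus θ) (i : Fin d)
    (K : Ω → List (smoothTorus θ) → M)
    (K' : List (smoothTorus θ) → M') (w : List (smoothTorus θ)) :
    (leib x i (fun w => ((fun p => K p w, K' w) : (Ω → M) × M')) w).2 = leib x i K' w :=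
  map_leib (AddMonoidHom.snd (Ω → M) M') x i (fun w => (fun p => K p w, K' w)) w

theorem leib_smul (x : smoothTorus θ) (i : Fin d) [Module ℂ M] (c : ℂ)
    (K : List (smoothTorus θ) → M) (w : List (smoothTorus θ)) :
    leib x i (fun w => c • K w) w = c • leib x i K w :=
  (map_leib (DistribSMul.toAddMonoidHom M c) x i K w).symm

end Recursion

/-! ### Formal operators acting as genuine ones -/

/-- The differential operator given by a formal one. -/
def act (B : FormalOp θ) : smoothTorus θ →ₗ[ℂ] smoothTorus θ :=
  B.sum fun α b => lmul b ∘ₗ DSeq (idx α)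

theorem act_apply (B : FormalOp θ) (g : smoothTorus θ) :
    act B g = B.sum fun α b => b * DSeq (idx α) g := by
  simp [act, Finsupp.sum]

/-- The derivations act on the values of `K` by the Leibniz rule for `𝐓`. -/
def IsLeib (x : smoothTorus θ) (K : List (smoothTorus θ) → smoothTorus θ) : Prop :=
  ∀ i w, D θ i (K w) = leib x i K w

/-- D_i moves inside by additivity, becomes `leib` there, and the two `leib` commute. -/
theorem IsLeib.leib {x : smoothTorus θ} {K : List (smoothTorus θ) → smoothTorus θ}
    (hK : IsLeib x K) (j : Fin d) : IsLeib x (leib x j K) := fun i w => by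
  have : D θ i (NCTorus.leib x j K w) = NCTorus.leib x j (fun w => D θ i (K w)) w :=
    map_leib (D θ i).toAddMonoidHom x j K w
  rw [this, leib_comm]
  congr 1
  funext w
  exact hK i w

theorem IsLeib.leibSeq {x : smoothTorus θ} {K : List (smoothTorus θ) → smoothTorus θ}
    (hK : IsLeib x K) (L : List (Fin d)) : IsLeib x (leibSeq x L K) := by
  induction L with
  | nil => exact hK
  | cons i L ih => exact ih.leib i

theorem IsLeib.DSeq_eq {x : smoothTorus θ} {K : List (smoothTorus θ) → smoothTorus θ}
    (hK : IsLeib x K) (L : List (Fin d)) (w : List (smoothTorus θ)) :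
    DSeq L (K w) = NCTorus.leibSeq x L K w := by
  induction L with
  | nil => rfl
  | cons i L ih =>
    rw [DSeq_cons, ih]
    exact hK.leibSeq L i w

/-- A first order recursion in the leftmost argument of `K` extends to formal operators. -/
theorem IsLeib.tMap_concat {M : Type*} [AddCommGroup M] {x : smoothTorus θ}
    {K : List (smoothTorus θ) → smoothTorus θ} (hK : IsLeib x K)
    {K₀ : List (smoothTorus θ) → M} (φ ψ : smoothTorus θ →+ M)
    (h : ∀ b w, K₀ (b :: w) = φ (K (b :: w)) + ψ (b * K w))
    (B : FormalOp θ) (Bs : List (FormalOp θ)) (w : List (smoothTorus θ)) :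
    tMap x K₀ (Bs ++ [B]) w = φ (tMap x K (Bs ++ [B]) w) + ψ (act B (tMap x K Bs w)) := by
  induction Bs generalizing w with
  | nil =>
    simp only [List.nil_append, tMap, h, leibSeq_add, Finsupp.sum, Finset.sum_add_distrib,
      act_apply, map_sum, map_leibSeq]
    congr 1
    refine Finset.sum_congr rfl fun α _ => ?_
    -- This is where formal derivatives become genuine: the derivations of `B`, applied by `leibSeq`
    -- to the argument list of `K`, differentiate the value of `K`.
    rw [hK.DSeq_eq]
    exact (map_leibSeq (ψ.comp (lmul (B α)).toAddMonoidHom) x _ K w).symm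
  | cons B' Bs ih =>
    simp only [List.cons_append, tMap, ih, leibSeq_add, Finsupp.sum, Finset.sum_add_distrib,
      map_sum]
    congr 1
    · exact Finset.sum_congr rfl fun α _ => (map_leibSeq φ x _ _ w).symm
    · exact Finset.sum_congr rfl fun α _ =>
        (map_leibSeq (ψ.comp (act B).toAddMonoidHom) x _ _ w).symm

/-- If the Leibniz rule for `𝐓` holds for the coefficients of the values of `K`, then these values
are smooth. -/
theorem smooth_of_coeff_leib {x : smoothTorus θ} {n : ℕ} {K : List (smoothTorus θ) → Op d}
    (hc : ∀ w, n ≤ w.length → K w ∈ cTorus θ)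
    (h : ∀ w, n ≤ w.length → ∀ i p, (p i : ℂ) * coeff p (K w) = coeff p (leib x i K w))
    {w : List (smoothTorus θ)} (hw : n ≤ w.length) : K w ∈ smoothTorus θ := by
  let G : Set (Op d) := {c | ∃ w, n ≤ w.length ∧ K w = c}
  have hG : ∀ w, n ≤ w.length → K w ∈ AddSubgroup.closure G := fun w hw =>
    AddSubgroup.subset_closure (show K w ∈ G from ⟨w, hw, rfl⟩)
  refine mem_smooth_of_coeff_closure (G := G) ?_ ?_ ⟨w, hw, rfl⟩
  · rintro _ ⟨w, hw, rfl⟩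
    exact hc w hw
  · rintro _ ⟨w, hw, rfl⟩ i
    exact ⟨_, leib_mem x i hG hw, h w hw i⟩

theorem derivOp_eq_leib {x : smoothTorus θ} {n : ℕ} {K : List (smoothTorus θ) → Op d}
    (hc : ∀ w, n ≤ w.length → K w ∈ cTorus θ)
    (h : ∀ w, n ≤ w.length → ∀ i p, (p i : ℂ) * coeff p (K w) = coeff p (leib x i K w))
    {w : List (smoothTorus θ)} (hw : n ≤ w.length) (i : Fin d) :
    derivOp θ i (K w) = leib x i K w :=
  derivOp_eq (smooth_of_coeff_leib hc h hw)
    (leib_mem (S := (cTorus θ).toSubalgebra.toSubring.toAddSubgroup) x i hc hw) (h w hw i)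

/-! ### Limits, derivatives and integrals of the recursive mappings -/

section Analysis

variable {E : Type*} [NormedAddCommGroup E] [NormedSpace ℂ E]

/-- Pairs consisting of a function and its derivative form a subgroup. -/
theorem tMap_hasDerivAt (x : smoothTorus θ) {K K' : ℝ → List (smoothTorus θ) → E}
    (h : ∀ w t, HasDerivAt (fun t => K t w) (K' t w) t) (Bs : List (FormalOp θ))
    (w : List (smoothTorus θ)) (t : ℝ) :
    HasDerivAt (fun t => tMap x (K t) Bs w) (tMap x (K' t) Bs w) t := by
  let S : AddSubgroup ((ℝ → E) × (ℝ → E)) :=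
    { carrier := {f | ∀ t, HasDerivAt f.1 (f.2 t) t}
      zero_mem' := fun t => hasDerivAt_const t 0
      add_mem' := fun hf hg t => (hf t).add (hg t)
      neg_mem' := fun hf t => (hf t).neg }
  have hS := tMap_mem (S := S) (n := 0) x (K := fun w => (fun t => K t w, fun t => K' t w))
    (fun w _ => h w) (Bs := Bs) (w := w) (Nat.zero_le _)
  refine ((hS t).congr_of_eventuallyEq (.of_forall fun s => ?_)).congr_deriv ?_
  · exact (tMap_pair_fst x K (fun w t => K' t w) Bs w s).symm
  · rw [tMap_pair_snd x K (fun w t => K' t w) Bs w, tMap_eval]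

/-- Pairs consisting of an integrable family and its integral form a subgroup. Integrability is
demanded for long lists only, since a weight singular at the origin may destroy it for short ones.
-/
theorem tMap_integral {Ω : Type*} [MeasurableSpace Ω] {μ : Measure Ω} (x : smoothTorus θ) {n : ℕ}
    {K : Ω → List (smoothTorus θ) → E} {K' : List (smoothTorus θ) → E}
    (hK : ∀ w, n ≤ w.length → Integrable (fun p => K p w) μ ∧ ∫ p, K p w ∂μ = K' w)
    {Bs : List (FormalOp θ)} {w : List (smoothTorus θ)} (hw : n ≤ Bs.length + w.length) :
    Integrable (fun p => tMap x (K p) Bs w) μ ∧ ∫ p, tMap x (K p) Bs w ∂μ = tMap x K' Bs w := by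
  let S : AddSubgroup ((Ω → E) × E) :=
    { carrier := {f | Integrable f.1 μ ∧ ∫ p, f.1 p ∂μ = f.2}
      zero_mem' := ⟨integrable_zero _ _ _, by simp⟩
      add_mem' := fun hf hg => ⟨hf.1.add hg.1, by
        rw [Prod.snd_add, ← hf.2, ← hg.2]
        exact integral_add hf.1 hg.1⟩
      neg_mem' := fun hf => ⟨hf.1.neg, by
        rw [Prod.snd_neg, ← hf.2]
        exact integral_neg _⟩ }
  have hS := tMap_mem (S := S) x (K := fun w => (fun p => K p w, K' w)) hK hw
  simp only [← tMap_pair_fst x K K', ← tMap_pair_snd x K K']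
  exact hS

end Analysis

end

end NCTorus

namespace NCTorus

noncomputable section

variable {d : ℕ} {θ : Matrix (Fin d) (Fin d) ℝ}

/-! ### The heat semigroup -/

/-- `e^{-tx}`. -/
def heat (x : Op d) (t : ℝ) : Op d := NormedSpace.exp (((-t : ℝ) : ℂ) • x)

theorem heat_zero (x : Op d) : heat x 0 = 1 := by simp [heat]

theorem hasDerivAt_heat (x : Op d) (t : ℝ) : HasDerivAt (heat x) (-(heat x t * x)) t := by
  have h := (hasDerivAt_exp_smul_const (𝕂 := ℂ) x ((-t : ℝ) : ℂ)).scomp t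
    ((hasDerivAt_neg t).ofReal_comp)
  exact h.congr_deriv (by simp [heat])

theorem continuous_heat (x : Op d) : Continuous (heat x) :=
  continuous_iff_continuousAt.2 fun t => (hasDerivAt_heat x t).continuousAt

/-- Variation of constants. -/
theorem eq_integral_heat {x : Op d} {y g : ℝ → Op d} (hg : Continuous g)
    (hy : ∀ t, HasDerivAt y (-(x * y t) - g t) t) (h0 : y 0 = 0) (t : ℝ) :
    y t = -∫ u in (0 : ℝ)..t, heat x (t - u) * g u := by
  have hc : Continuous fun u => heat x (t - u) * g u :=
    ((continuous_heat x).comp (by fun_prop)).mul hg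
  have h := intervalIntegral.integral_eq_sub_of_hasDerivAt
    (f := fun u => heat x (t - u) * y u) (f' := fun u => -(heat x (t - u) * g u))
    (a := 0) (b := t) (fun u _ => by
      -- In the derivative of u ↦ e^{-(t-u)x} y(u) the two terms containing x cancel, leaving
      -- -e^{-(t-u)x} g(u).
      have h1 : HasDerivAt (fun u => heat x (t - u)) (heat x (t - u) * x) u := by
        have := (hasDerivAt_heat x (t - u)).scomp u ((hasDerivAt_id u).const_sub t)
        exact this.congr_deriv (by simp)
      exact (h1.mul (hy u)).congr_deriv (by noncomm_ring))
    (hc.neg.intervalIntegrable _ _)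
  rw [intervalIntegral.integral_neg, sub_self, heat_zero, one_mul, h0, mul_zero, sub_zero] at h
  exact h.symm

/-! ### Exponential series -/

section Series

variable {E : Type*} [NormedAddCommGroup E] [NormedSpace ℂ E] [CompleteSpace E]

theorem summable_expSeries {a : ℕ → E} {ρ : ℝ} (ha : ∀ p, ‖a p‖ ≤ ρ ^ p) (t : ℝ) :
    Summable fun p : ℕ => ((t ^ p / p.factorial : ℝ) : ℂ) • a p := by
  refine Summable.of_norm_bounded (Real.summable_pow_div_factorial (|t| * |ρ|)) fun p => ?_
  rw [norm_smul, Complex.norm_real, norm_div, norm_pow, Real.norm_eq_abs, Real.norm_natCast,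
    mul_pow, mul_div_right_comm]
  gcongr
  exact (ha p).trans ((le_abs_self _).trans (abs_pow ρ p).le)

/-- Termwise differentiation shifts the coefficients by one; on the ball of radius |t| + 1 the
differentiated series is dominated by an exponential series. -/
theorem hasDerivAt_expSeries {a : ℕ → E} {ρ : ℝ} (ha : ∀ p, ‖a p‖ ≤ ρ ^ p) (t : ℝ) :
    HasDerivAt (fun t : ℝ => ∑' p : ℕ, ((t ^ p / p.factorial : ℝ) : ℂ) • a p)
      (∑' p : ℕ, ((t ^ p / p.factorial : ℝ) : ℂ) • a (p + 1)) t := by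
  let T : ℝ := |t| + 1
  have hg : ∀ (p : ℕ) (s : ℝ), HasDerivAt (fun t : ℝ => ((t ^ p / p.factorial : ℝ) : ℂ) • a p)
      (((p * s ^ (p - 1) / p.factorial : ℝ) : ℂ) • a p) s := fun p s =>
    (((hasDerivAt_pow p s).div_const _).ofReal_comp).smul_const (a p)
  have hterm : ∀ (p : ℕ) (s : ℝ), ((p + 1 : ℕ) : ℝ) * s ^ (p + 1 - 1) / (p + 1).factorial =
      s ^ p / p.factorial := fun p s => by
    rw [Nat.factorial_succ, Nat.cast_mul, Nat.add_sub_cancel,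
      mul_div_mul_left _ _ (Nat.cast_ne_zero.2 p.succ_ne_zero)]
  have key := hasDerivAt_tsum_of_isPreconnected (y₀ := t) (y := t)
    (u := fun p : ℕ => ((p * T ^ (p - 1) / p.factorial : ℝ)) * |ρ| ^ p) ?_
    (Metric.isOpen_ball (x := (0 : ℝ)) (ε := T))
    (convex_ball _ _).isPreconnected (fun p s _ => hg p s) (fun p s hs => ?_)
    (by simp [T]) (summable_expSeries ha t) (by simp [T])
  · refine key.congr_deriv ?_
    rw [Summable.tsum_eq_zero_add]
    · simp only [hterm]
      simp
    · rw [← summable_nat_add_iff 1]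
      simp only [hterm]
      refine Summable.of_norm_bounded
        ((Real.summable_pow_div_factorial (|t| * |ρ|)).mul_right |ρ|) fun p => ?_
      rw [norm_smul, Complex.norm_real, norm_div, norm_pow, Real.norm_eq_abs, Real.norm_natCast,
        mul_pow, mul_div_right_comm, mul_assoc, ← pow_succ]
      gcongr
      exact (ha _).trans ((le_abs_self _).trans (abs_pow ρ _).le)
  · rw [← summable_nat_add_iff 1]
    simp only [hterm]
    refine ((Real.summable_pow_div_factorial (T * |ρ|)).mul_right |ρ|).congr fun p => ?_
    rw [mul_pow, pow_succ]
    ring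
  · simp only [norm_smul, Complex.norm_real, norm_div, norm_mul, norm_pow, Real.norm_natCast]
    have hs' : ‖s‖ ≤ T := (mem_ball_zero_iff.1 hs).le
    gcongr
    exact (ha p).trans ((le_abs_self _).trans (abs_pow ρ p).le)

end Series

/-! ### The multiple operator integrals of the divided differences of `e^{-t·}` -/

/-- The multiple operator integral of the divided difference of the `p`-th power: the sum of
`x^{i₀} b₁ x^{i₁} ⋯ b_n x^{i_n}` over `i₀ + ⋯ + i_n = p - n`. -/
def powT (x : smoothTorus θ) : ℕ → List (smoothTorus θ) → smoothTorus θ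
  | 0, [] => 1
  | 0, _ :: _ => 0
  | p + 1, [] => x * powT x p []
  | p + 1, b :: w => x * powT x p (b :: w) + b * powT x p w

/-- Differentiating a letter x splits a block of x's and inserts D_i x as a new argument;
differentiating b_j replaces it. These are the terms of `leib`. The induction strips the leftmost
letter, which is either x or b₁. -/
theorem isLeib_powT (x : smoothTorus θ) (p : ℕ) : IsLeib x (powT x p) := by
  induction p with
  | zero =>
    intro i w
    cases w with
    | nil => exact D_one i
    | cons b w =>
      rw [powT, map_zero]
      -- All values of `K` involved vanish, so the result lies in the trivial subgroup.
      have : ∀ w, leib x i (fun w' => powT x 0 (b :: w')) w = 0 := fun w =>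
        leib_mem (S := ⊥) (n := 0) x i (fun w _ => by simp [powT]) (Nat.zero_le _)
      have h0 := this w
      simp only [powT] at h0
      simp [leib, powT, h0]
  | succ p ih =>
    intro i w
    cases w with
    | nil =>
      rw [powT, D_mul, ih, leib, leib, powT]
      exact add_comm _ _
    | cons b w =>
      have h1 : ∀ K w, x * leib x i K w = leib x i (fun w => x * K w) w := fun K w =>
        map_leib (lmul x).toAddMonoidHom x i K w
      have hadd : ∀ g h : smoothTorus θ, x * (g + h) = x * g + x * h := fun g h =>
        map_add (lmul x) g h
      have h2 : ∀ w, b * leib x i (powT x p) w = leib x i (fun w => b * powT x p w) w := fun w =>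
        map_leib (lmul b).toAddMonoidHom x i (powT x p) w
      simp only [powT, map_add, D_mul, ih i, h2, leib, leib_add, hadd, h1]
      abel

/-- The sum of the operator norms. -/
def sumNorm (w : List (smoothTorus θ)) : ℝ := (w.map fun b : smoothTorus θ => ‖(b : Op d)‖).sum

theorem sumNorm_nonneg (w : List (smoothTorus θ)) : 0 ≤ sumNorm w := by
  refine List.sum_nonneg fun r hr => ?_
  obtain ⟨b, -, rfl⟩ := List.mem_map.1 hr
  exact norm_nonneg _

theorem sumNorm_cons (b : smoothTorus θ) (w : List (smoothTorus θ)) :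
    sumNorm (b :: w) = ‖(b : Op d)‖ + sumNorm w := by
  simp only [sumNorm, List.map_cons, List.sum_cons]

/-- The words that are summed are among those in the expansion of (x + b₁ + ⋯ + b_n)^p. -/
theorem norm_powT_le (x : smoothTorus θ) (w : List (smoothTorus θ)) (p : ℕ) :
    ‖(powT x p w : Op d)‖ ≤ (‖(x : Op d)‖ + sumNorm w) ^ p := by
  induction p generalizing w with
  | zero =>
    cases w with
    | nil => exact ContinuousLinearMap.norm_id_le.trans (by simp)
    | cons b w => simp [powT]
  | succ p ih =>
    cases w with
    | nil =>
      rw [powT, coe_mul, pow_succ']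
      refine (norm_mul_le _ _).trans ?_
      have := ih []
      gcongr
      · exact add_nonneg (norm_nonneg _) (sumNorm_nonneg _)
      · exact le_add_of_nonneg_right (sumNorm_nonneg _)
    | cons b w =>
      rw [powT, Submodule.coe_add, coe_mul, coe_mul, pow_succ']
      have hw := sumNorm_nonneg w
      have h1 := ih (b :: w)
      have h2 : ‖(powT x p w : Op d)‖ ≤
          (‖(x : Op d)‖ + sumNorm (b :: w)) ^ p := by
        refine (ih w).trans ?_
        rw [sumNorm_cons]
        have := sumNorm_nonneg w
        gcongr
        simp
      set ρ := ‖(x : Op d)‖ + sumNorm (b :: w) with hρ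
      have hρ' : ‖(x : Op d)‖ + ‖(b : Op d)‖ ≤ ρ := by
        rw [hρ, sumNorm_cons]
        linarith
      have hρ0 : 0 ≤ ρ := le_trans (by positivity) hρ'
      calc _ ≤ ‖(x : Op d)‖ * ρ ^ p + ‖(b : Op d)‖ * ρ ^ p := by
            refine (norm_add_le _ _).trans ?_
            gcongr
            · exact (norm_mul_le _ _).trans (by gcongr)
            · exact (norm_mul_le _ _).trans (by gcongr)
        _ ≤ _ := by
            rw [← add_mul]
            gcongr

/-- The multiple operator integral of the divided difference of `e^{-t·}`. -/
def expOp (x : smoothTorus θ) (t : ℝ) (w : List (smoothTorus θ)) : Op d :=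
  ∑' p : ℕ, (((-t) ^ p / p.factorial : ℝ) : ℂ) • (powT x p w : Op d)

theorem summable_powT (x : smoothTorus θ) (t : ℝ) (w : List (smoothTorus θ)) :
    Summable fun p : ℕ => ((t ^ p / p.factorial : ℝ) : ℂ) • (powT x p w : Op d) :=
  summable_expSeries (norm_powT_le x w) t

theorem expOp_mem_cTorus (x : smoothTorus θ) (t : ℝ) (w : List (smoothTorus θ)) :
    expOp x t w ∈ cTorus θ :=
  (isClosed_cTorus θ).mem_of_tendsto (summable_powT x (-t) w).hasSum (.of_forall fun _ =>
    sum_mem fun p _ => (cTorus θ).smul_mem (powT x p w).2.1 _)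

theorem leib_tsum {E : Type*} [NormedAddCommGroup E] (x : smoothTorus θ) (i : Fin d)
    {f : ℕ → List (smoothTorus θ) → E} (hf : ∀ w, Summable fun p => f p w)
    (w : List (smoothTorus θ)) :
    HasSum (fun p => leib x i (f p) w) (leib x i (fun w => ∑' p, f p w) w) := by
  let S : AddSubgroup ((ℕ → E) × E) :=
    { carrier := {f | HasSum f.1 f.2}
      zero_mem' := hasSum_zero
      add_mem' := fun hf hg => HasSum.add hf hg
      neg_mem' := fun hf => HasSum.neg hf }
  have hS := leib_mem (S := S) x i (n := 0) (K := fun w => (fun p => f p w, ∑' p, f p w))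
    (fun w _ => (hf w).hasSum) (w := w) (Nat.zero_le _)
  rw [← leib_pair_snd x i f (fun w => ∑' p, f p w) w]
  simp only [← leib_pair_fst x i f (fun w => ∑' p, f p w) w]
  exact hS

/-- The Leibniz rule holds for every power, and coefficients pass through the norm convergent
series. This yields the smoothness of `expOp` and the Leibniz rule at once. -/
theorem coeff_expOp (x : smoothTorus θ) (t : ℝ) (w : List (smoothTorus θ)) (i : Fin d)
    (n : Fin d → ℤ) : (n i : ℂ) * coeff n (expOp x t w) = coeff n (leib x i (expOp x t) w) := by
  refine (((summable_powT x (-t) w).hasSum.mapL (coeff n)).mul_left (n i : ℂ)).unique ?_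
  refine ((leib_tsum x i (summable_powT x (-t)) w).mapL (coeff n)).congr_fun fun p => ?_
  rw [leib_smul, map_smul, map_smul, smul_eq_mul, smul_eq_mul, mul_left_comm]
  congr 1
  have h := map_leib (smoothTorus θ).subtype.toAddMonoidHom x i (powT x p) w
  have h2 := congrArg (Subtype.val) (isLeib_powT x p i w)
  rw [← coeff_deriv i (powT x p w).2]
  exact congrArg (coeff n) (h2.trans h)

/-- The smooth element `expOp x t w`. -/
def expT (x : smoothTorus θ) (t : ℝ) (w : List (smoothTorus θ)) : smoothTorus θ :=
  ⟨expOp x t w, smooth_of_coeff_leib (n := 0) (K := expOp x t) (x := x)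
    (fun w _ => expOp_mem_cTorus x t w) (fun w _ => coeff_expOp x t w) (Nat.zero_le _)⟩

theorem isLeib_expT (x : smoothTorus θ) (t : ℝ) : IsLeib x (expT x t) := fun i w => by
  ext1
  have h := map_leib (smoothTorus θ).subtype.toAddMonoidHom x i (expT x t) w
  exact (derivOp_eq_leib (n := 0) (fun w _ => expOp_mem_cTorus x t w)
    (fun w _ => coeff_expOp x t w) (Nat.zero_le _) i).trans h.symm

theorem expT_nil (x : smoothTorus θ) (t : ℝ) : (expT x t [] : Op d) = heat x t := by
  have hp : ∀ p, (powT x p [] : Op d) = (x : Op d) ^ p := fun p => by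
    induction p with
    | zero => rfl
    | succ p ih => rw [powT, coe_mul, ih, pow_succ']
  rw [heat, NormedSpace.exp_eq_tsum ℂ]
  change ∑' _, _ = _
  refine tsum_congr fun p => ?_
  rw [hp, smul_pow, smul_smul]
  congr 1
  push_cast
  ring

theorem expT_zero_cons (x b : smoothTorus θ) (w : List (smoothTorus θ)) :
    expT x 0 (b :: w) = 0 := by
  ext1
  change ∑' _, _ = _
  rw [tsum_eq_single 0]
  · simp [powT]
  · intro p hp
    simp [hp]

/-- The right-hand side of the differential equation of `expT`. -/
def heatRhs (x : smoothTorus θ) (K : List (smoothTorus θ) → smoothTorus θ) :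
    List (smoothTorus θ) → smoothTorus θ
  | [] => -(x * K [])
  | b :: w => -(x * K (b :: w)) - b * K w

/-- Differentiation replaces the p-th power by the (p+1)-st, whose recursion strips the leftmost
letter: the case x gives the homogeneous term and the case b₁ the inhomogeneity. -/
theorem hasDerivAt_expT (x : smoothTorus θ) (w : List (smoothTorus θ)) (t : ℝ) :
    HasDerivAt (fun t => (expT x t w : Op d)) (heatRhs x (expT x t) w) t := by
  have h := (hasDerivAt_expSeries (norm_powT_le x w) (-t)).scomp t (hasDerivAt_neg t)
  refine h.congr_deriv ?_
  rw [neg_one_smul]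
  cases w with
  | nil =>
    simp only [powT, coe_mul, heatRhs, Submodule.coe_neg, ← mul_smul_comm]
    rw [(summable_powT x (-t) []).tsum_mul_left]
    rfl
  | cons b w =>
    simp only [powT, coe_mul, heatRhs, Submodule.coe_neg, Submodule.coe_sub, Submodule.coe_add,
      smul_add, ← mul_smul_comm]
    rw [((summable_powT x (-t) (b :: w)).mul_left _).tsum_add
      ((summable_powT x (-t) w).mul_left _), (summable_powT x (-t) (b :: w)).tsum_mul_left,
      (summable_powT x (-t) w).tsum_mul_left, neg_add, ← sub_eq_add_neg]
    rfl

theorem continuous_expT (x : smoothTorus θ) (w : List (smoothTorus θ)) :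
    Continuous fun t => (expT x t w : Op d) :=
  continuous_iff_continuousAt.2 fun t => (hasDerivAt_expT x w t).continuousAt

/-- `𝐓` for the function `e^{-t·}`, with the arguments `𝐁₁, …, 𝐁_m` in their natural order. -/
def chain (x : smoothTorus θ) (t : ℝ) (Bs : List (FormalOp θ)) : smoothTorus θ :=
  tMap x (expT x t) Bs.reverse []

theorem chain_nil (x : smoothTorus θ) (t : ℝ) : (chain x t [] : Op d) = heat x t := expT_nil x t

theorem coe_tMap (x : smoothTorus θ) (K : List (smoothTorus θ) → smoothTorus θ)
    (Bs : List (FormalOp θ)) (w : List (smoothTorus θ)) :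
    ((tMap x K Bs w : smoothTorus θ) : Op d) = tMap x (fun w => (K w : Op d)) Bs w :=
  map_tMap (smoothTorus θ).subtype.toAddMonoidHom x K Bs w

/-- At t = 0 only the zeroth power survives, and it vanishes on nonempty lists, the only ones that
occur here. -/
theorem chain_zero_cons (x : smoothTorus θ) (B : FormalOp θ) (Bs : List (FormalOp θ)) :
    chain x 0 (B :: Bs) = 0 :=
  tMap_mem (S := ⊥) (n := 1) x (fun w hw => by
    cases w with
    | nil => simp at hw
    | cons b w => simp [expT_zero_cons]) (by simp)

/-- The equation of `expT` in its leftmost argument extends to formal operators by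
`IsLeib.tMap_concat`, with φ = -x· and ψ = -1. Reversing the list of operators puts `B` into the
leftmost slot. -/
theorem hasDerivAt_chain (x : smoothTorus θ) (B : FormalOp θ) (Bs : List (FormalOp θ)) (t : ℝ) :
    HasDerivAt (fun t => (chain x t (B :: Bs) : Op d))
      (-((x : Op d) * chain x t (B :: Bs)) - act B (chain x t Bs)) t := by
  have h := tMap_hasDerivAt x (K := fun t w => (expT x t w : Op d))
    (hasDerivAt_expT x) (B :: Bs).reverse [] t
  simp only [← coe_tMap] at h
  refine h.congr_deriv ?_
  have := (isLeib_expT x t).tMap_concat (K₀ := heatRhs x (expT x t))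
    (-(lmul x).toAddMonoidHom) (-AddMonoidHom.id _)
    (fun b w => by simp [heatRhs, sub_eq_add_neg]) B Bs.reverse []
  rw [List.reverse_cons, this]
  simp [sub_eq_add_neg, chain]

end

end NCTorus

namespace NCTorus

noncomputable section

/-! ### Integrals over the simplex -/

section Simplex

variable {n : ℕ}

/-- The barycentric coordinates `s_j - s_{j+1}` of a point of the simplex. -/
def wt (s : Fin n → ℝ) (j : Fin (n + 1)) : ℝ := extSeq s j.castSucc - extSeq s j.succ

theorem sum_wt (s : Fin n → ℝ) : ∑ j, wt s j = 1 := by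
  have h1 := Fin.sum_univ_succ (extSeq s)
  have h2 := Fin.sum_univ_castSucc (extSeq s)
  have h3 : extSeq s 0 = 1 := rfl
  have h4 : extSeq s (Fin.last _) = 0 := by
    rw [extSeq, ← Fin.succ_last, Fin.cons_succ, Fin.snoc_last]
  simp only [wt, Finset.sum_sub_distrib]
  linarith

/-- In the parametrisation (u, us) of the larger simplex the weights are 1 - u and u times those of
s. -/
theorem extSeq_cons_smul (u : ℝ) (s : Fin n → ℝ) (j : Fin (n + 2)) :
    extSeq (Fin.cons u (u • s) : Fin (n + 1) → ℝ) j.succ = u * extSeq s j := by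
  rw [extSeq, Fin.cons_succ, ← Fin.cons_snoc_eq_snoc_cons]
  induction j using Fin.cases with
  | zero => simp [extSeq]
  | succ k =>
    rw [extSeq, Fin.cons_succ, Fin.cons_succ]
    induction k using Fin.lastCases with
    | last => simp
    | cast k => simp

theorem wt_cons_zero (u : ℝ) (s : Fin n → ℝ) :
    wt (Fin.cons u (u • s) : Fin (n + 1) → ℝ) 0 = 1 - u := by
  rw [wt, extSeq_cons_smul]
  simp [extSeq]

theorem wt_cons_succ (u : ℝ) (s : Fin n → ℝ) (j : Fin (n + 1)) :
    wt (Fin.cons u (u • s) : Fin (n + 1) → ℝ) j.succ = u * wt s j := by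
  rw [wt, extSeq_cons_smul, ← Fin.succ_castSucc, extSeq_cons_smul, wt, mul_sub]

theorem continuous_extSeq (j : Fin (n + 2)) : Continuous fun s : Fin n → ℝ => extSeq s j := by
  induction j using Fin.cases with
  | zero => exact continuous_const
  | succ k =>
    induction k using Fin.lastCases with
    | last => simpa [extSeq] using continuous_const
    | cast k => simpa [extSeq] using continuous_apply k

theorem continuous_wt (j : Fin (n + 1)) : Continuous fun s : Fin n → ℝ => wt s j :=
  (continuous_extSeq _).sub (continuous_extSeq _)

theorem mem_simplex_cons {u : ℝ} {y : Fin n → ℝ} :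
    (Fin.cons u y : Fin (n + 1) → ℝ) ∈ simplex (n + 1) ↔
      (0 ≤ u ∧ u ≤ 1) ∧ (∀ j, 0 ≤ y j ∧ y j ≤ u) ∧ Antitone y := by
  constructor
  · rintro ⟨h1, h2⟩
    refine ⟨by simpa using h1 0, fun j => ⟨by simpa using (h1 j.succ).1, ?_⟩, fun i j hij => ?_⟩
    · simpa using h2 (Fin.zero_le j.succ)
    · simpa using h2 (Fin.succ_le_succ_iff.2 hij)
  · rintro ⟨h1, h2, h3⟩
    refine ⟨fun j => ?_, fun i j hij => ?_⟩
    · induction j using Fin.cases with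
      | zero => simpa using h1
      | succ j => simpa using ⟨(h2 j).1, (h2 j).2.trans h1.2⟩
    · induction j using Fin.cases with
      | zero =>
        obtain rfl : i = 0 := Fin.le_zero_iff.1 hij
        exact le_rfl
      | succ j =>
        induction i using Fin.cases with
        | zero => simpa using (h2 j).2
        | succ i => simpa using h3 (Fin.succ_le_succ_iff.1 hij)

theorem isClosed_simplex (n : ℕ) : IsClosed (simplex n) := by
  have : simplex n = (⋂ j, {s | 0 ≤ s j ∧ s j ≤ 1}) ∩
      ⋂ i, ⋂ j, ⋂ (_ : i ≤ j), {s | s j ≤ s i} := by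
    ext s
    simp [simplex, Antitone]
  rw [this]
  refine (isClosed_iInter fun j => ?_).inter
    (isClosed_iInter fun i => isClosed_iInter fun j => isClosed_iInter fun _ =>
      isClosed_le (continuous_apply j) (continuous_apply i))
  exact (isClosed_le continuous_const (continuous_apply j)).inter
    (isClosed_le (continuous_apply j) continuous_const)

theorem isCompact_simplex (n : ℕ) : IsCompact (simplex n) :=
  (isCompact_univ_pi fun _ => isCompact_Icc (a := (0 : ℝ)) (b := 1)).of_isClosed_subset
    (isClosed_simplex n) fun _ hs j _ => hs.1 j

theorem wt_nonneg {s : Fin n → ℝ} (hs : s ∈ simplex n) (j : Fin (n + 1)) : 0 ≤ wt s j := by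
  -- Appending 0 and prepending 1 keeps a point in the simplex of the next dimension, whose points
  -- are antitone by definition.
  have hmono : Antitone (extSeq s) := by
    have h2 : (Fin.snoc s 0 : Fin (n + 1) → ℝ) ∈ simplex (n + 1) := by
      refine ⟨fun j => ?_, fun i j hij => ?_⟩
      · induction j using Fin.lastCases with
        | last => simp
        | cast j => simpa using hs.1 j
      · induction i using Fin.lastCases with
        | last =>
          obtain rfl : j = Fin.last n := Fin.last_le_iff.1 hij
          exact le_rfl
        | cast i =>
          induction j using Fin.lastCases with
          | last => simpa using (hs.1 i).1
          | cast j => simpa using hs.2 (Fin.castSucc_le_castSucc_iff.1 hij)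
    exact (mem_simplex_cons.2 ⟨by simp, h2.1, h2.2⟩ :
      (Fin.cons 1 (Fin.snoc s 0 : Fin (n + 1) → ℝ) : Fin (n + 2) → ℝ) ∈ simplex (n + 2)).2
  exact sub_nonneg.2 (hmono (Fin.castSucc_lt_succ).le)

theorem sum_wt_mul_pos {s : Fin n → ℝ} (hs : s ∈ simplex n) {α : Fin (n + 1) → ℝ}
    (hα : ∀ j, 0 < α j) : 0 < ∑ j, wt s j * α j := by
  have h1 : ∃ j, 0 < wt s j := by
    by_contra! h
    have := Finset.sum_nonpos fun j (_ : j ∈ Finset.univ) => h j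
    rw [sum_wt] at this
    linarith
  obtain ⟨j, hj⟩ := h1
  exact Finset.sum_pos' (fun j _ => mul_nonneg (wt_nonneg hs j) (hα _).le)
    ⟨j, Finset.mem_univ _, mul_pos hj (hα _)⟩

open scoped Pointwise in
/-- Integration over the simplex, the first variable last. -/
theorem setIntegral_simplex_succ {E : Type*} [NormedAddCommGroup E] [NormedSpace ℝ E]
    {Ψ : (Fin (n + 1) → ℝ) → E} (hΨ : IntegrableOn Ψ (simplex (n + 1))) :
    ∫ s in simplex (n + 1), Ψ s =
      ∫ u in (0 : ℝ)..1, u ^ n • ∫ s in simplex n, Ψ (Fin.cons u (u • s)) := by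
  let e := MeasurableEquiv.piFinSuccAbove (fun _ : Fin (n + 1) => ℝ) 0
  have he : MeasurePreserving e.symm :=
    (volume_preserving_piFinSuccAbove (fun _ : Fin (n + 1) => ℝ) 0).symm _
  have hesymm : ∀ p : ℝ × (Fin n → ℝ), e.symm p = Fin.cons p.1 p.2 := fun p => by
    simp [e, MeasurableEquiv.piFinSuccAbove, Fin.insertNthEquiv]
  have hmeas : MeasurableSet (e.symm ⁻¹' simplex (n + 1)) :=
    e.symm.measurable (isClosed_simplex _).measurableSet
  have hint : IntegrableOn (fun p => Ψ (e.symm p)) (e.symm ⁻¹' simplex (n + 1)) :=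
    (he.integrableOn_comp_preimage e.symm.measurableEmbedding).2 hΨ
  rw [← he.setIntegral_preimage_emb e.symm.measurableEmbedding, ← integral_indicator hmeas,
    Measure.volume_eq_prod, integral_prod _ ((integrable_indicator_iff hmeas).2 hint),
    intervalIntegral.integral_of_le zero_le_one, ← integral_indicator measurableSet_Ioc]
  refine integral_congr_ae ?_
  -- At u = 0 the section cannot be rescaled; it is discarded as a null set.
  have h0 : ∀ᵐ u : ℝ, u ≠ 0 := by simp [ae_iff]
  filter_upwards [h0] with u hu
  by_cases hu1 : u ∈ Set.Ioc (0 : ℝ) 1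
  · rw [Set.indicator_of_mem hu1]
    -- For 0 < u ≤ 1 the section over u is the dilate of the simplex by u, whence the Jacobian u^n.
    have hset : ∀ y, (u, y) ∈ e.symm ⁻¹' simplex (n + 1) ↔ y ∈ u • simplex n := fun y => by
      rw [Set.mem_preimage, hesymm, mem_simplex_cons, Set.mem_smul_set_iff_inv_smul_mem₀ hu]
      constructor
      · rintro ⟨-, h1, h2⟩
        refine ⟨fun j => ⟨mul_nonneg (inv_nonneg.2 hu1.1.le) (h1 j).1, ?_⟩, fun i j hij => ?_⟩
        · exact (inv_mul_le_one₀ hu1.1).2 (h1 j).2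
        · exact mul_le_mul_of_nonneg_left (h2 hij) (inv_nonneg.2 hu1.1.le)
      · rintro ⟨h1, h2⟩
        refine ⟨⟨hu1.1.le, hu1.2⟩, fun j => ⟨?_, ?_⟩, fun i j hij => ?_⟩
        · exact (mul_nonneg_iff_of_pos_left (inv_pos.2 hu1.1)).1 (h1 j).1
        · exact (inv_mul_le_one₀ hu1.1).1 (h1 j).2
        · exact le_of_mul_le_mul_left (h2 hij) (inv_pos.2 hu1.1)
    have h1 : ∀ y, (e.symm ⁻¹' simplex (n + 1)).indicator (fun p => Ψ (e.symm p)) (u, y) =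
        (u • simplex n).indicator (fun y => Ψ (Fin.cons u y)) y := fun y => by
      by_cases hy : y ∈ u • simplex n
      · rw [Set.indicator_of_mem hy, Set.indicator_of_mem ((hset y).2 hy), hesymm]
      · rw [Set.indicator_of_notMem hy, Set.indicator_of_notMem (mt (hset y).1 hy)]
    simp only [h1]
    rw [integral_indicator ((isClosed_simplex n).smul₀ u).measurableSet,
      Measure.setIntegral_comp_smul_of_pos volume (fun y => Ψ (Fin.cons u y)) _ hu1.1,
      smul_smul]
    simp [hu]
  · rw [Set.indicator_of_notMem hu1]
    refine integral_eq_zero_of_ae (.of_forall fun y => Set.indicator_of_notMem (fun h => hu1 ?_) _)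
    rw [Set.mem_preimage, hesymm, mem_simplex_cons] at h
    exact ⟨lt_of_le_of_ne h.1.1 hu.symm, h.1.2⟩

theorem setIntegral_simplex_zero {E : Type*} [NormedAddCommGroup E] [NormedSpace ℝ E]
    [CompleteSpace E] (Ψ : (Fin 0 → ℝ) → E) : ∫ s in simplex 0, Ψ s = Ψ ![] := by
  have : simplex 0 = Set.univ := by
    ext s
    simp [simplex, Antitone]
  rw [this, setIntegral_univ, volume_pi, Measure.pi_of_empty _ ![], integral_dirac]

end Simplex

/-! ### The Hermite–Genocchi formula -/

/-- Coinciding arguments involve derivatives, so agreement on the open half-line is used, not just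
at the given points. -/
theorem divDiff_congr {n : ℕ} {f g : ℝ → ℝ} (h : Set.EqOn f g (Set.Ioi 0)) {α : Fin (n + 1) → ℝ}
    (hα : ∀ j, 0 < α j) : divDiff n f α = divDiff n g α := by
  induction n generalizing f g with
  | zero => exact h (hα 0)
  | succ n ih =>
    refine ih (fun β hβ => ?_) fun j => hα j.succ
    by_cases hb : β = α 0
    · subst hb
      rw [dslope_same, dslope_same]
      exact ((h.eventuallyEq_of_mem (Ioi_mem_nhds (hα 0)))).deriv_eq
    · rw [dslope_of_ne _ hb, dslope_of_ne _ hb, slope_def_field, slope_def_field, h hβ, h (hα 0)]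

theorem convex_pos {a b u : ℝ} (ha : 0 < a) (hb : 0 < b) (hu : u ∈ Set.Icc (0 : ℝ) 1) :
    0 < (1 - u) * a + u * b := by
  rcases hu.1.eq_or_lt with h | h
  · rw [← h]; simpa using ha
  · have : 0 ≤ (1 - u) * a := mul_nonneg (by linarith [hu.2]) ha.le
    have : 0 < u * b := mul_pos h hb
    linarith

/-- Newton's recursion replaces f by its slope at α₀, which is β ↦ ∫₀¹ f'((1-u)α₀ + uβ) du. The
induction hypothesis applies to this function, and Fubini turns simplex and [0,1] into the next
simplex. Derivatives are given as a sequence `f i` on (0, ∞), because nothing is known off the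
half-line. -/
theorem divDiff_eq_setIntegral {f : ℕ → ℝ → ℝ}
    (hf : ∀ i y, 0 < y → HasDerivAt (f i) (f (i + 1) y) y) {n : ℕ} {α : Fin (n + 1) → ℝ}
    (hα : ∀ j, 0 < α j) :
    divDiff n (f 0) α = ∫ s in simplex n, f n (∑ j, wt s j * α j) := by
  induction n generalizing f with
  | zero =>
    rw [setIntegral_simplex_zero]
    simp [divDiff, wt, extSeq]
  | succ n ih =>
    have hcont : ∀ i, ContinuousOn (f i) (Set.Ioi 0) := fun i y hy =>
      (hf i y hy).continuousAt.continuousWithinAt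
    set a := α 0 with ha
    have ha0 : 0 < a := hα 0
    -- The i-th derivative of the slope in β: each differentiation under the integral brings down a
    -- factor u.
    let g : ℕ → ℝ → ℝ := fun i β => ∫ u in (0 : ℝ)..1, u ^ i * f (i + 1) ((1 - u) * a + u * β)
    have hgi : ∀ i β, 0 < β → ContinuousOn
        (fun u => u ^ i * f (i + 1) ((1 - u) * a + u * β)) (Set.Icc 0 1) := fun i β hβ =>
      (continuousOn_pow i).mul ((hcont (i + 1)).comp (by fun_prop)
        fun u hu => convex_pos ha0 hβ hu)
    have hg : ∀ i y, 0 < y → HasDerivAt (g i) (g (i + 1) y) y := by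
      intro i y hy
      have hcomp : ContinuousOn (fun p : ℝ × ℝ => f (i + 2) ((1 - p.2) * a + p.2 * p.1))
          (Set.Icc (y / 2) (2 * y) ×ˢ Set.Icc 0 1) :=
        (hcont (i + 2)).comp (by fun_prop) fun p hp => convex_pos ha0
          (lt_of_lt_of_le (by positivity) hp.1.1) hp.2
      obtain ⟨C, hC⟩ := (isCompact_Icc.prod isCompact_Icc).exists_bound_of_continuousOn hcomp
      have hnhds : Set.Ioo (y / 2) (2 * y) ∈ 𝓝 y := Ioo_mem_nhds (by linarith) (by linarith)
      refine (intervalIntegral.hasDerivAt_integral_of_dominated_loc_of_deriv_le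
        (F := fun β u => u ^ i * f (i + 1) ((1 - u) * a + u * β))
        (F' := fun β u => u ^ (i + 1) * f (i + 2) ((1 - u) * a + u * β))
        (bound := fun _ => C) hnhds ?_ ?_ ?_ ?_ ?_ ?_).2
      · filter_upwards [hnhds] with β hβ
        rw [Set.uIoc_of_le zero_le_one]
        exact ((hgi i β (by linarith [hβ.1])).mono Set.Ioc_subset_Icc_self).aestronglyMeasurable
          measurableSet_Ioc
      · exact ContinuousOn.intervalIntegrable (by
          rw [Set.uIcc_of_le zero_le_one]; exact hgi i y hy)
      · rw [Set.uIoc_of_le zero_le_one]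
        exact ((hgi (i + 1) y hy).mono Set.Ioc_subset_Icc_self).aestronglyMeasurable
          measurableSet_Ioc
      · refine .of_forall fun u hu β hβ => ?_
        rw [Set.uIoc_of_le zero_le_one] at hu
        rw [norm_mul, norm_pow]
        have h1 := hC (β, u) ⟨⟨hβ.1.le, hβ.2.le⟩, ⟨hu.1.le, hu.2⟩⟩
        have h2 : ‖u‖ ^ (i + 1) ≤ 1 := pow_le_one₀ (norm_nonneg _) (by
          rw [Real.norm_of_nonneg hu.1.le]; exact hu.2)
        calc _ ≤ 1 * C := mul_le_mul h2 h1 (norm_nonneg _) zero_le_one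
          _ = C := one_mul C
      · exact intervalIntegrable_const
      · refine .of_forall fun u hu β hβ => ?_
        rw [Set.uIoc_of_le zero_le_one] at hu
        have hpos := convex_pos ha0 (show 0 < β by linarith [hβ.1]) ⟨hu.1.le, hu.2⟩
        have h1 := ((hf (i + 1) _ hpos).comp β
          (((hasDerivAt_id β).const_mul u).const_add ((1 - u) * a))).const_mul (u ^ i)
        exact h1.congr_deriv (by simp only [mul_one]; ring)
    have hslope : Set.EqOn (dslope (f 0) a) (g 0) (Set.Ioi 0) := by
      intro β hβ
      have hFTC := intervalIntegral.integral_eq_sub_of_hasDerivAt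
        (f := fun u => f 0 ((1 - u) * a + u * β))
        (f' := fun u => (β - a) * (u ^ 0 * f 1 ((1 - u) * a + u * β))) (a := 0) (b := 1)
        (fun u hu => by
          rw [Set.uIcc_of_le zero_le_one] at hu
          have h1 := (hf 0 _ (convex_pos ha0 hβ hu)).comp u
            ((((hasDerivAt_id u).const_sub 1).mul_const a).add ((hasDerivAt_id u).mul_const β))
          exact h1.congr_deriv (by simp; ring))
        (ContinuousOn.intervalIntegrable (by
          rw [Set.uIcc_of_le zero_le_one]
          exact continuousOn_const.mul (hgi 0 β hβ)))
      rw [intervalIntegral.integral_const_mul] at hFTC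
      by_cases hb : β = a
      · rw [hb, dslope_same, (hf 0 a ha0).deriv]
        simp only [g, pow_zero, one_mul]
        have : ∀ u : ℝ, (1 - u) * a + u * a = a := fun u => by ring
        simp [this]
      · rw [dslope_of_ne _ hb, slope_def_field, div_eq_iff (sub_ne_zero.2 hb), mul_comm]
        change _ = (β - a) * ∫ u in (0 : ℝ)..1, u ^ 0 * f 1 ((1 - u) * a + u * β)
        rw [hFTC]
        simp
    have hsum : ∀ s ∈ simplex n, 0 < ∑ j, wt s j * α j.succ := fun s hs =>
      sum_wt_mul_pos hs fun j => hα j.succ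
    have hwc : ∀ m, ∀ β : Fin (m + 1) → ℝ, Continuous fun s : Fin m → ℝ => ∑ j, wt s j * β j :=
      fun m β => continuous_finsetSum _ fun j _ => (continuous_wt j).mul continuous_const
    have hint : IntegrableOn (fun s => f (n + 1) (∑ j, wt s j * α j)) (simplex (n + 1)) :=
      ((hcont _).comp (hwc _ _).continuousOn fun s hs => sum_wt_mul_pos hs hα).integrableOn_compact (isCompact_simplex _)
    change divDiff n (dslope (f 0) a) (fun j => α j.succ) = _
    rw [divDiff_congr hslope fun j => hα j.succ, ih hg fun j => hα j.succ,
      setIntegral_simplex_succ hint]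
    have hinner : ∀ u : ℝ, ∀ s : Fin n → ℝ, ∑ j, wt (Fin.cons u (u • s) : Fin (n + 1) → ℝ) j * α j
        = (1 - u) * a + u * ∑ j, wt s j * α j.succ := fun u s => by
      rw [Fin.sum_univ_succ, wt_cons_zero, Finset.mul_sum]
      simp only [wt_cons_succ, mul_assoc, ha]
    simp only [hinner, g, smul_eq_mul, ← integral_const_mul]
    rw [intervalIntegral.integral_of_le zero_le_one]
    simp only [intervalIntegral.integral_of_le zero_le_one]
    -- The factor u^n in the n-th derivative of the slope is exactly the Jacobian of the
    -- parametrisation of the simplex.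
    refine integral_integral_swap ?_
    have hcont2 : ContinuousOn (fun p : (Fin n → ℝ) × ℝ =>
        p.2 ^ n * f (n + 1) ((1 - p.2) * a + p.2 * ∑ j, wt p.1 j * α j.succ))
        (simplex n ×ˢ Set.Icc 0 1) := by
      have := hwc n fun j => α j.succ
      exact (by fun_prop : Continuous fun p : (Fin n → ℝ) × ℝ => p.2 ^ n).continuousOn.mul
        ((hcont _).comp (((continuous_const.sub continuous_snd).mul continuous_const).add
          (continuous_snd.mul (this.comp continuous_fst))).continuousOn
          fun p hp => convex_pos ha0 (hsum _ hp.1) hp.2)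
    have h3 := (hcont2.integrableOn_compact (μ := volume.prod volume)
      ((isCompact_simplex n).prod isCompact_Icc)).mono_set
      (Set.prod_mono_right (Set.Ioc_subset_Icc_self))
    rw [IntegrableOn, ← Measure.prod_restrict] at h3
    exact h3

end

end NCTorus

namespace NCTorus

noncomputable section

variable {d : ℕ} {θ : Matrix (Fin d) (Fin d) ℝ}

/-! ### Families that are continuous with all derivatives -/

/-- All derivatives of the family `g` are norm continuous. -/
def SmoothCts {T : Type*} [TopologicalSpace T] (g : T → smoothTorus θ) : Prop :=
  ∀ L : List (Fin d), Continuous fun p => (DSeq L (g p) : Op d)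

section SmoothCts

variable {T : Type*} [TopologicalSpace T] {g g' : T → smoothTorus θ}

theorem SmoothCts.continuous (hg : SmoothCts g) : Continuous fun p => (g p : Op d) := hg []

theorem SmoothCts.deriv (hg : SmoothCts g) (i : Fin d) : SmoothCts fun p => D θ i (g p) :=
  fun L => by simpa only [DSeq_concat] using hg (L ++ [i])

theorem SmoothCts.dseq (hg : SmoothCts g) (L : List (Fin d)) : SmoothCts fun p => DSeq L (g p) := by
  induction L with
  | nil => exact hg
  | cons i L ih => exact ih.deriv i

theorem SmoothCts.add (hg : SmoothCts g) (hg' : SmoothCts g') :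
    SmoothCts fun p => g p + g' p := fun L => by
  simp only [map_add, Submodule.coe_add]
  exact (hg L).add (hg' L)

theorem SmoothCts.neg (hg : SmoothCts g) : SmoothCts fun p => -g p := fun L => by
  simp only [map_neg, Submodule.coe_neg]
  exact (hg L).neg

theorem smoothCts_const (b : smoothTorus θ) : SmoothCts fun _ : T => b := fun _ =>
  continuous_const

theorem SmoothCts.sum {ι : Type*} {s : Finset ι} {g : ι → T → smoothTorus θ}
    (hg : ∀ i ∈ s, SmoothCts (g i)) : SmoothCts fun p => ∑ i ∈ s, g i p := by
  classical
  induction s using Finset.induction_on with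
  | empty => simpa using smoothCts_const 0
  | insert i s hi ih =>
    simp only [Finset.sum_insert hi]
    exact (hg i (Finset.mem_insert_self i s)).add
      (ih fun j hj => hg j (Finset.mem_insert_of_mem hj))

/-- Induction on the number of derivatives for all pairs of families, since the Leibniz rule
replaces one factor by its derivative. -/
theorem SmoothCts.mul (hg : SmoothCts g) (hg' : SmoothCts g') : SmoothCts fun p => g p * g' p := by
  have key : ∀ (n : ℕ) (g g' : T → smoothTorus θ), SmoothCts g → SmoothCts g' →
      ∀ L : List (Fin d), L.length = n → Continuous fun p => (DSeq L (g p * g' p) : Op d) := by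
    intro n
    induction n with
    | zero =>
      intro g g' hg hg' L hL
      rw [List.length_eq_zero_iff.1 hL]
      exact hg.continuous.mul hg'.continuous
    | succ n ih =>
      intro g g' hg hg' L hL
      rcases List.eq_nil_or_concat' L with rfl | ⟨L, i, rfl⟩
      · simp at hL
      · simp only [DSeq_concat, D_mul, map_add, Submodule.coe_add]
        have hL' : L.length = n := by simpa using hL
        exact (ih _ _ (hg.deriv i) hg' L hL').add (ih _ _ hg (hg'.deriv i) L hL')
  exact fun L => key _ g g' hg hg' L rfl

theorem SmoothCts.act (hg : SmoothCts g) (B : FormalOp θ) : SmoothCts fun p => act B (g p) := by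
  simp only [act_apply, Finsupp.sum]
  exact SmoothCts.sum fun α _ => (smoothCts_const _).mul (hg.dseq _)

theorem SmoothCts.expT (x : smoothTorus θ) {r : T → ℝ} (hr : Continuous r)
    (w : List (smoothTorus θ)) : SmoothCts fun p => expT x (r p) w := fun L => by
  let S : AddSubgroup (T → Op d) :=
    { carrier := {f | Continuous f}
      zero_mem' := continuous_const
      add_mem' := fun hf hg => Continuous.add hf hg
      neg_mem' := fun hf => Continuous.neg hf }
  have h := leibSeq_mem (S := S) (n := 0) x L (K := fun w p => (NCTorus.expT x (r p) w : Op d))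
    (fun w _ => (continuous_expT x w).comp hr) (w := w) (Nat.zero_le _)
  refine Continuous.congr h fun p => ?_
  rw [(isLeib_expT x (r p)).DSeq_eq]
  exact (map_leibSeq (Pi.evalAddMonoidHom (fun _ : T => Op d) p) x L _ w).trans
    (map_leibSeq (smoothTorus θ).subtype.toAddMonoidHom x L (NCTorus.expT x (r p)) w).symm

theorem SmoothCts.smoothIntegrable [MeasurableSpace T] [OpensMeasurableSpace T] [T2Space T]
    {μ : Measure T} [IsFiniteMeasureOnCompacts μ] (hg : SmoothCts g) {K : Set T}
    (hK : IsCompact K) : SmoothIntegrable (μ.restrict K) g := fun L =>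
  (hg L).continuousOn.integrableOn_compact hK

end SmoothCts

theorem SmoothIntegrable.act_integral {Ω : Type*} [MeasurableSpace Ω] {μ : Measure Ω}
    {g : Ω → smoothTorus θ} (hg : SmoothIntegrable μ g) (B : FormalOp θ) :
    (act B ⟨_, hg.mem⟩ : Op d) = ∫ p, (act B (g p) : Op d) ∂μ := by
  simp only [act_apply, Finsupp.sum, Submodule.coe_sum, coe_mul, hg.DSeq_integral]
  rw [integral_finsetSum _ fun α _ => (hg _).const_mul _]
  exact Finset.sum_congr rfl fun α _ => (integral_const_mul_of_integrable (hg _)).symm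

theorem smoothCts_chain (x : smoothTorus θ) (Bs : List (FormalOp θ)) :
    SmoothCts fun t => chain x t Bs := by
  let S : AddSubgroup (ℝ → smoothTorus θ) :=
    { carrier := {f | SmoothCts f}
      zero_mem' := smoothCts_const 0
      add_mem' := fun hf hg => SmoothCts.add hf hg
      neg_mem' := fun hf => SmoothCts.neg hf }
  have h := tMap_mem (S := S) (n := 0) x (K := fun w t => expT x t w)
    (fun w _ => SmoothCts.expT x continuous_id w) (Bs := Bs.reverse) (w := []) (Nat.zero_le _)
  have h2 : (fun t => chain x t Bs) = tMap x (fun w t => expT x t w) Bs.reverse [] := by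
    funext t
    exact (tMap_eval x (expT x) Bs.reverse [] t).symm
  rw [h2]
  exact h

theorem chain_cons_eq_integral (x : smoothTorus θ) (B : FormalOp θ) (Bs : List (FormalOp θ))
    (t : ℝ) : (chain x t (B :: Bs) : Op d) =
      -∫ u in (0 : ℝ)..t, heat x (t - u) * (act B (chain x u Bs) : Op d) :=
  eq_integral_heat ((smoothCts_chain x Bs).act B).continuous (hasDerivAt_chain x B Bs)
    (by rw [chain_zero_cons]; rfl) t

/-! ### The integral formula over the simplex -/

/-- `e^{-r₀x} B₁ e^{-r₁x} B₂ ⋯ B_m e^{-r_m x}`, applied to `1`. -/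
def heatProd (x : smoothTorus θ) {m : ℕ} (r : Fin (m + 1) → ℝ) (B : Fin m → FormalOp θ) :
    smoothTorus θ :=
  (List.ofFn fun (j : Fin m) (g : smoothTorus θ) =>
    expT x (r j.castSucc) [] * act (B j) g).foldr (fun T g => T g) (expT x (r (Fin.last m)) [])

theorem heatProd_succ (x : smoothTorus θ) {m : ℕ} (r : Fin (m + 2) → ℝ)
    (B : Fin (m + 1) → FormalOp θ) :
    heatProd x r B = expT x (r 0) [] *
      act (B 0) (heatProd x (fun j => r j.succ) fun j => B j.succ) := by
  rw [heatProd, List.ofFn_succ, List.foldr_cons]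
  rfl

theorem smoothCts_heatProd {T : Type*} [TopologicalSpace T] (x : smoothTorus θ) {m : ℕ}
    {r : T → Fin (m + 1) → ℝ} (hr : ∀ j, Continuous fun p => r p j) (B : Fin m → FormalOp θ) :
    SmoothCts fun p => heatProd x (r p) B := by
  induction m with
  | zero => exact SmoothCts.expT x (hr 0) []
  | succ m ih =>
    simp only [heatProd_succ]
    exact (SmoothCts.expT x (hr 0) []).mul ((ih (fun j => hr j.succ) _).act _)

theorem smoothCts_heatProd_wt (x : smoothTorus θ) {m : ℕ} (t : ℝ) (B : Fin m → FormalOp θ) :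
    SmoothCts fun s : Fin m → ℝ => heatProd x (fun j => wt s j * t) B :=
  smoothCts_heatProd x (fun j => (continuous_wt j).mul continuous_const) B

/-- Iterated Duhamel formula: each step contributes a sign and, after rescaling the time interval
[0, t] to [0, 1], a factor t; the nested integrals form the integral over the simplex. -/
theorem smul_setIntegral_heatProd (x : smoothTorus θ) {m : ℕ} (B : Fin m → FormalOp θ) (t : ℝ) :
    (((-t) ^ m : ℝ) : ℂ) • ∫ s in simplex m, (heatProd x (fun j => wt s j * t) B : Op d) =
      chain x t (List.ofFn B) := by
  induction m generalizing t with
  | zero =>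
    rw [setIntegral_simplex_zero]
    simp [heatProd, wt, extSeq, chain, tMap]
  | succ m ih =>
    -- The induction hypothesis is used at time tu; the powers match as (-t)^{m+1} u^m = -t
    -- (-(tu))^m. Differentiation under the simplex integral is `SmoothIntegrable.act_integral`.
    have hinner : ∀ u : ℝ, (((-t) ^ (m + 1) : ℝ) : ℂ) • u ^ m • ∫ s in simplex m,
        (heatProd x (fun j => wt (Fin.cons u (u • s) : Fin (m + 1) → ℝ) j * t) B : Op d) =
        -(t • (heat x (t - t * u) *
          (act (B 0) (chain x (t * u) (List.ofFn fun j => B j.succ)) : Op d))) := by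
      intro u
      have hs := (smoothCts_heatProd_wt x (t * u) fun j => B j.succ).smoothIntegrable
        (μ := volume) (isCompact_simplex m)
      have h1 : chain x (t * u) (List.ofFn fun j => B j.succ) =
          (((-(t * u)) ^ m : ℝ) : ℂ) • ⟨_, hs.mem⟩ := Subtype.ext (ih _ _).symm
      simp only [heatProd_succ, wt_cons_zero, wt_cons_succ, coe_mul, expT_nil]
      rw [h1, map_smul, Submodule.coe_smul, hs.act_integral]
      have h2 : ∀ (s : Fin m → ℝ) j, u * wt s j * t = wt s j * (t * u) := fun s j => by ring
      simp only [h2]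
      rw [integral_const_mul_of_integrable (((smoothCts_heatProd_wt x (t * u) fun j =>
        B j.succ).act (B 0)).smoothIntegrable (isCompact_simplex m)).integrable]
      have hr : ∀ (r : ℝ) (T : Op d), r • T = (r : ℂ) • T := fun r T => (Complex.coe_smul r T).symm
      rw [mul_smul_comm, hr (u ^ m), hr t, smul_smul, smul_smul, ← neg_smul]
      congr 1
      · push_cast
        ring
      · congr 2
        ring
    rw [setIntegral_simplex_succ
      ((smoothCts_heatProd_wt x t B).continuous.continuousOn.integrableOn_compact
        (isCompact_simplex _)), ← intervalIntegral.integral_smul]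
    simp only [hinner]
    rw [intervalIntegral.integral_neg, intervalIntegral.integral_smul,
      intervalIntegral.smul_integral_comp_mul_left
        (fun u => heat (x : Op d) (t - u) * (act (B 0) (chain x u (List.ofFn fun j => B j.succ)) : Op d)),
      List.ofFn_succ, chain_cons_eq_integral]
    simp

/-! ### Decay -/

section Decay

variable {x : smoothTorus θ} {c : ℝ}

theorem hasDerivAt_expT_cons (x b : smoothTorus θ) (w : List (smoothTorus θ)) (t : ℝ) :
    HasDerivAt (fun t => (expT x t (b :: w) : Op d))
      (-((x : Op d) * (expT x t (b :: w) : Op d)) - (b : Op d) * (expT x t w : Op d)) t := by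
  refine (hasDerivAt_expT x (b :: w) t).congr_deriv ?_
  rw [heatRhs, Submodule.coe_sub, Submodule.coe_neg, coe_mul, coe_mul]

/-- In Duhamel's formula e^{-c(t-u)} e^{-cu} = e^{-ct}, so the exponential rate is kept and every
argument contributes one factor t. -/
theorem norm_expT_le (hc : ∀ t, 0 ≤ t → ‖heat (x : Op d) t‖ ≤ Real.exp (-(c * t)))
    (w : List (smoothTorus θ)) :
    ∃ C, 0 ≤ C ∧ ∀ t, 0 ≤ t →
      ‖(expT x t w : Op d)‖ ≤ C * (t ^ w.length * Real.exp (-(c * t))) := by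
  induction w with
  | nil => exact ⟨1, zero_le_one, fun t ht => by simpa [expT_nil] using hc t ht⟩
  | cons b w ih =>
    obtain ⟨C, hC0, hC⟩ := ih
    refine ⟨‖(b : Op d)‖ * C, by positivity, fun t ht => ?_⟩
    have hcont : Continuous fun u => (b : Op d) * (expT x u w : Op d) :=
      continuous_const.mul (continuous_expT x w)
    have h := eq_integral_heat (x := (x : Op d)) (y := fun t => (expT x t (b :: w) : Op d)) hcont
      (hasDerivAt_expT_cons x b w) (by simp [expT_zero_cons]) t
    change (expT x t (b :: w) : Op d) = _ at h
    rw [h, norm_neg]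
    have key := intervalIntegral.norm_integral_le_of_norm_le_const (a := 0) (b := t)
      (f := fun u => heat (x : Op d) (t - u) * ((b : Op d) * (expT x u w : Op d)))
      (C := ‖(b : Op d)‖ * C * (t ^ w.length * Real.exp (-(c * t)))) ?_
    · refine key.trans_eq ?_
      rw [sub_zero, abs_of_nonneg ht, List.length_cons, pow_succ]
      ring
    · intro u hu
      rw [Set.uIoc_of_le ht] at hu
      have h1 := hc (t - u) (sub_nonneg.2 hu.2)
      have h2 := hC u hu.1.le
      have h3 : Real.exp (-(c * t)) = Real.exp (-(c * (t - u))) * Real.exp (-(c * u)) := by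
        rw [← Real.exp_add]
        ring_nf
      have h4 : ‖(b : Op d) * (expT x u w : Op d)‖ ≤
          ‖(b : Op d)‖ * (C * (u ^ w.length * Real.exp (-(c * u)))) :=
        (norm_mul_le (b : Op d) (expT x u w : Op d)).trans
          (mul_le_mul_of_nonneg_left h2 (norm_nonneg _))
      have h5 := norm_mul_le (heat (x : Op d) (t - u)) ((b : Op d) * (expT x u w : Op d))
      refine h5.trans ((mul_le_mul h1 h4 (norm_nonneg _) (Real.exp_nonneg _)).trans ?_)
      calc Real.exp (-(c * (t - u))) *
            (‖(b : Op d)‖ * (C * (u ^ w.length * Real.exp (-(c * u)))))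
        _ = ‖(b : Op d)‖ * C * (u ^ w.length * Real.exp (-(c * t))) := by rw [h3]; ring
        _ ≤ _ := by
            have := hu.1.le
            have := hu.2
            gcongr

theorem pow_le_mul_exp (hc0 : 0 < c) (k : ℕ) : ∃ C, 0 ≤ C ∧ ∀ t, 0 ≤ t →
    t ^ k ≤ C * Real.exp (c * t) := by
  refine ⟨k.factorial / c ^ k, by positivity, fun t ht => ?_⟩
  have h := Real.pow_div_factorial_le_exp (c * t) (by positivity) k
  rw [div_le_iff₀ (by positivity), mul_pow] at h
  rw [div_mul_eq_mul_div, le_div_iff₀ (by positivity)]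
  linarith

/-- The lists in the recursion have various lengths, hence various powers of t; the excess over t^n
is absorbed by half of the exponential rate. -/
theorem norm_tMap_le (hc0 : 0 < c) (hc : ∀ t, 0 ≤ t → ‖heat (x : Op d) t‖ ≤ Real.exp (-(c * t))) {n : ℕ}
    {Bs : List (FormalOp θ)} {w : List (smoothTorus θ)} (hw : n ≤ Bs.length + w.length) :
    ∃ C, 0 ≤ C ∧ ∀ t, 0 ≤ t →
      ‖((tMap x (expT x t) Bs w : smoothTorus θ) : Op d)‖ ≤ C * (t ^ n * Real.exp (-(c / 2 * t))) := by
  let S : AddSubgroup (ℝ → smoothTorus θ) :=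
    { carrier := {f | ∃ C, 0 ≤ C ∧ ∀ t, 0 ≤ t →
        ‖(f t : Op d)‖ ≤ C * (t ^ n * Real.exp (-(c / 2 * t)))}
      zero_mem' := ⟨0, le_rfl, fun t _ => by simp⟩
      add_mem' := fun ⟨C, hC0, hC⟩ ⟨C', hC0', hC'⟩ => ⟨C + C', by positivity, fun t ht => by
        rw [add_mul, Pi.add_apply, Submodule.coe_add]
        exact (norm_add_le _ _).trans (add_le_add (hC t ht) (hC' t ht))⟩
      neg_mem' := fun ⟨C, hC0, hC⟩ => ⟨C, hC0, fun t ht => by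
        rw [Pi.neg_apply, Submodule.coe_neg, norm_neg]
        exact hC t ht⟩ }
  have h := tMap_mem (S := S) x (K := fun w t => expT x t w) (fun w hw => ?_) hw
  · obtain ⟨C, hC0, hC⟩ := h
    refine ⟨C, hC0, fun t ht => ?_⟩
    rw [← tMap_eval x (expT x) Bs w t]
    exact hC t ht
  · obtain ⟨C, hC0, hC⟩ := norm_expT_le hc w
    obtain ⟨C', hC0', hC'⟩ := pow_le_mul_exp (half_pos hc0) (w.length - n)
    refine ⟨C * C', by positivity, fun t ht => (hC t ht).trans ?_⟩
    have h1 : t ^ w.length = t ^ n * t ^ (w.length - n) := by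
      rw [← pow_add, Nat.add_sub_cancel' hw]
    have h2 : Real.exp (-(c / 2 * t)) = Real.exp (c / 2 * t) * Real.exp (-(c * t)) := by
      rw [← Real.exp_add]
      ring_nf
    have h3 := hC' t ht
    rw [h1, h2]
    calc C * (t ^ n * t ^ (w.length - n) * Real.exp (-(c * t)))
        ≤ C * (t ^ n * (C' * Real.exp (c / 2 * t)) * Real.exp (-(c * t))) := by gcongr
      _ = _ := by ring

end Decay

theorem integrable_pow_norm_mul_exp {c : ℝ} (hc : 0 < c) (j : ℕ) :
    Integrable fun ξ : EuclideanSpace ℝ (Fin d) => ‖ξ‖ ^ j * Real.exp (-(c * ‖ξ‖ ^ 2)) := by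
  have hg : Integrable fun ξ : EuclideanSpace ℝ (Fin d) => Real.exp (-(c / 2) * ‖ξ‖ ^ 2) := by
    have h := (GaussianFourier.integrable_cexp_neg_mul_sq_norm_add (V := EuclideanSpace ℝ (Fin d))
      (b := (c / 2 : ℝ)) (by simpa using hc) 0 0).norm
    refine h.congr (.of_forall fun ξ => ?_)
    simp only [Complex.norm_exp]
    congr 1
    simp [← Complex.ofReal_pow]
  obtain ⟨C, hC0, hC⟩ := pow_le_mul_exp (half_pos hc) j
  refine (hg.const_mul (C * Real.exp (c / 2))).mono' (by fun_prop) (.of_forall fun ξ => ?_)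
  rw [Real.norm_of_nonneg (by positivity)]
  -- Odd powers occur, so |ξ| is first bounded by 1 + |ξ|², which costs the constant e^{c/2}.
  have h1 : ‖ξ‖ ^ j ≤ (1 + ‖ξ‖ ^ 2) ^ j := by
    gcongr
    nlinarith [sq_nonneg (‖ξ‖ - 1)]
  have h2 := h1.trans (hC (1 + ‖ξ‖ ^ 2) (by positivity))
  have h3 : C * Real.exp (c / 2) * Real.exp (-(c / 2) * ‖ξ‖ ^ 2) =
      C * Real.exp (c / 2 * (1 + ‖ξ‖ ^ 2)) * Real.exp (-(c * ‖ξ‖ ^ 2)) := by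
    rw [mul_assoc, mul_assoc, ← Real.exp_add, ← Real.exp_add]
    ring_nf
  rw [h3]
  gcongr

end

end NCTorus

namespace NCTorus

noncomputable section

variable {d : ℕ}

/-! ### Functional calculus of the positive invertible element -/

section Spectrum

variable {x : Op d} {c : ℝ}

theorem exists_spectrum_lower_bound (hx : x.IsPositive) (hxu : IsUnit x) :
    ∃ c, 0 < c ∧ ∀ r ∈ spectrum ℝ x, c ≤ r := by
  have h0 : (0 : ℝ) ∉ spectrum ℝ x := spectrum.zero_notMem ℝ hxu
  have hopen : (spectrum ℝ x)ᶜ ∈ 𝓝 (0 : ℝ) := (spectrum.isClosed x).isOpen_compl.mem_nhds h0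
  obtain ⟨c, hc, hball⟩ := Metric.mem_nhds_iff.1 hopen
  refine ⟨c, hc, fun r hr => ?_⟩
  by_contra! hlt
  have hr0 : 0 ≤ r := spectrum_nonneg_of_nonneg ((ContinuousLinearMap.nonneg_iff_isPositive x).2 hx) hr
  exact hball (by rwa [mem_ball_zero_iff, Real.norm_of_nonneg hr0]) hr

theorem re_mem_spectrum {A : Type*} [CStarAlgebra A] {x : A} (hsa : IsSelfAdjoint x) {z : ℂ} (hz : z ∈ spectrum ℂ x) :
    z.re ∈ spectrum ℝ x ∧ z = z.re := by
  have h := hsa.mem_spectrum_eq_re hz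
  refine ⟨?_, h⟩
  rw [← spectrum.algebraMap_mem_iff (S := ℂ)]
  rw [h] at hz
  exact hz

theorem cfc_exp_eq_heat (hsa : IsSelfAdjoint x) (t : ℝ) :
    cfc (fun z : ℂ => Complex.exp (((-t : ℝ) : ℂ) • z)) x = heat x t := by
  have hn : IsStarNormal x := hsa.isStarNormal
  have hn' : IsStarNormal (((-t : ℝ) : ℂ) • x) := by
    constructor
    rw [star_smul]
    exact ((hn.star_comm_self).smul_left _).smul_right _
  rw [cfc_comp_smul ((-t : ℝ) : ℂ) Complex.exp x (by fun_prop) hn, heat,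
    CFC.complex_exp_eq_normedSpace_exp hn']

theorem norm_heat_le (hsa : IsSelfAdjoint x) (hc : ∀ r ∈ spectrum ℝ x, c ≤ r) {t : ℝ}
    (ht : 0 ≤ t) : ‖heat x t‖ ≤ Real.exp (-(c * t)) := by
  rw [← cfc_exp_eq_heat hsa]
  refine norm_cfc_le (Real.exp_nonneg _) fun z hz => ?_
  obtain ⟨h1, h2⟩ := re_mem_spectrum hsa hz
  rw [Complex.norm_exp]
  have := mul_le_mul_of_nonneg_right (hc _ h1) ht
  simp only [smul_eq_mul, Complex.re_ofReal_mul]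
  gcongr
  linarith

/-- The truncation `max z.re c` makes the factor bounded on all of ℝ, as `SeparatedSymbol` demands,
and it is inactive on the spectrum. -/
theorem cfc_max_exp (hsa : IsSelfAdjoint x) (hc : ∀ r ∈ spectrum ℝ x, c ≤ r) (κ : ℂ) (t : ℝ) :
    cfc (fun z : ℂ => κ * (Real.exp (-(t * (max z.re c - c))) : ℂ)) x =
      (κ * (Real.exp (t * c) : ℂ)) • heat x t := by
  have hn : IsStarNormal x := hsa.isStarNormal
  rw [← cfc_exp_eq_heat hsa, ← cfc_const_mul _ _ x (by fun_prop)]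
  refine cfc_congr fun z hz => ?_
  obtain ⟨h1, h2⟩ := re_mem_spectrum hsa hz
  rw [max_eq_left (hc _ h1), mul_assoc, Complex.ofReal_exp, Complex.ofReal_exp, ← Complex.exp_add]
  congr 2
  conv_rhs => rw [h2]
  push_cast
  simp only [smul_eq_mul]
  ring

end Spectrum

/-! ### Partitions of unity on a compact set -/

/-- Tent functions max(0, ε - |y - s|) at the centres of a finite cover by ε-balls, divided by their
sum. -/
theorem exists_partition {σ : Set ℝ} (hσ : IsCompact σ) {ε : ℝ} (hε : 0 < ε) :
    ∃ (S : Finset ℝ) (χ : ℝ → ℝ → ℝ), (∀ s ∈ S, s ∈ σ) ∧ (∀ s, ContinuousOn (χ s) σ) ∧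
      (∀ s, ∀ y ∈ σ, 0 ≤ χ s y) ∧ (∀ y ∈ σ, ∑ s ∈ S, χ s y = 1) ∧
      ∀ s, ∀ y ∈ σ, χ s y ≠ 0 → |y - s| < ε := by
  obtain ⟨T, hT, hfin, hcov⟩ := hσ.elim_finite_subcover_image (b := σ)
    (c := fun s => Metric.ball s ε) (fun _ _ => Metric.isOpen_ball)
    (fun y hy => Set.mem_biUnion hy (Metric.mem_ball_self hε))
  let S := hfin.toFinset
  let ψ : ℝ → ℝ → ℝ := fun s y => max 0 (ε - |y - s|)
  have hψ0 : ∀ s y, 0 ≤ ψ s y := fun s y => le_max_left _ _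
  have hψc : ∀ s, Continuous (ψ s) := fun s => by fun_prop
  have hpos : ∀ y ∈ σ, 0 < ∑ s ∈ S, ψ s y := fun y hy => by
    obtain ⟨s, hs, hys⟩ := Set.mem_iUnion₂.1 (hcov hy)
    refine Finset.sum_pos' (fun s _ => hψ0 s y) ⟨s, hfin.mem_toFinset.2 hs, ?_⟩
    rw [Metric.mem_ball, Real.dist_eq] at hys
    exact lt_max_of_lt_right (sub_pos.2 hys)
  refine ⟨S, fun s y => ψ s y / ∑ s ∈ S, ψ s y, fun s hs => hT (hfin.mem_toFinset.1 hs),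
    fun s => (hψc s).continuousOn.div
      (continuous_finsetSum _ fun s _ => hψc s).continuousOn fun y hy => (hpos y hy).ne',
    fun s y hy => div_nonneg (hψ0 s y) (hpos y hy).le, fun y hy => ?_, fun s y hy h => ?_⟩
  · rw [← Finset.sum_div, div_self (hpos y hy).ne']
  · by_contra! hle
    refine h ?_
    have : ψ s y = 0 := max_eq_left (by linarith)
    simp [this]

/-! ### Independence of the separation of variables -/

/-- The multilinear map `(A₀, …, A_n) ↦ A₀ V₁ A₁ ⋯ V_n A_n`. -/
def interlace {n : ℕ} (V : Fin n → Op d) :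
    ContinuousMultilinearMap ℂ (fun _ : Fin (n + 1) => Op d) (Op d) :=
  (ContinuousMultilinearMap.mkPiAlgebraFin ℂ (n + 1) (Op d)).compContinuousLinearMap
    (Fin.cons (ContinuousLinearMap.id ℂ (Op d)) fun j => ContinuousLinearMap.mul ℂ (Op d) (V j))

theorem interlace_apply {n : ℕ} (V : Fin n → Op d) (A : Fin (n + 1) → Op d) :
    interlace V A = A 0 * (List.ofFn fun j : Fin n => V j * A j.succ).prod := by
  simp [interlace, List.ofFn_succ]

section Independence

variable {x : Op d} {n : ℕ} {φ : (Fin (n + 1) → ℝ) → ℂ}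

theorem norm_cfc_factor_le {A : Type*} [CStarAlgebra A] {x : A} (hsa : IsSelfAdjoint x)
    (f : ℝ → ℂ) {C : ℝ} (hC0 : 0 ≤ C) (hC : ∀ y ∈ spectrum ℝ x, ‖f y‖ ≤ C) :
    ‖cfc (fun z : ℂ => f z.re) x‖ ≤ C :=
  norm_cfc_le hC0 fun _ hz => hC _ (re_mem_spectrum hsa hz).1

theorem sum_smul_cfc {A : Type*} [CStarAlgebra A] (x : A) [IsStarNormal x] {ι : Type*}
    (S : Finset ι) (f : ι → ℂ) (χ : ι → ℂ → ℂ) (h : ∀ s ∈ S, ContinuousOn (χ s) (spectrum ℂ x)) :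
    ∑ s ∈ S, f s • cfc (χ s) x = cfc (fun z => ∑ s ∈ S, f s * χ s z) x := by
  classical
  induction S using Finset.induction_on with
  | empty => simp [cfc_const_zero]
  | insert s S hs ih =>
    have h1 := h s (Finset.mem_insert_self s S)
    have h2 : ∀ s ∈ S, ContinuousOn (χ s) (spectrum ℂ x) := fun t ht =>
      h t (Finset.mem_insert_of_mem ht)
    rw [Finset.sum_insert hs, ih h2, ← cfc_const_mul (f s) (χ s) x h1,
      ← cfc_add x (fun z => f s * χ s z) (fun z => ∑ s ∈ S, f s * χ s z)
        (continuousOn_const.mul h1)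
        (continuousOn_finsetSum _ fun s hs => continuousOn_const.mul (h2 s hs))]
    simp only [Finset.sum_insert hs]

/-- Riemann sums for the functional calculus of `x`. -/
theorem exists_tendsto_cfc {A : Type*} [CStarAlgebra A] {x : A} (hsa : IsSelfAdjoint x) :
    ∃ (S : ℕ → Finset ℝ) (Q : ℕ → ℝ → A), (∀ p, ∀ s ∈ S p, s ∈ spectrum ℝ x) ∧
      (∀ (f : ℝ → ℂ) (C : ℝ), 0 ≤ C → (∀ y, ‖f y‖ ≤ C) → ∀ p, ‖∑ s ∈ S p, f s • Q p s‖ ≤ C) ∧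
      ∀ f : ℝ → ℂ, Continuous f →
        Tendsto (fun p => ∑ s ∈ S p, f s • Q p s) atTop (𝓝 (cfc (fun z : ℂ => f z.re) x)) := by
  have hσ : IsCompact (spectrum ℝ x) := spectrum.isCompact x
  have hn : IsStarNormal x := hsa.isStarNormal
  choose S χ hS hχc hχ0 hχ1 hχε using fun p : ℕ =>
    exists_partition hσ (ε := 1 / ((p : ℝ) + 1)) (by positivity)
  -- The weights are the functional calculus of a partition of unity and do not depend on `f`. The
  -- sum ∑ f(s) Q_s is the functional calculus of ∑ f(s) χ_s, which tends to f uniformly on the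
  -- spectrum by uniform continuity.
  let Q : ℕ → ℝ → A := fun p s => cfc (fun z : ℂ => (χ p s z.re : ℂ)) x
  have hχcont : ∀ p s, ContinuousOn (fun z : ℂ => (χ p s z.re : ℂ)) (spectrum ℂ x) := fun p s =>
    Complex.continuous_ofReal.comp_continuousOn ((hχc p s).comp Complex.continuous_re.continuousOn
      fun z hz => (re_mem_spectrum hsa hz).1)
  have happrox : ∀ (f : ℝ → ℂ) (p : ℕ), ∑ s ∈ S p, f s • Q p s =
      cfc (fun z : ℂ => (fun y : ℝ => ∑ s ∈ S p, f s * (χ p s y : ℂ)) z.re) x := fun f p =>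
    sum_smul_cfc x (S p) f (fun s (z : ℂ) => (χ p s z.re : ℂ)) fun s _ => hχcont p s
  have hbound : ∀ (f : ℝ → ℂ) (C : ℝ), 0 ≤ C → (∀ y, ‖f y‖ ≤ C) → ∀ p,
      ‖∑ s ∈ S p, f s • Q p s‖ ≤ C := by
    intro f C hC0 hC p
    rw [happrox]
    refine norm_cfc_factor_le hsa (fun y : ℝ => ∑ s ∈ S p, f s * (χ p s y : ℂ)) hC0 fun y hy => ?_
    calc ‖∑ s ∈ S p, f s * (χ p s y : ℂ)‖ ≤ ∑ s ∈ S p, C * χ p s y := by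
          refine norm_sum_le_of_le _ fun s _ => ?_
          rw [norm_mul, Complex.norm_real, Real.norm_of_nonneg (hχ0 p s y hy)]
          exact mul_le_mul_of_nonneg_right (hC s) (hχ0 p s y hy)
      _ = C := by rw [← Finset.mul_sum, hχ1 p y hy, mul_one]
  have hlim : ∀ f : ℝ → ℂ, Continuous f →
      Tendsto (fun p => ∑ s ∈ S p, f s • Q p s) atTop (𝓝 (cfc (fun z : ℂ => f z.re) x)) := by
    intro f hf
    simp only [happrox]
    refine tendsto_cfc_fun ?_ (.of_forall fun p => ?_)
    · rw [Metric.tendstoUniformlyOn_iff]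
      intro δ hδ
      have huc := hσ.uniformContinuousOn_of_continuous hf.continuousOn
      rw [Metric.uniformContinuousOn_iff] at huc
      obtain ⟨η, hη, hηf⟩ := huc (δ / 2) (half_pos hδ)
      have hev : ∀ᶠ p : ℕ in atTop, 1 / ((p : ℝ) + 1) < η :=
        tendsto_one_div_add_atTop_nhds_zero_nat.eventually (gt_mem_nhds hη)
      filter_upwards [hev] with p hp z hz
      have hy := (re_mem_spectrum hsa hz).1
      set y := z.re
      have h1 : f y - ∑ s ∈ S p, f s * (χ p s y : ℂ) =
          ∑ s ∈ S p, (f y - f s) * (χ p s y : ℂ) := by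
        have : (∑ s ∈ S p, (χ p s y : ℂ)) = 1 := by
          rw [← Complex.ofReal_sum, hχ1 p y hy, Complex.ofReal_one]
        simp only [sub_mul, Finset.sum_sub_distrib, ← Finset.mul_sum, this, mul_one]
      rw [dist_eq_norm, h1]
      refine lt_of_le_of_lt (b := δ / 2) ?_ (half_lt_self hδ)
      calc ‖∑ s ∈ S p, (f y - f s) * (χ p s y : ℂ)‖ ≤ ∑ s ∈ S p, δ / 2 * χ p s y := by
            refine norm_sum_le_of_le _ fun s hs => ?_
            rw [norm_mul, Complex.norm_real, Real.norm_of_nonneg (hχ0 p s y hy)]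
            by_cases h0 : χ p s y = 0
            · simp [h0]
            · refine mul_le_mul_of_nonneg_right ?_ (hχ0 p s y hy)
              rw [← dist_eq_norm]
              exact (hηf y hy s (hS p s hs)
                (by rw [Real.dist_eq]; exact (hχε p s y hy h0).trans hp)).le
        _ = δ / 2 := by rw [← Finset.mul_sum, hχ1 p y hy, mul_one]
    · exact continuousOn_finsetSum _ fun s _ => continuousOn_const.mul (hχcont p s)
  exact ⟨S, Q, hS, hbound, hlim⟩

theorem multilinear_sum_smul {ι M M' κ : Type*} [Fintype ι] [DecidableEq ι]
    [NormedAddCommGroup M] [NormedSpace ℂ M] [NormedAddCommGroup M'] [NormedSpace ℂ M']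
    (T : ContinuousMultilinearMap ℂ (fun _ : ι => M) M') (S : Finset κ) (c : ι → κ → ℂ)
    (Q : κ → M) : (T fun j => ∑ s ∈ S, c j s • Q s) =
      ∑ s ∈ Fintype.piFinset fun _ : ι => S, (∏ j, c j (s j)) • T fun j => Q (s j) := by
  have h := T.toMultilinearMap.map_sum_finset (fun j s => c j s • Q s) fun _ => S
  refine h.trans (Finset.sum_congr rfl fun s _ => ?_)
  exact T.toMultilinearMap.map_smul_univ (fun j => c j (s j)) fun j => Q (s j)

/-- Riemann sums for integrals of multilinear expressions in the functional calculus of `x`. -/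
theorem exists_tendsto_integral_multilinear {A : Type*} [CStarAlgebra A] {x : A}
    (hsa : IsSelfAdjoint x) (n : ℕ) :
    ∃ (S : ℕ → Finset ℝ) (Q : ℕ → ℝ → A), (∀ p, ∀ s ∈ S p, s ∈ spectrum ℝ x) ∧
      ∀ {Ω : Type} [MeasurableSpace Ω] (μ : Measure Ω) [IsFiniteMeasure μ]
        (g : Fin (n + 1) → ℝ → Ω → ℂ) (C : ℝ)
        (T : ContinuousMultilinearMap ℂ (fun _ : Fin (n + 1) => A) A), 0 ≤ C →
        (∀ j s, Measurable (g j s)) → (∀ j s ω, ‖g j s ω‖ ≤ C) →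
        (∀ j ω, Continuous fun s => g j s ω) →
        Integrable (fun ω => T fun j => cfc (fun z : ℂ => g j z.re ω) x) μ ∧
        Tendsto (fun p => ∑ s ∈ Fintype.piFinset fun _ : Fin (n + 1) => S p,
          (∫ ω, ∏ j, g j (s j) ω ∂μ) • T fun j => Q p (s j)) atTop
          (𝓝 (∫ ω, (T fun j => cfc (fun z : ℂ => g j z.re ω) x) ∂μ)) := by
  obtain ⟨S, Q, hS, hbound, hlim⟩ := exists_tendsto_cfc hsa
  refine ⟨S, Q, hS, fun {Ω} _ μ _ g C T hC0 hmeas hC hcont => ?_⟩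
  have hexp : ∀ p ω, (T fun j => ∑ s ∈ S p, g j s ω • Q p s) =
      ∑ s ∈ Fintype.piFinset fun _ : Fin (n + 1) => S p,
        (∏ j, g j (s j) ω) • T fun j => Q p (s j) :=
    fun p ω => multilinear_sum_smul T (S p) (fun j s => g j s ω) (Q p)
  have hscal : ∀ s : Fin (n + 1) → ℝ, Integrable (fun ω => ∏ j, g j (s j) ω) μ := by
    intro s
    refine Integrable.of_bound
      (Finset.measurable_prod _ fun j _ => hmeas j (s j)).aestronglyMeasurable (C ^ (n + 1))
      (.of_forall fun ω => ?_)
    rw [norm_prod]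
    refine (Finset.prod_le_prod (fun j _ => norm_nonneg _) fun j _ => hC j (s j) ω).trans_eq ?_
    simp
  have hterm : ∀ p (s : Fin (n + 1) → ℝ), Integrable
      (fun ω => (∏ j, g j (s j) ω) • T fun j => Q p (s j)) μ := fun p s =>
    (hscal s).smul_const (T fun j => Q p (s j))
  have hFm : ∀ p, Integrable (fun ω => T fun j => ∑ s ∈ S p, g j s ω • Q p s) μ := by
    intro p
    simp only [hexp]
    exact integrable_finsetSum _ fun s _ => hterm p s
  have hFb : ∀ p ω, ‖T fun j => ∑ s ∈ S p, g j s ω • Q p s‖ ≤ ‖T‖ * C ^ (n + 1) := by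
    intro p ω
    refine (T.le_opNorm _).trans (mul_le_mul_of_nonneg_left ?_ (norm_nonneg _))
    refine (Finset.prod_le_prod (fun j _ => norm_nonneg _) fun j _ =>
      hbound (fun s => g j s ω) C hC0 (fun y => hC j y ω) p).trans_eq ?_
    simp
  have hFlim : ∀ ω, Tendsto (fun p => T fun j => ∑ s ∈ S p, g j s ω • Q p s) atTop
      (𝓝 (T fun j => cfc (fun z : ℂ => g j z.re ω) x)) := fun ω =>
    (T.cont.tendsto _).comp (tendsto_pi_nhds.2 fun j =>
      hlim (fun s => g j s ω) (hcont j ω))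
  constructor
  -- Measurability of the operator-valued integrand comes from its being a pointwise limit of finite
  -- sums of measurable scalars times fixed operators.
  · refine Integrable.of_bound (aestronglyMeasurable_of_tendsto_ae atTop
      (fun p => (hFm p).aestronglyMeasurable) (.of_forall hFlim))
      (‖T‖ * C ^ (n + 1)) (.of_forall fun ω => ?_)
    exact le_of_tendsto ((hFlim ω).norm) (.of_forall fun p => hFb p ω)
  · refine (tendsto_integral_of_dominated_convergence (fun _ => ‖T‖ * C ^ (n + 1))
      (fun p => (hFm p).aestronglyMeasurable) (integrable_const _)
      (fun p => .of_forall (hFb p)) (.of_forall hFlim)).congr fun p => ?_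
    simp only [hexp]
    rw [integral_finsetSum _ fun s _ => hterm p s]
    exact Finset.sum_congr rfl fun s hs => integral_smul_const _ _

/-- Riemann sums for multiple operator integrals: there are weighted nodes, depending on `x` only,
that compute the multiple operator integrals of all symbols. -/
theorem SeparatedSymbol.exists_tendsto_integral (hsa : IsSelfAdjoint x) :
    ∃ (S : ℕ → Finset ℝ) (Q : ℕ → ℝ → Op d),
      ∀ (r : SeparatedSymbol x n φ) (V : Fin n → Op d),
        letI := r.mΩ
        Integrable (fun p => interlace V fun j => cfc (fun z : ℂ => r.factor j z.re p) x) r.μ ∧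
        Tendsto (fun p => ∑ s ∈ Fintype.piFinset fun _ : Fin (n + 1) => S p,
          φ s • interlace V fun j => Q p (s j)) atTop (𝓝 (r.integral V)) := by
  obtain ⟨S, Q, hS, h⟩ := exists_tendsto_integral_multilinear hsa n
  refine ⟨S, Q, fun r V => ?_⟩
  let := r.mΩ
  have := r.finite_measure
  obtain ⟨C, hC⟩ := r.bounded_factor
  obtain ⟨h1, h2⟩ := h r.μ r.factor |C| (interlace V) (abs_nonneg C)
    (fun j s => (r.measurable_factor j).comp measurable_prodMk_left)
    (fun j α p => (hC j α p).trans (le_abs_self C)) r.continuous_factor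
  refine ⟨h1, ?_⟩
  have hint : r.integral V =
      ∫ ω, (interlace V fun j => cfc (fun z : ℂ => r.factor j z.re ω) x) ∂r.μ := by
    simp only [interlace_apply]
    rfl
  rw [hint]
  refine h2.congr fun p => Finset.sum_congr rfl fun s hs => ?_
  -- The nodes lie in the spectrum, so the scalar integrals are values of the symbol and the sums no
  -- longer involve the separation.
  rw [← r.symbol_eq s fun j => hS p _ (Fintype.mem_piFinset.1 hs j)]

theorem SeparatedSymbol.integrable (hsa : IsSelfAdjoint x) (r : SeparatedSymbol x n φ)
    (V : Fin n → Op d) : letI := r.mΩ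
    Integrable (fun p => interlace V fun j => cfc (fun z : ℂ => r.factor j z.re p) x) r.μ := by
  obtain ⟨S, Q, h⟩ := SeparatedSymbol.exists_tendsto_integral (φ := φ) hsa
  exact (h r V).1

theorem SeparatedSymbol.integral_eq_interlace (r : SeparatedSymbol x n φ) (V : Fin n → Op d) :
    letI := r.mΩ
    r.integral V = ∫ p, (interlace V fun j => cfc (fun z : ℂ => r.factor j z.re p) x) ∂r.μ := by
  simp only [interlace_apply]
  rfl

/-- All separations of one symbol share the same Riemann sums, so the chosen one may be replaced by
`r`. -/
theorem moi_eq_integral (hsa : IsSelfAdjoint x) (r : SeparatedSymbol x n φ) (V : Fin n → Op d) :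
    moi x φ V = r.integral V := by
  have hne : Nonempty (SeparatedSymbol x n φ) := ⟨r⟩
  obtain ⟨S, Q, h⟩ := SeparatedSymbol.exists_tendsto_integral (φ := φ) hsa
  rw [moi, dif_pos hne]
  exact tendsto_nhds_unique (h hne.some V).2 (h r V).2

end Independence

end

end NCTorus

namespace NCTorus

noncomputable section

variable {d : ℕ} {θ : Matrix (Fin d) (Fin d) ℝ}

/-! ### Gaussian moments and primitives of powers -/

/-- `∫ ‖ξ‖^{2q} e^{-y‖ξ‖²} dξ`. -/
def gaussMoment (d q : ℕ) (y : ℝ) : ℝ :=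
  ∫ ξ : EuclideanSpace ℝ (Fin d), ‖ξ‖ ^ (2 * q) * Real.exp (-(y * ‖ξ‖ ^ 2))

theorem gaussMoment_zero {y : ℝ} (hy : 0 < y) :
    gaussMoment d 0 y = Real.pi ^ ((d : ℝ) / 2) * y ^ (-(d : ℝ) / 2) := by
  have h := GaussianFourier.integral_rexp_neg_mul_sq_norm (V := EuclideanSpace ℝ (Fin d)) hy
  simp only [finrank_euclideanSpace, Fintype.card_fin] at h
  rw [gaussMoment]
  simp only [mul_zero, pow_zero, one_mul, ← neg_mul]
  rw [h, Real.div_rpow Real.pi_pos.le hy.le, neg_div, Real.rpow_neg hy.le, div_eq_mul_inv]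

/-- Differentiation under the integral brings down -|ξ|²; for parameters above y/2 a Gaussian with
parameter y/2 dominates. -/
theorem hasDerivAt_gaussMoment (q : ℕ) {y : ℝ} (hy : 0 < y) :
    HasDerivAt (gaussMoment d q) (-gaussMoment d (q + 1) y) y := by
  have hcont : ∀ (p : ℕ) (z : ℝ), Continuous fun ξ : EuclideanSpace ℝ (Fin d) =>
      ‖ξ‖ ^ p * Real.exp (-(z * ‖ξ‖ ^ 2)) := fun p z => by fun_prop
  have h := (hasDerivAt_integral_of_dominated_loc_of_deriv_le (𝕜 := ℝ)
    (μ := (volume : Measure (EuclideanSpace ℝ (Fin d))))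
    (F := fun z ξ => ‖ξ‖ ^ (2 * q) * Real.exp (-(z * ‖ξ‖ ^ 2)))
    (F' := fun z ξ => -(‖ξ‖ ^ (2 * (q + 1)) * Real.exp (-(z * ‖ξ‖ ^ 2))))
    (bound := fun ξ => ‖ξ‖ ^ (2 * (q + 1)) * Real.exp (-(y / 2 * ‖ξ‖ ^ 2)))
    (Ioi_mem_nhds (half_lt_self hy))
    (.of_forall fun z => (hcont _ z).aestronglyMeasurable)
    (integrable_pow_norm_mul_exp hy _) (hcont _ y).neg.aestronglyMeasurable
    (.of_forall fun ξ z hz => ?_) (integrable_pow_norm_mul_exp (half_pos hy) _)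
    (.of_forall fun ξ z _ => ?_)).2
  · rw [integral_neg] at h
    exact h
  · rw [norm_neg, Real.norm_of_nonneg (by positivity)]
    gcongr
    exact le_of_lt hz
  · have h1 : HasDerivAt (fun z : ℝ => -(z * ‖ξ‖ ^ 2)) (-(1 * ‖ξ‖ ^ 2)) z :=
      ((hasDerivAt_id z).mul_const _).neg
    refine (h1.exp.const_mul (‖ξ‖ ^ (2 * q))).congr_deriv ?_
    ring

/-- The derivatives of a primitive of order `h` of `y ↦ y^{-d/2}`. -/
def primitiveDeriv (d h : ℕ) (F : ℝ → ℝ) (i : ℕ) (y : ℝ) : ℝ :=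
  if i < h then iteratedDeriv i F y
  else (-1) ^ (i - h) * (Real.pi ^ ((d : ℝ) / 2))⁻¹ * gaussMoment d (i - h) y

section Primitive

variable {k : ℕ} {F : ℝ → ℝ}

theorem IsPowerPrimitive.iteratedDeriv_eq (hF : IsPowerPrimitive k d F) {y : ℝ} (hy : 0 < y) :
    iteratedDeriv (k / 2) F y = (Real.pi ^ ((d : ℝ) / 2))⁻¹ * gaussMoment d 0 y := by
  rw [hF.2 y hy, gaussMoment_zero hy, inv_mul_cancel_left₀]
  exact (Real.rpow_pos_of_pos Real.pi_pos _).ne'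

theorem IsPowerPrimitive.primitiveDeriv_zero (hF : IsPowerPrimitive k d F) :
    Set.EqOn F (primitiveDeriv d (k / 2) F 0) (Set.Ioi 0) := fun y hy => by
  rw [primitiveDeriv]
  split_ifs with h
  · rw [iteratedDeriv_zero]
  · have h0 : k / 2 = 0 := by omega
    have := hF.iteratedDeriv_eq hy
    rw [h0, iteratedDeriv_zero] at this
    rw [this, h0]
    simp

theorem IsPowerPrimitive.hasDerivAt_primitiveDeriv (hF : IsPowerPrimitive k d F) (i : ℕ) (y : ℝ)
    (hy : 0 < y) : HasDerivAt (primitiveDeriv d (k / 2) F i)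
      (primitiveDeriv d (k / 2) F (i + 1) y) y := by
  by_cases hi : i < k / 2
  · have hd : HasDerivAt (iteratedDeriv i F) (iteratedDeriv (i + 1) F y) y := by
      have h1 := hF.1.differentiableOn_iteratedDerivWithin (m := i) (by exact_mod_cast hi)
        isOpen_Ioi.uniqueDiffOn
      have h2 := (h1.congr fun z hz => (iteratedDerivWithin_of_isOpen isOpen_Ioi hz).symm) y hy
      rw [iteratedDeriv_succ]
      exact (h2.differentiableAt (Ioi_mem_nhds hy)).hasDerivAt
    have e1 : primitiveDeriv d (k / 2) F i = iteratedDeriv i F := by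
      funext z
      rw [primitiveDeriv, if_pos hi]
    rw [e1]
    refine hd.congr_deriv ?_
    rw [primitiveDeriv]
    split_ifs with h
    · rfl
    -- The order k/2 is where the derivatives of the arbitrary primitive become the zeroth Gaussian
    -- moment.
    · have : i + 1 = k / 2 := by omega
      rw [this, hF.iteratedDeriv_eq hy]
      simp
  · have e1 : primitiveDeriv d (k / 2) F i =
        fun y => (-1) ^ (i - k / 2) * (Real.pi ^ ((d : ℝ) / 2))⁻¹ * gaussMoment d (i - k / 2) y := by
      funext z
      rw [primitiveDeriv, if_neg hi]
    rw [e1, primitiveDeriv, if_neg (by omega), Nat.sub_add_comm (by omega)]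
    refine ((hasDerivAt_gaussMoment (i - k / 2) hy).const_mul _).congr_deriv ?_
    rw [pow_succ]
    ring

/-- For n ≥ k/2 the Hermite–Genocchi formula contains only the n-th derivative, a Gaussian moment;
the freedom in the choice of `F` drops out. -/
theorem IsPowerPrimitive.divDiff_eq (hF : IsPowerPrimitive k d F) {n : ℕ} (hn : k / 2 ≤ n)
    {α : Fin (n + 1) → ℝ} (hα : ∀ j, 0 < α j) :
    divDiff n F α = (-1) ^ (n - k / 2) * (Real.pi ^ ((d : ℝ) / 2))⁻¹ *
      ∫ s in simplex n, gaussMoment d (n - k / 2) (∑ j, wt s j * α j) := by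
  rw [divDiff_congr hF.primitiveDeriv_zero hα,
    divDiff_eq_setIntegral hF.hasDerivAt_primitiveDeriv hα, ← integral_const_mul]
  simp only [primitiveDeriv, if_neg hn.not_gt]

end Primitive

end

end NCTorus

namespace NCTorus

noncomputable section

variable {d : ℕ} {θ : Matrix (Fin d) (Fin d) ℝ}

/-! ### Heat products without differentiation -/

theorem powT_eq_zero (x : smoothTorus θ) (p : ℕ) {w : List (smoothTorus θ)} (hw : 0 ∈ w) :
    powT x p w = 0 := by
  induction p generalizing w with
  | zero =>
    cases w with
    | nil => simp at hw
    | cons b w => rfl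
  | succ p ih =>
    cases w with
    | nil => simp at hw
    | cons b w =>
      rw [powT, ih hw]
      rcases List.mem_cons.1 hw with h | h
      · rw [← h]
        ext1
        simp
      · rw [ih h]
        ext1
        simp

theorem expT_eq_zero (x : smoothTorus θ) (t : ℝ) {w : List (smoothTorus θ)} (hw : 0 ∈ w) :
    expT x t w = 0 := by
  ext1
  change ∑' p : ℕ, _ = _
  simp [powT_eq_zero x _ hw]

/-- Operators of order zero trigger no differentiation. The hypothesis on `K` is needed since
`Finsupp.single 0 0` is the zero operator, whose sum is empty. -/
theorem tMap_map_single_zero {M : Type*} [AddCommGroup M] (x : smoothTorus θ)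
    {K : List (smoothTorus θ) → M} (hK : ∀ w, 0 ∈ w → K w = 0) (L w : List (smoothTorus θ)) :
    tMap x K (L.map (Finsupp.single 0)) w = K (L.reverse ++ w) := by
  induction L generalizing w with
  | nil => rfl
  | cons b L ih =>
    rw [List.map_cons, tMap, Finsupp.sum_single_index]
    · rw [idx_zero]
      change tMap x K (L.map (Finsupp.single 0)) (b :: w) = _
      rw [ih]
      simp
    · rw [idx_zero]
      change tMap x K (L.map (Finsupp.single 0)) (0 :: w) = _
      rw [ih]
      exact hK _ (by simp)

/-- This makes the simplex formula for `chain` available for the plain multiple operator integral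
`expT`. -/
theorem chain_ofFn_single_zero (x : smoothTorus θ) (t : ℝ) (w : List (smoothTorus θ)) :
    chain x t (List.ofFn fun j => Finsupp.single 0 (w.get j)) = expT x t w := by
  have h : (List.ofFn fun j => (Finsupp.single 0 (w.get j) : FormalOp θ)) =
      w.map (Finsupp.single 0) := by
    conv_rhs => rw [← List.ofFn_get w, List.map_ofFn]
    rfl
  rw [chain, h, ← List.map_reverse,
    tMap_map_single_zero x fun w hw => expT_eq_zero x t hw]
  simp

theorem act_single_zero (b g : smoothTorus θ) :
    act (Finsupp.single 0 b) g = b * g := by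
  rw [act_apply, Finsupp.sum_single_index, idx_zero]
  · rfl
  · ext1
    simp

theorem coe_heatProd_single_zero (x : smoothTorus θ) {n : ℕ} (r : Fin (n + 1) → ℝ)
    (b : Fin n → smoothTorus θ) :
    (heatProd x r (fun j => Finsupp.single 0 (b j)) : Op d) =
      interlace (fun j => (b j : Op d)) fun j => heat (x : Op d) (r j) := by
  rw [interlace_apply]
  induction n with
  | zero => simp [heatProd, expT_nil]
  | succ n ih =>
    rw [heatProd_succ, coe_mul, act_single_zero, coe_mul, ih, expT_nil, List.ofFn_succ,
      List.prod_cons, mul_assoc]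

/-! ### The multiple operator integral for a primitive of a power -/

section Symbol

variable {k n : ℕ} {F : ℝ → ℝ} {x : Op d} {c : ℝ}

/-- The weight `‖ξ‖^{2q} e^{-c‖ξ‖²}` on `ℝ^d`. -/
def gaussWeight (d q : ℕ) (c : ℝ) (ξ : EuclideanSpace ℝ (Fin d)) : ℝ :=
  ‖ξ‖ ^ (2 * q) * Real.exp (-(c * ‖ξ‖ ^ 2))

theorem gaussWeight_nonneg (q : ℕ) (c : ℝ) (ξ : EuclideanSpace ℝ (Fin d)) :
    0 ≤ gaussWeight d q c ξ := by
  rw [gaussWeight]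
  positivity

theorem continuous_gaussWeight (q : ℕ) (c : ℝ) : Continuous (gaussWeight d q c) := by
  unfold gaussWeight
  fun_prop

/-- The measure `‖ξ‖^{2q} e^{-c‖ξ‖²} dξ`. -/
def gaussMeasure (d q : ℕ) (c : ℝ) : Measure (EuclideanSpace ℝ (Fin d)) :=
  volume.withDensity fun ξ => (gaussWeight d q c ξ).toNNReal

theorem isFiniteMeasure_gaussMeasure (q : ℕ) (hc : 0 < c) :
    IsFiniteMeasure (gaussMeasure d q c) :=
  isFiniteMeasure_withDensity_ofReal (integrable_pow_norm_mul_exp hc (2 * q)).2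

theorem integral_gaussMeasure {E : Type*} [NormedAddCommGroup E] [NormedSpace ℝ E] (q : ℕ)
    (g : EuclideanSpace ℝ (Fin d) → E) :
    ∫ ξ, g ξ ∂gaussMeasure d q c = ∫ ξ, gaussWeight d q c ξ • g ξ := by
  rw [gaussMeasure, integral_withDensity_eq_integral_smul
    (continuous_gaussWeight q c).measurable.real_toNNReal]
  refine integral_congr_ae (.of_forall fun ξ => ?_)
  simp only [NNReal.smul_def, Real.coe_toNNReal _ (gaussWeight_nonneg q c ξ)]

/-- The exponents of the separated factors. -/
def symbolTime (n : ℕ) (j : Fin (n + 1)) (p : EuclideanSpace ℝ (Fin d) × (Fin n → ℝ)) : ℝ :=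
  ‖p.1‖ ^ 2 * max (wt p.2 j) 0

theorem continuous_symbolTime (j : Fin (n + 1)) : Continuous (symbolTime (d := d) n j) :=
  (continuous_fst.norm.pow 2).mul (((continuous_wt j).comp continuous_snd).max continuous_const)

theorem symbolTime_nonneg (j : Fin (n + 1)) (p : EuclideanSpace ℝ (Fin d) × (Fin n → ℝ)) :
    0 ≤ symbolTime n j p := mul_nonneg (sq_nonneg _) (le_max_right _ _)

theorem symbolTime_eq {s : Fin n → ℝ} (hs : s ∈ simplex n) (j : Fin (n + 1))
    (ξ : EuclideanSpace ℝ (Fin d)) : symbolTime n j (ξ, s) = wt s j * ‖ξ‖ ^ 2 := by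
  rw [symbolTime, max_eq_left (wt_nonneg hs j), mul_comm]

theorem sum_symbolTime {s : Fin n → ℝ} (hs : s ∈ simplex n) (ξ : EuclideanSpace ℝ (Fin d)) :
    ∑ j, symbolTime n j (ξ, s) = ‖ξ‖ ^ 2 := by
  simp only [symbolTime_eq hs, ← Finset.sum_mul, sum_wt, one_mul]

/-- The separated factors of `F^{[n]}`. -/
def symbolFactor (d k n : ℕ) (c : ℝ) (j : Fin (n + 1)) (α : ℝ)
    (p : EuclideanSpace ℝ (Fin d) × (Fin n → ℝ)) : ℝ :=
  (if j = 0 then (-1) ^ (n - k / 2) * (Real.pi ^ ((d : ℝ) / 2))⁻¹ else 1) *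
    Real.exp (-(symbolTime n j p * (max α c - c)))

theorem prod_symbolFactor (α : Fin (n + 1) → ℝ) (p : EuclideanSpace ℝ (Fin d) × (Fin n → ℝ)) :
    ∏ j, symbolFactor d k n c j (α j) p = (-1) ^ (n - k / 2) * (Real.pi ^ ((d : ℝ) / 2))⁻¹ *
      Real.exp (-∑ j, symbolTime n j p * (max (α j) c - c)) := by
  simp only [symbolFactor, Finset.prod_mul_distrib, Finset.prod_ite_eq', Finset.mem_univ, if_true]
  rw [← Real.exp_sum, Finset.sum_neg_distrib]

theorem continuous_symbolFactor (j : Fin (n + 1)) :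
    Continuous (Function.uncurry (symbolFactor d k n c j)) := by
  have h := (continuous_symbolTime (d := d) j).comp (continuous_snd (X := ℝ))
  have h2 : Continuous fun q : ℝ × (EuclideanSpace ℝ (Fin d) × (Fin n → ℝ)) => max q.1 c - c :=
    (continuous_fst.max continuous_const).sub continuous_const
  exact continuous_const.mul (Real.continuous_exp.comp (h.mul h2).neg)

/-- Truncating the weights at 0 and α at c keeps every exponent nonpositive everywhere; on the
simplex and above c the truncations do nothing. -/
theorem abs_symbolFactor_le (j : Fin (n + 1)) (α : ℝ)
    (p : EuclideanSpace ℝ (Fin d) × (Fin n → ℝ)) :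
    |symbolFactor d k n c j α p| ≤ max |(-1) ^ (n - k / 2) * (Real.pi ^ ((d : ℝ) / 2))⁻¹| 1 := by
  rw [symbolFactor, abs_mul, Real.abs_exp]
  refine mul_le_of_le_one_right (abs_nonneg _) ?_ |>.trans ?_
  · rw [Real.exp_le_one_iff, neg_nonpos]
    exact mul_nonneg (symbolTime_nonneg _ _) (sub_nonneg.2 (le_max_right _ _))
  · split_ifs
    · exact le_max_left _ _
    · simp

/-- The factor e^{-c|ξ|²} is moved into the measure: the measure becomes finite and the remaining
factors, which contain α - c, stay bounded. -/
theorem IsPowerPrimitive.divDiff_eq_integral (hF : IsPowerPrimitive k d F) (hn : k / 2 ≤ n)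
    (hc0 : 0 < c) {α : Fin (n + 1) → ℝ} (hα : ∀ j, c ≤ α j) :
    divDiff n F α = ∫ p, ∏ j, symbolFactor d k n c j (α j) p
      ∂(gaussMeasure d (n - k / 2) c).prod (volume.restrict (simplex n)) := by
  have := isFiniteMeasure_gaussMeasure (d := d) (n - k / 2) hc0
  have : IsFiniteMeasure ((volume : Measure (Fin n → ℝ)).restrict (simplex n)) :=
    isFiniteMeasure_restrict.2 (isCompact_simplex n).measure_lt_top.ne
  have hint : Integrable (fun p => ∏ j, symbolFactor d k n c j (α j) p)
      ((gaussMeasure d (n - k / 2) c).prod (volume.restrict (simplex n))) := by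
    refine Integrable.of_bound (continuous_finsetProd _ fun j _ =>
      (continuous_symbolFactor j).comp (continuous_const.prodMk continuous_id)).aestronglyMeasurable
      ((max |(-1) ^ (n - k / 2) * (Real.pi ^ ((d : ℝ) / 2))⁻¹| 1) ^ (n + 1)) (.of_forall fun p => ?_)
    rw [Real.norm_eq_abs, Finset.abs_prod]
    refine (Finset.prod_le_prod (fun j _ => abs_nonneg _) fun j _ =>
      abs_symbolFactor_le j (α j) p).trans_eq ?_
    simp
  rw [integral_prod_symm _ hint, hF.divDiff_eq hn fun j => hc0.trans_le (hα j),
    ← integral_const_mul]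
  refine setIntegral_congr_fun (isClosed_simplex n).measurableSet fun s hs => ?_
  simp only [integral_gaussMeasure, prod_symbolFactor, smul_eq_mul]
  rw [gaussMoment, ← integral_const_mul]
  refine integral_congr_ae (.of_forall fun ξ => ?_)
  -- The weights sum to 1, so lowering every α_j by c changes the exponent by exactly c|ξ|².
  have h1 : ∑ j, symbolTime n j (ξ, s) * (max (α j) c - c) =
      (∑ j, wt s j * α j) * ‖ξ‖ ^ 2 - c * ‖ξ‖ ^ 2 := by
    have h2 : ∑ j, symbolTime n j (ξ, s) * c = c * ‖ξ‖ ^ 2 := by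
      rw [← Finset.sum_mul, sum_symbolTime hs, mul_comm]
    simp only [max_eq_left (hα _), mul_sub, Finset.sum_sub_distrib, h2]
    rw [Finset.sum_mul]
    congr 1
    refine Finset.sum_congr rfl fun j _ => ?_
    rw [symbolTime_eq hs]
    ring
  simp only [h1, gaussWeight]
  rw [neg_sub, sub_eq_add_neg, Real.exp_add, Real.exp_neg (c * _)]
  field_simp

theorem measurable_symbolFactor_ofReal (j : Fin (n + 1)) : Measurable (Function.uncurry
    fun α (p : EuclideanSpace ℝ (Fin d) × (Fin n → ℝ)) => (symbolFactor d k n c j α p : ℂ)) := by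
  have h := (continuous_symbolFactor (d := d) (k := k) (c := c) j).measurable
  exact Complex.measurable_ofReal.comp h

theorem continuous_symbolFactor_ofReal (j : Fin (n + 1))
    (p : EuclideanSpace ℝ (Fin d) × (Fin n → ℝ)) :
    Continuous fun α => (symbolFactor d k n c j α p : ℂ) := by
  have h := (continuous_symbolFactor (d := d) (k := k) (c := c) j).comp
    (continuous_id.prodMk (continuous_const (y := p)))
  exact Complex.continuous_ofReal.comp h

theorem IsPowerPrimitive.divDiff_eq_integral_ofReal (hF : IsPowerPrimitive k d F) (hn : k / 2 ≤ n)
    (hc0 : 0 < c) {α : Fin (n + 1) → ℝ} (hα : ∀ j, c ≤ α j) :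
    ((divDiff n F α : ℝ) : ℂ) = ∫ p, ∏ j, (symbolFactor d k n c j (α j) p : ℂ)
      ∂(gaussMeasure d (n - k / 2) c).prod (volume.restrict (simplex n)) := by
  simp only [← Complex.ofReal_prod]
  rw [integral_complex_ofReal, ← hF.divDiff_eq_integral hn hc0 hα]

/-- The separation of variables of `F^{[n]}`, for a primitive `F` of a power. -/
def IsPowerPrimitive.symbol (hF : IsPowerPrimitive k d F) (hn : k / 2 ≤ n) (hc0 : 0 < c)
    (hc : ∀ r ∈ spectrum ℝ x, c ≤ r) :
    SeparatedSymbol x n fun α => ((divDiff n F α : ℝ) : ℂ) where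
  Ω := EuclideanSpace ℝ (Fin d) × (Fin n → ℝ)
  μ := (gaussMeasure d (n - k / 2) c).prod (volume.restrict (simplex n))
  finite_measure := by
    have := isFiniteMeasure_gaussMeasure (d := d) (n - k / 2) hc0
    have : IsFiniteMeasure ((volume : Measure (Fin n → ℝ)).restrict (simplex n)) :=
      isFiniteMeasure_restrict.2 (isCompact_simplex n).measure_lt_top.ne
    infer_instance
  factor := fun j α p => (symbolFactor d k n c j α p : ℂ)
  measurable_factor := measurable_symbolFactor_ofReal
  bounded_factor := ⟨_, fun j α p => (Complex.norm_real _).trans_le (abs_symbolFactor_le j α p)⟩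
  continuous_factor := continuous_symbolFactor_ofReal
  symbol_eq := fun α hα =>
    hF.divDiff_eq_integral_ofReal hn hc0 fun j => hc _ (hα j)

/-- Each factor is a multiple of a heat operator; the scalars e^{c t_j} multiply to e^{c|ξ|²}, which
undoes the weight of `gaussMeasure`. -/
theorem interlace_cfc_symbolFactor (hsa : IsSelfAdjoint x) (hc : ∀ r ∈ spectrum ℝ x, c ≤ r)
    (V : Fin n → Op d) {s : Fin n → ℝ} (hs : s ∈ simplex n) (ξ : EuclideanSpace ℝ (Fin d)) :
    (interlace V fun j => cfc (fun z : ℂ => (symbolFactor d k n c j z.re (ξ, s) : ℂ)) x) =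
      (((-1) ^ (n - k / 2) * (Real.pi ^ ((d : ℝ) / 2))⁻¹ * Real.exp (c * ‖ξ‖ ^ 2) : ℝ) : ℂ) •
        interlace V fun j => heat x (wt s j * ‖ξ‖ ^ 2) := by
  have h : ∀ j, cfc (fun z : ℂ => (symbolFactor d k n c j z.re (ξ, s) : ℂ)) x =
      (((if j = 0 then (-1) ^ (n - k / 2) * (Real.pi ^ ((d : ℝ) / 2))⁻¹ else 1) *
        Real.exp (symbolTime n j (ξ, s) * c) : ℝ) : ℂ) • heat x (symbolTime n j (ξ, s)) := by
    intro j
    have := cfc_max_exp hsa hc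
      (((if j = 0 then (-1) ^ (n - k / 2) * (Real.pi ^ ((d : ℝ) / 2))⁻¹ else 1 : ℝ)) : ℂ)
      (symbolTime n j (ξ, s))
    rw [← Complex.ofReal_mul] at this
    rw [← this]
    simp only [symbolFactor, Complex.ofReal_mul]
  simp only [h]
  rw [(interlace V).map_smul_univ
    (fun j => (((if j = 0 then (-1) ^ (n - k / 2) * (Real.pi ^ ((d : ℝ) / 2))⁻¹ else 1) *
        Real.exp (symbolTime n j (ξ, s) * c) : ℝ) : ℂ)) fun j => heat x (symbolTime n j (ξ, s))]
  congr 1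
  · rw [← Complex.ofReal_prod, Finset.prod_mul_distrib, ← Real.exp_sum, ← Finset.sum_mul,
      sum_symbolTime hs]
    simp [mul_comm]
  · simp only [symbolTime_eq hs]

end Symbol

/-- Brings the scalars into the shape in which (-|ξ|²)^n, n = h + q, is the prefactor of the simplex
formula. -/
theorem gaussWeight_mul_eq (c P : ℝ) (q h : ℕ) {ξ : EuclideanSpace ℝ (Fin d)} (hξ : ξ ≠ 0) :
    gaussWeight d q c ξ * ((-1) ^ q * P⁻¹ * Real.exp (c * ‖ξ‖ ^ 2)) =
      (-1) ^ h * P⁻¹ * ((‖ξ‖ ^ (2 * h))⁻¹ * (-‖ξ‖ ^ 2) ^ (h + q)) := by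
  have hξ' : 0 < ‖ξ‖ := norm_pos_iff.2 hξ
  have h3 : ((-1 : ℝ) ^ h) * (-1) ^ h = 1 := by
    rw [← mul_pow]; simp
  have h4 : ‖ξ‖ ^ (2 * h) ≠ 0 := by positivity
  have h5 : Real.exp (-(c * ‖ξ‖ ^ 2)) * Real.exp (c * ‖ξ‖ ^ 2) = 1 := by
    rw [← Real.exp_add]; simp
  rw [gaussWeight, neg_pow (‖ξ‖ ^ 2), ← pow_mul, mul_add, pow_add, pow_add]
  calc _ = ‖ξ‖ ^ (2 * q) * (-1) ^ q * P⁻¹ *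
        (Real.exp (-(c * ‖ξ‖ ^ 2)) * Real.exp (c * ‖ξ‖ ^ 2)) := by ring
    _ = ‖ξ‖ ^ (2 * q) * (-1) ^ q * P⁻¹ * ((‖ξ‖ ^ (2 * h))⁻¹ * ‖ξ‖ ^ (2 * h)) *
        ((-1) ^ h * (-1) ^ h) := by rw [h5, h3, inv_mul_cancel₀ h4, mul_one, mul_one]
    _ = _ := by ring

/-- For fixed ξ the simplex part of the separated integral is an integral of heat products, that is,
the multiple operator integral of e^{-|ξ|²·}; what remains is the integral over ξ. -/
theorem moi_divDiff_eq [NeZero d] {k : ℕ} {F : ℝ → ℝ} (hF : IsPowerPrimitive k d F)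
    {x : smoothTorus θ} (hx : (x : Op d).IsPositive) (hxu : IsUnit (x : Op d))
    {w : List (smoothTorus θ)} (hw : k / 2 ≤ w.length) :
    moi (x : Op d) (fun α => ((divDiff w.length F α : ℝ) : ℂ)) (fun j => (w.get j : Op d)) =
      (((-1) ^ (k / 2) * (Real.pi ^ ((d : ℝ) / 2))⁻¹ : ℝ) : ℂ) •
        ∫ ξ : EuclideanSpace ℝ (Fin d), (((‖ξ‖ ^ (2 * (k / 2)))⁻¹ : ℝ) : ℂ) •
          (expT x (‖ξ‖ ^ 2) w : Op d) := by
  obtain ⟨c, hc0, hc⟩ := exists_spectrum_lower_bound hx hxu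
  have hsa : IsSelfAdjoint (x : Op d) := hx.isSelfAdjoint
  have := isFiniteMeasure_gaussMeasure (d := d) (w.length - k / 2) hc0
  have : IsFiniteMeasure ((volume : Measure (Fin w.length → ℝ)).restrict (simplex w.length)) :=
    isFiniteMeasure_restrict.2 (isCompact_simplex _).measure_lt_top.ne
  let r : SeparatedSymbol (x : Op d) w.length fun α => ((divDiff w.length F α : ℝ) : ℂ) :=
    hF.symbol hw hc0 hc
  have hint : Integrable (fun p => interlace (fun j => (w.get j : Op d)) fun j => cfc (fun z : ℂ =>
      (symbolFactor d k w.length c j z.re p : ℂ)) (x : Op d))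
      ((gaussMeasure d (w.length - k / 2) c).prod (volume.restrict (simplex w.length))) :=
    r.integrable hsa fun j => (w.get j : Op d)
  rw [moi_eq_integral hsa r, r.integral_eq_interlace]
  change ∫ p, (interlace (fun j => (w.get j : Op d)) fun j => cfc (fun z : ℂ =>
    (symbolFactor d k w.length c j z.re p : ℂ)) (x : Op d))
      ∂(gaussMeasure d (w.length - k / 2) c).prod (volume.restrict (simplex w.length)) = _
  rw [integral_prod _ hint, integral_gaussMeasure, ← integral_smul]
  have h0 : ∀ᵐ ξ : EuclideanSpace ℝ (Fin d), ξ ≠ 0 := by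
    simp [ae_iff]
  refine integral_congr_ae (h0.mono fun ξ hξ => ?_)
  have hξ' : 0 < ‖ξ‖ := norm_pos_iff.2 hξ
  have h1 := smul_setIntegral_heatProd x (fun j => Finsupp.single 0 (w.get j)) (‖ξ‖ ^ 2)
  rw [chain_ofFn_single_zero] at h1
  have h2 : ∫ s in simplex w.length, (interlace (fun j => (w.get j : Op d)) fun j =>
      cfc (fun z : ℂ => (symbolFactor d k w.length c j z.re (ξ, s) : ℂ)) (x : Op d)) =
      (((-1) ^ (w.length - k / 2) * (Real.pi ^ ((d : ℝ) / 2))⁻¹ * Real.exp (c * ‖ξ‖ ^ 2) : ℝ) : ℂ) •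
        ∫ s in simplex w.length, (heatProd x (fun j => wt s j * ‖ξ‖ ^ 2)
          (fun j => Finsupp.single 0 (w.get j)) : Op d) := by
    rw [← integral_smul]
    refine setIntegral_congr_fun (isClosed_simplex _).measurableSet fun s hs => ?_
    simp only [coe_heatProd_single_zero]
    exact interlace_cfc_symbolFactor hsa hc _ hs ξ
  simp only [h2, ← h1]
  obtain ⟨q, hq⟩ := Nat.exists_eq_add_of_le hw
  have h3 := gaussWeight_mul_eq c (Real.pi ^ ((d : ℝ) / 2)) q (k / 2) hξ
  rw [← hq, ← Nat.sub_eq_of_eq_add' hq] at h3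
  rw [← algebraMap_smul ℂ (gaussWeight d (w.length - k / 2) c ξ), Complex.coe_algebraMap, smul_smul,
    smul_smul, smul_smul, ← Complex.ofReal_mul, ← Complex.ofReal_mul, ← Complex.ofReal_mul, h3, ← mul_assoc]

end

end NCTorus

namespace NCTorus

noncomputable section

variable {d : ℕ} {θ : Matrix (Fin d) (Fin d) ℝ}

/-! ### Multilinearity of the heat products -/

theorem act_add (B B' : FormalOp θ) (g : smoothTorus θ) : act (B + B') g = act B g + act B' g := by
  simp only [act_apply]
  refine Finsupp.sum_add_index' (fun α => ?_) fun α b b' => ?_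
  · ext1; simp
  · ext1; simp [add_mul]

theorem act_smul (c : ℂ) (B : FormalOp θ) (g : smoothTorus θ) : act (c • B) g = c • act B g := by
  simp only [act_apply]
  rw [Finsupp.sum_smul_index', Finsupp.smul_sum]
  · refine Finsupp.sum_congr fun α _ => ?_
    ext1
    simp
  · intro α
    ext1
    simp

/-- `heatProd` as a multilinear map. -/
def heatMultilinear (x : smoothTorus θ) : (m : ℕ) → (Fin (m + 1) → ℝ) →
    MultilinearMap ℂ (fun _ : Fin m => FormalOp θ) (smoothTorus θ)
  | 0, r => MultilinearMap.constOfIsEmpty ℂ _ (expT x (r 0) [])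
  | m + 1, r => LinearMap.uncurryLeft
      { toFun := fun B => (lmul (expT x (r 0) []) ∘ₗ act B).compMultilinearMap
          (heatMultilinear x m fun j => r j.succ)
        map_add' := fun B B' => by
          ext1 v
          simp only [LinearMap.compMultilinearMap_apply, LinearMap.comp_apply, act_add, map_add,
            add_apply]
        map_smul' := fun c B => by
          ext1 v
          simp [act_smul] }

theorem heatMultilinear_apply (x : smoothTorus θ) {m : ℕ} (r : Fin (m + 1) → ℝ)
    (B : Fin m → FormalOp θ) : heatMultilinear x m r B = heatProd x r B := by
  induction m with
  | zero => rfl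
  | succ m ih =>
    rw [heatProd_succ, ← ih]
    rfl

/-- `𝐕(ξ) = ∑ ξ_i 𝐀_i` for `j ∈ 𝒜`, and `𝐏` otherwise. -/
def formalWAt {m : ℕ} (x : smoothTorus θ) (a : Fin d → smoothTorus θ) (a₀ : smoothTorus θ)
    (𝒜 : Finset (Fin m)) (ξ : EuclideanSpace ℝ (Fin d)) (j : Fin m) : FormalOp θ :=
  if j ∈ 𝒜 then ∑ i, (ξ i : ℂ) • formalA x a i else formalP x a a₀

/-- `∏_{j ∈ 𝒜} ξ_{ι(j)}`. -/
def monomialAt {m : ℕ} {𝒜 : Finset (Fin m)} (ι : {j // j ∈ 𝒜} → Fin d)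
    (ξ : EuclideanSpace ℝ (Fin d)) : ℝ := ∏ j, ξ (ι j)

section Expansion

variable {m : ℕ} (x : smoothTorus θ) (a : Fin d → smoothTorus θ) (a₀ : smoothTorus θ)
  (𝒜 : Finset (Fin m))

/-- Heat products are multilinear in the operators, and V(ξ) = ∑ ξ_i A_i is expanded in the slots of
`𝒜`, the other slots being frozen at P. -/
theorem heatProd_formalWAt (r : Fin (m + 1) → ℝ) (ξ : EuclideanSpace ℝ (Fin d)) :
    heatProd x r (formalWAt x a a₀ 𝒜 ξ) =
      ∑ ι : {j // j ∈ 𝒜} → Fin d, (monomialAt ι ξ : ℂ) • heatProd x r (formalW x a a₀ 𝒜 ι) := by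
  classical
  let T := (heatMultilinear x m r).domDomRestrict (fun j => j ∈ 𝒜) fun _ => formalP x a a₀
  have h1 : heatProd x r (formalWAt x a a₀ 𝒜 ξ) =
      T fun _ => ∑ i, (ξ i : ℂ) • formalA x a i := by
    rw [← heatMultilinear_apply, MultilinearMap.domDomRestrict_apply]
    rfl
  rw [h1, T.map_sum fun _ i => (ξ i : ℂ) • formalA x a i]
  refine Finset.sum_congr rfl fun ι _ => ?_
  rw [T.map_smul_univ (fun j => (ξ (ι j) : ℂ)) fun j => formalA x a (ι j), monomialAt,
    Complex.ofReal_prod, MultilinearMap.domDomRestrict_apply, heatMultilinear_apply]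
  rfl

/-- The multilinearity of `chain` is read off from the simplex formula, not from the recursion. -/
theorem chain_formalWAt (t : ℝ) (ξ : EuclideanSpace ℝ (Fin d)) :
    (chain x t (List.ofFn (formalWAt x a a₀ 𝒜 ξ)) : Op d) =
      ∑ ι : {j // j ∈ 𝒜} → Fin d,
        (monomialAt ι ξ : ℂ) • (chain x t (List.ofFn (formalW x a a₀ 𝒜 ι)) : Op d) := by
  simp only [← smul_setIntegral_heatProd, heatProd_formalWAt, Submodule.coe_sum,
    Submodule.coe_smul]
  have hint : ∀ ι : {j // j ∈ 𝒜} → Fin d, Integrable (fun s : Fin m → ℝ => (monomialAt ι ξ : ℂ) •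
      (heatProd x (fun j => wt s j * t) (formalW x a a₀ 𝒜 ι) : Op d))
      (volume.restrict (simplex m)) := fun ι =>
    ((smoothCts_heatProd_wt x t _).smoothIntegrable (isCompact_simplex m)).integrable.smul
      (monomialAt ι ξ : ℂ)
  rw [integral_finsetSum _ fun ι _ => hint ι, Finset.smul_sum]
  refine Finset.sum_congr rfl fun ι _ => ?_
  rw [integral_smul, smul_comm]

end Expansion

/-! ### Integration over `ℝ^d` -/

/-- The integrable families. -/
def integrableSubgroup (E : Type*) [NormedAddCommGroup E] {Ω : Type*} [MeasurableSpace Ω]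
    (μ : Measure Ω) : AddSubgroup (Ω → E) where
  carrier := {f | Integrable f μ}
  zero_mem' := integrable_zero _ _ _
  add_mem' := fun hf hg => Integrable.add hf hg
  neg_mem' := fun hf => Integrable.neg hf

/-- The families that are integrable with all derivatives. -/
def smoothIntegrableSubgroup (θ : Matrix (Fin d) (Fin d) ℝ) {Ω : Type*} [MeasurableSpace Ω]
    (μ : Measure Ω) : AddSubgroup (Ω → smoothTorus θ) where
  carrier := {g | ∀ L, (fun p => (DSeq L (g p) : Op d)) ∈ integrableSubgroup (Op d) μ}
  zero_mem' := fun L => by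
    convert zero_mem (integrableSubgroup (Op d) μ) using 1
    funext p
    simp
  add_mem' := fun {f g} hf hg L => by
    convert add_mem (hf L) (hg L) using 1
    funext p
    simp
  neg_mem' := fun {f} hf L => by
    convert neg_mem (hf L) using 1
    funext p
    simp

section Weighted

variable {x : smoothTorus θ} {ρ : EuclideanSpace ℝ (Fin d) → ℝ} {h : ℕ}

/-- Every argument contributes a factor |ξ|², so at least h arguments compensate a singularity
|ξ|^{-2h} at the origin; at infinity there is Gaussian decay. -/
theorem integrable_smul_expT (hx : (x : Op d).IsPositive) (hxu : IsUnit (x : Op d))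
    (hρm : Measurable ρ) (hρ : ∀ ξ, |ρ ξ| ≤ (‖ξ‖ ^ (2 * h))⁻¹) {w : List (smoothTorus θ)}
    (hw : h ≤ w.length) :
    Integrable fun ξ => (ρ ξ : ℂ) • (expT x (‖ξ‖ ^ 2) w : Op d) := by
  obtain ⟨c, hc0, hc⟩ := exists_spectrum_lower_bound hx hxu
  obtain ⟨C, hC0, hC⟩ := norm_expT_le (fun t ht => norm_heat_le hx.isSelfAdjoint hc ht) w
  refine ((integrable_pow_norm_mul_exp hc0 (2 * (w.length - h))).const_mul C).mono'
    (((Complex.measurable_ofReal.comp hρm).aestronglyMeasurable).smul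
      ((continuous_expT x w).comp (continuous_norm.pow 2)).aestronglyMeasurable)
    (.of_forall fun ξ => ?_)
  rw [norm_smul, Complex.norm_real, Real.norm_eq_abs]
  refine (mul_le_mul (hρ ξ) (hC (‖ξ‖ ^ 2) (by positivity)) (norm_nonneg _)
    (by positivity)).trans ?_
  have h1 : (‖ξ‖ ^ (2 * h))⁻¹ * (‖ξ‖ ^ 2) ^ w.length ≤ ‖ξ‖ ^ (2 * (w.length - h)) := by
    rw [← pow_mul]
    obtain ⟨q, hq⟩ := Nat.exists_eq_add_of_le hw
    rw [hq, Nat.add_sub_cancel_left, mul_add, pow_add, ← mul_assoc]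
    exact mul_le_of_le_one_left (by positivity) (inv_mul_le_one_of_le₀ le_rfl (by positivity))
  calc (‖ξ‖ ^ (2 * h))⁻¹ * (C * ((‖ξ‖ ^ 2) ^ w.length * Real.exp (-(c * ‖ξ‖ ^ 2)))) =
      C * (((‖ξ‖ ^ (2 * h))⁻¹ * (‖ξ‖ ^ 2) ^ w.length) * Real.exp (-(c * ‖ξ‖ ^ 2))) := by ring
    _ ≤ _ := by gcongr

/-- Neither the recursion nor further derivatives shorten the argument lists, so the subgroup
argument applies twice: first to the derivatives of `expT`, then to the recursion. -/
theorem smoothIntegrable_smul_tMap (hx : (x : Op d).IsPositive) (hxu : IsUnit (x : Op d))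
    (hρm : Measurable ρ) (hρ : ∀ ξ, |ρ ξ| ≤ (‖ξ‖ ^ (2 * h))⁻¹) {Bs : List (FormalOp θ)}
    {w : List (smoothTorus θ)} (hw : h ≤ Bs.length + w.length) :
    SmoothIntegrable volume fun ξ : EuclideanSpace ℝ (Fin d) =>
      (ρ ξ : ℂ) • tMap x (expT x (‖ξ‖ ^ 2)) Bs w := by
  have hexp : ∀ w : List (smoothTorus θ), h ≤ w.length →
      (fun ξ : EuclideanSpace ℝ (Fin d) => (ρ ξ : ℂ) • expT x (‖ξ‖ ^ 2) w) ∈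
        smoothIntegrableSubgroup θ volume := by
    intro w hw L
    have h1 := leibSeq_mem (S := integrableSubgroup (Op d) volume) (n := h) x L
      (K := fun w (ξ : EuclideanSpace ℝ (Fin d)) => (ρ ξ : ℂ) • (expT x (‖ξ‖ ^ 2) w : Op d))
      (fun w hw => integrable_smul_expT hx hxu hρm hρ hw) hw
    have h2 : ∀ ξ : EuclideanSpace ℝ (Fin d), leibSeq x L (fun w (ξ : EuclideanSpace ℝ (Fin d)) =>
        (ρ ξ : ℂ) • (expT x (‖ξ‖ ^ 2) w : Op d)) w ξ =
          (DSeq L ((ρ ξ : ℂ) • expT x (‖ξ‖ ^ 2) w) : Op d) := fun ξ => by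
      rw [map_smul, (isLeib_expT x (‖ξ‖ ^ 2)).DSeq_eq]
      exact (map_leibSeq (Pi.evalAddMonoidHom (fun _ : EuclideanSpace ℝ (Fin d) => Op d) ξ)
        x L _ w).trans (map_leibSeq ((DistribSMul.toAddMonoidHom (Op d) (ρ ξ : ℂ)).comp
          (smoothTorus θ).subtype.toAddMonoidHom) x L (expT x (‖ξ‖ ^ 2)) w).symm
    exact Integrable.congr h1 (.of_forall h2)
  have h1 := tMap_mem (S := smoothIntegrableSubgroup θ volume) (n := h) x
    (K := fun w (ξ : EuclideanSpace ℝ (Fin d)) => (ρ ξ : ℂ) • expT x (‖ξ‖ ^ 2) w) hexp hw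
  have h2 : (tMap x (fun w (ξ : EuclideanSpace ℝ (Fin d)) => (ρ ξ : ℂ) • expT x (‖ξ‖ ^ 2) w)
      Bs w) = fun ξ => (ρ ξ : ℂ) • tMap x (expT x (‖ξ‖ ^ 2)) Bs w := by
    funext ξ
    exact (tMap_eval x (fun (ξ : EuclideanSpace ℝ (Fin d)) w => (ρ ξ : ℂ) • expT x (‖ξ‖ ^ 2) w)
      Bs w ξ).trans (map_tMap (DistribSMul.toAddMonoidHom (smoothTorus θ) (ρ ξ : ℂ)) x
        (expT x (‖ξ‖ ^ 2)) Bs w).symm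
  rw [h2] at h1
  exact h1

theorem smoothIntegrable_smul_chain (hx : (x : Op d).IsPositive) (hxu : IsUnit (x : Op d))
    (hρm : Measurable ρ) (hρ : ∀ ξ, |ρ ξ| ≤ (‖ξ‖ ^ (2 * h))⁻¹) {Bs : List (FormalOp θ)}
    (hw : h ≤ Bs.length) :
    SmoothIntegrable volume fun ξ : EuclideanSpace ℝ (Fin d) =>
      (ρ ξ : ℂ) • chain x (‖ξ‖ ^ 2) Bs :=
  smoothIntegrable_smul_tMap hx hxu hρm hρ (by simpa using hw)

theorem measurable_inv_norm_pow (n : ℕ) :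
    Measurable fun ξ : EuclideanSpace ℝ (Fin d) => (‖ξ‖ ^ n)⁻¹ :=
  (measurable_norm.pow_const n).inv

/-- The superposition formula for the initial values passes through the recursion. Its restriction
to lists of length at least k/2 is harmless because m ≥ k/2. -/
theorem bT_eq_integral [NeZero d] {k : ℕ} {F : ℝ → ℝ} (hF : IsPowerPrimitive k d F)
    (hx : (x : Op d).IsPositive) (hxu : IsUnit (x : Op d)) {m : ℕ} (B : Fin m → FormalOp θ)
    (hm : k / 2 ≤ m) :
    bT θ F x B = (((-1) ^ (k / 2) * (Real.pi ^ ((d : ℝ) / 2))⁻¹ : ℝ) : ℂ) •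
      ∫ ξ : EuclideanSpace ℝ (Fin d), (((‖ξ‖ ^ (2 * (k / 2)))⁻¹ : ℝ) : ℂ) •
        (chain x (‖ξ‖ ^ 2) (List.ofFn B) : Op d) := by
  rw [bT, bTAux_eq_tMap, ← integral_smul]
  set κ : ℂ := (((-1) ^ (k / 2) * (Real.pi ^ ((d : ℝ) / 2))⁻¹ : ℝ) : ℂ)
  have h1 := tMap_integral (μ := (volume : Measure (EuclideanSpace ℝ (Fin d)))) x (n := k / 2)
    (K := fun ξ w => κ • (((‖ξ‖ ^ (2 * (k / 2)))⁻¹ : ℝ) : ℂ) • (expT x (‖ξ‖ ^ 2) w : Op d))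
    (K' := fun w => moi (x : Op d) (fun α => ((divDiff w.length F α : ℝ) : ℂ))
      fun j => (w.get j : Op d))
    (fun w hw => ⟨(integrable_smul_expT hx hxu (measurable_inv_norm_pow _) (fun ξ => by
      rw [abs_of_nonneg (by positivity)]) hw).smul κ, by
        rw [integral_smul]; exact (moi_divDiff_eq hF hx hxu hw).symm⟩)
    (Bs := (List.ofFn B).reverse) (w := []) (by simpa using hm)
  rw [← h1.2]
  refine integral_congr_ae (.of_forall fun ξ => ?_)
  simp only [smul_smul]
  rw [chain, coe_tMap]
  exact (map_tMap (DistribSMul.toAddMonoidHom (Op d)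
    (κ * (((‖ξ‖ ^ (2 * (k / 2)))⁻¹ : ℝ) : ℂ))) x _ _ _).symm

end Weighted

/-! ### Means over the sphere -/

theorem integral_polar {E : Type*} [NormedAddCommGroup E] [NormedSpace ℝ E]
    (p : Metric.sphere (0 : EuclideanSpace ℝ (Fin d)) 1 → ℝ) (f : ℝ → E) [NeZero d]
    (g : EuclideanSpace ℝ (Fin d) → E)
    (hg : ∀ ξ (hξ : ξ ≠ 0), g ξ = p (homeomorphUnitSphereProd _ ⟨ξ, hξ⟩).1 • f ‖ξ‖) :
    ∫ ξ, g ξ = (∫ u, p u ∂(volume : Measure (EuclideanSpace ℝ (Fin d))).toSphere) •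
      ∫ r : Set.Ioi (0 : ℝ), f r ∂.volumeIoiPow (Module.finrank ℝ (EuclideanSpace ℝ (Fin d)) - 1) := by
  let μ : Measure (EuclideanSpace ℝ (Fin d)) := volume
  rw [← integral_prod_smul p fun r : Set.Ioi (0 : ℝ) => f r,
    ← μ.measurePreserving_homeomorphUnitSphereProd.integral_comp
      (Homeomorph.measurableEmbedding _)]
  have h1 : ∫ ξ, g ξ = ∫ ξ : ({(0)}ᶜ : Set (EuclideanSpace ℝ (Fin d))), g ξ ∂(μ.comap (↑)) := by
    rw [integral_subtype_comap (measurableSet_singleton _).compl g, restrict_compl_singleton]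
  rw [h1]
  refine integral_congr_ae (.of_forall fun ξ => ?_)
  simp only [hg ξ.1 ξ.2]
  simp

/-- In polar coordinates both integrals are an integral over the sphere times the same radial
integral; the ratio of the spherical parts is the mean. -/
theorem integral_monomialAt_smul [NeZero d] {E : Type*} [NormedAddCommGroup E] [NormedSpace ℝ E]
    {m n : ℕ} {𝒜 : Finset (Fin m)} (h𝒜 : 𝒜.card = n) (ι : {j // j ∈ 𝒜} → Fin d) (f : ℝ → E) :
    ∫ ξ : EuclideanSpace ℝ (Fin d), monomialAt ι ξ • f ‖ξ‖ =
      sphereMean ι • ∫ ξ : EuclideanSpace ℝ (Fin d), ‖ξ‖ ^ n • f ‖ξ‖ := by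
  have hpos : (volume : Measure (EuclideanSpace ℝ (Fin d))).toSphere.real Set.univ ≠ 0 := by
    rw [measureReal_ne_zero_iff, ne_eq, Measure.measure_univ_eq_zero]
    exact Measure.toSphere_ne_zero _
  rw [integral_polar (fun _ => 1) (fun r => r ^ n • f r) (fun ξ => ‖ξ‖ ^ n • f ‖ξ‖)
      (fun ξ _ => (one_smul ℝ _).symm),
    integral_polar (fun u => ∏ j, (u : EuclideanSpace ℝ (Fin d)) (ι j)) (fun r => r ^ n • f r)
      (fun ξ => monomialAt ι ξ • f ‖ξ‖) fun ξ hξ => ?_]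
  · rw [smul_smul, sphereMean, average_eq, smul_eq_mul, integral_const, smul_eq_mul, mul_one,
      inv_mul_eq_div, div_mul_cancel₀ _ hpos]
  · rw [smul_smul]
    congr 1
    have h1 : ∀ j, (((homeomorphUnitSphereProd _ ⟨ξ, hξ⟩).1 : EuclideanSpace ℝ (Fin d))) (ι j) =
        ‖ξ‖⁻¹ * ξ (ι j) := fun j => by simp
    simp only [h1, Finset.prod_mul_distrib, Finset.prod_const, Finset.card_univ, monomialAt,
      Fintype.card_coe, h𝒜]
    have : ‖ξ‖ ≠ 0 := norm_ne_zero_iff.2 hξ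
    rw [mul_right_comm, ← mul_pow, inv_mul_cancel₀ this, one_pow, one_mul]

theorem abs_monomialAt_le {m : ℕ} {𝒜 : Finset (Fin m)} (ι : {j // j ∈ 𝒜} → Fin d)
    (ξ : EuclideanSpace ℝ (Fin d)) : |monomialAt ι ξ| ≤ ‖ξ‖ ^ 𝒜.card := by
  rw [monomialAt, Finset.abs_prod]
  refine (Finset.prod_le_prod (fun _ _ => abs_nonneg _) fun j _ =>
    PiLp.norm_apply_le ξ (ι j)).trans_eq ?_
  simp

theorem continuous_monomialAt {m : ℕ} {𝒜 : Finset (Fin m)} (ι : {j // j ∈ 𝒜} → Fin d) :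
    Continuous (monomialAt ι) := by
  unfold monomialAt
  fun_prop

/-! ### The summands of the main formula -/

section Main

variable {x : smoothTorus θ} {m k : ℕ} {𝒜 : Finset (Fin m)}

/-- The monomial has degree 2m - k, which reduces the singularity |ξ|^{-2m} to |ξ|^{-k}. -/
theorem abs_inv_norm_pow_mul_monomialAt_le (hk : Even k) (hm : k ≤ 2 * m) (h𝒜 : 𝒜.card = 2 * m - k)
    (ι : {j // j ∈ 𝒜} → Fin d) (ξ : EuclideanSpace ℝ (Fin d)) :
    |(‖ξ‖ ^ (2 * m))⁻¹ * monomialAt ι ξ| ≤ (‖ξ‖ ^ (2 * (k / 2)))⁻¹ := by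
  rw [abs_mul, abs_of_nonneg (by positivity), Nat.two_mul_div_two_of_even hk]
  refine (mul_le_mul_of_nonneg_left (abs_monomialAt_le ι ξ) (by positivity)).trans ?_
  obtain ⟨q, hq⟩ := Nat.exists_eq_add_of_le hm
  rw [h𝒜, hq, Nat.add_sub_cancel_left, pow_add, mul_inv, mul_assoc]
  exact mul_le_of_le_one_right (by positivity) (inv_mul_le_one_of_le₀ le_rfl (by positivity))

theorem smoothIntegrable_formalWAt (hx : (x : Op d).IsPositive) (hxu : IsUnit (x : Op d))
    (a : Fin d → smoothTorus θ) (a₀ : smoothTorus θ)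
    (hk : Even k) (hm : k ≤ 2 * m) (h𝒜 : 𝒜.card = 2 * m - k) :
    SmoothIntegrable volume fun ξ : EuclideanSpace ℝ (Fin d) =>
      (((‖ξ‖ ^ (2 * m))⁻¹ : ℝ) : ℂ) • chain x (‖ξ‖ ^ 2) (List.ofFn (formalWAt x a a₀ 𝒜 ξ)) := by
  have h1 : ∀ ξ, chain x (‖ξ‖ ^ 2) (List.ofFn (formalWAt x a a₀ 𝒜 ξ)) =
      ∑ ι : {j // j ∈ 𝒜} → Fin d,
        (monomialAt ι ξ : ℂ) • chain x (‖ξ‖ ^ 2) (List.ofFn (formalW x a a₀ 𝒜 ι)) := fun ξ => by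
    ext1
    simp only [chain_formalWAt, Submodule.coe_sum, Submodule.coe_smul]
  have h3 : (fun ξ : EuclideanSpace ℝ (Fin d) =>
      (((‖ξ‖ ^ (2 * m))⁻¹ : ℝ) : ℂ) • chain x (‖ξ‖ ^ 2) (List.ofFn (formalWAt x a a₀ 𝒜 ξ))) =
      ∑ ι : {j // j ∈ 𝒜} → Fin d, fun ξ : EuclideanSpace ℝ (Fin d) =>
        (((‖ξ‖ ^ (2 * m))⁻¹ * monomialAt ι ξ : ℝ) : ℂ) •
          chain x (‖ξ‖ ^ 2) (List.ofFn (formalW x a a₀ 𝒜 ι)) := by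
    funext ξ
    rw [h1, Finset.smul_sum, Finset.sum_apply]
    exact Finset.sum_congr rfl fun ι _ => by rw [smul_smul, Complex.ofReal_mul]
  rw [h3]
  refine sum_mem (S := smoothIntegrableSubgroup θ volume) fun ι _ => ?_
  exact smoothIntegrable_smul_chain hx hxu
    ((measurable_inv_norm_pow (2 * m)).mul (continuous_monomialAt ι).measurable)
    (abs_inv_norm_pow_mul_monomialAt_le hk hm h𝒜 ι) (by simp; omega)

/-- The prefactor (-1)^{k/2} π^{d/2} cancels the constant of `bT_eq_integral`. The sphere mean times
|ξ|^{-k} is traded for |ξ|^{-2m} ∏ ξ_{ι(j)}, and the sum over ι becomes V(ξ) in the slots of `𝒜`. -/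
theorem mainSummand_eq_integral [NeZero d] {F : ℝ → ℝ} (hF : IsPowerPrimitive k d F)
    (hx : (x : Op d).IsPositive) (hxu : IsUnit (x : Op d)) (a : Fin d → smoothTorus θ)
    (a₀ : smoothTorus θ) (hk : Even k) (hm : k ≤ 2 * m) (h𝒜 : 𝒜.card = 2 * m - k) :
    mainSummand θ x a a₀ k F 𝒜 = ∫ ξ : EuclideanSpace ℝ (Fin d),
      (((‖ξ‖ ^ (2 * m))⁻¹ : ℝ) : ℂ) •
        (chain x (‖ξ‖ ^ 2) (List.ofFn (formalWAt x a a₀ 𝒜 ξ)) : Op d) := by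
  have h2 : ∀ ι : {j // j ∈ 𝒜} → Fin d, Integrable fun ξ : EuclideanSpace ℝ (Fin d) =>
      (((‖ξ‖ ^ (2 * m))⁻¹ * monomialAt ι ξ : ℝ) : ℂ) •
        (chain x (‖ξ‖ ^ 2) (List.ofFn (formalW x a a₀ 𝒜 ι)) : Op d) := fun ι =>
    (smoothIntegrable_smul_chain (θ := θ) hx hxu
      ((measurable_inv_norm_pow (2 * m)).mul (continuous_monomialAt ι).measurable)
      (abs_inv_norm_pow_mul_monomialAt_le hk hm h𝒜 ι) (Bs := List.ofFn (formalW x a a₀ 𝒜 ι))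
      (by simp; omega)).integrable
  simp only [chain_formalWAt, Finset.smul_sum, smul_smul, ← Complex.ofReal_mul]
  rw [integral_finsetSum _ fun ι _ => h2 ι, mainSummand, Finset.smul_sum]
  refine Finset.sum_congr rfl fun ι _ => ?_
  rw [bT_eq_integral hF hx hxu _ (by omega), smul_smul, smul_smul, ← Complex.ofReal_mul,
    ← Complex.ofReal_mul]
  have hP : Real.pi ^ ((d : ℝ) / 2) ≠ 0 := (Real.rpow_pos_of_pos Real.pi_pos _).ne'
  have h4 : (-1) ^ (k / 2) * Real.pi ^ ((d : ℝ) / 2) *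
      (sphereMean ι * ((-1) ^ (k / 2) * (Real.pi ^ ((d : ℝ) / 2))⁻¹)) = sphereMean ι := by
    have h5 : ((-1 : ℝ) ^ (k / 2)) * (-1) ^ (k / 2) = 1 := by
      rw [← mul_pow]; simp
    calc _ = ((-1 : ℝ) ^ (k / 2)) * (-1) ^ (k / 2) *
          (Real.pi ^ ((d : ℝ) / 2) * (Real.pi ^ ((d : ℝ) / 2))⁻¹) * sphereMean ι := by ring
      _ = _ := by rw [h5, mul_inv_cancel₀ hP, one_mul, one_mul]
  have h3 := integral_monomialAt_smul h𝒜 ι fun r =>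
    (((r ^ (2 * m))⁻¹ : ℝ) : ℂ) • (chain x (r ^ 2) (List.ofFn (formalW x a a₀ 𝒜 ι)) : Op d)
  have h6 : ∀ ξ : EuclideanSpace ℝ (Fin d), (((‖ξ‖ ^ (2 * m))⁻¹ * monomialAt ι ξ : ℝ) : ℂ) •
      (chain x (‖ξ‖ ^ 2) (List.ofFn (formalW x a a₀ 𝒜 ι)) : Op d) =
      monomialAt ι ξ • (((‖ξ‖ ^ (2 * m))⁻¹ : ℝ) : ℂ) •
        (chain x (‖ξ‖ ^ 2) (List.ofFn (formalW x a a₀ 𝒜 ι)) : Op d) := fun ξ => by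
    rw [mul_comm, Complex.ofReal_mul, mul_smul]
    exact Complex.coe_smul _ _
  have h7 : ∀ᵐ ξ : EuclideanSpace ℝ (Fin d), ‖ξ‖ ^ (2 * m - k) • (((‖ξ‖ ^ (2 * m))⁻¹ : ℝ) : ℂ) •
      (chain x (‖ξ‖ ^ 2) (List.ofFn (formalW x a a₀ 𝒜 ι)) : Op d) =
      (((‖ξ‖ ^ (2 * (k / 2)))⁻¹ : ℝ) : ℂ) •
        (chain x (‖ξ‖ ^ 2) (List.ofFn (formalW x a a₀ 𝒜 ι)) : Op d) := by
    have h0 : ∀ᵐ ξ : EuclideanSpace ℝ (Fin d), ξ ≠ 0 := by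
      simp [ae_iff]
    refine h0.mono fun ξ hξ => ?_
    refine (Complex.coe_smul (‖ξ‖ ^ (2 * m - k)) _).symm.trans ?_
    rw [smul_smul, ← Complex.ofReal_mul, Nat.two_mul_div_two_of_even hk]
    congr 2
    have : ‖ξ‖ ≠ 0 := norm_ne_zero_iff.2 hξ
    obtain ⟨q, hq⟩ := Nat.exists_eq_add_of_le hm
    rw [hq, Nat.add_sub_cancel_left, pow_add]
    field_simp
  simp only [h6]
  rw [h3, integral_congr_ae h7, mul_assoc _ (sphereMean ι), h4]
  exact (Complex.coe_smul _ _)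

end Main

end

end NCTorus

namespace NCTorus

noncomputable section

variable {d N : ℕ} {θ : Matrix (Fin d) (Fin d) ℝ}
  (Φ : cTorus θ →⋆ₐ[ℂ] Matrix (Fin N) (Fin N) C(UnitAddTorus (Fin d), ℂ))

/-! ### Evaluation of matrix-valued functions -/

/-- The ⋆-homomorphism `b ↦ Φ(b)(t)`. -/
def evalMat (t : UnitAddTorus (Fin d)) : cTorus θ →⋆ₐ[ℂ] Matrix (Fin N) (Fin N) ℂ where
  toFun b := Matrix.of fun p q => Φ b p q t
  map_one' := by
    ext p q
    rw [map_one, Matrix.of_apply, Matrix.one_apply, Matrix.one_apply]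
    split_ifs <;> simp
  map_mul' b c := by
    ext p q
    simp [Matrix.mul_apply]
  map_zero' := by
    ext p q
    simp
  map_add' b c := by
    ext p q
    simp
  commutes' c := by
    ext p q
    rw [AlgHomClass.commutes, Matrix.of_apply, Matrix.algebraMap_matrix_apply,
      Matrix.algebraMap_matrix_apply]
    split_ifs <;> simp
  map_star' b := by
    ext p q
    simp [map_star, Matrix.star_apply]

/-- As operators on Euclidean space the matrices form a C⋆-algebra, into which ⋆-homomorphisms are
contractive; in finite dimension the topology is the same. -/
theorem continuous_evalMat (t : UnitAddTorus (Fin d)) : Continuous (evalMat Φ t) := by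
  have : IsClosed (cTorus θ : Set (Op d)) := isClosed_cTorus θ
  let T := Matrix.toEuclideanCLM (n := Fin N) (𝕜 := ℂ)
  let π : cTorus θ →⋆ₐ[ℂ] (EuclideanSpace ℂ (Fin N) →L[ℂ] EuclideanSpace ℂ (Fin N)) :=
    (T : Matrix (Fin N) (Fin N) ℂ →⋆ₐ[ℂ] _).comp (evalMat Φ t)
  have hπ : Continuous π := by
    refine AddMonoidHomClass.continuous_of_bound π 1 fun b => ?_
    rw [one_mul]
    exact NonUnitalStarAlgHom.norm_apply_le π b
  have hT : Continuous T.symm := T.symm.toAlgEquiv.toLinearMap.continuous_of_finiteDimensional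
  refine (hT.comp hπ).congr fun b => ?_
  exact T.symm_apply_apply _

theorem evalMat_toC (b : smoothTorus θ) (t : UnitAddTorus (Fin d)) :
    evalMat Φ t (toC b) = matrixAt Φ b t := rfl

theorem matrixAt_mul (b c : smoothTorus θ) (t : UnitAddTorus (Fin d)) :
    matrixAt Φ (b * c) t = matrixAt Φ b t * matrixAt Φ c t :=
  map_mul (evalMat Φ t) (toC b) (toC c)

theorem matrixAt_add (b c : smoothTorus θ) (t : UnitAddTorus (Fin d)) :
    matrixAt Φ (b + c) t = matrixAt Φ b t + matrixAt Φ c t :=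
  map_add (evalMat Φ t) (toC b) (toC c)

theorem matrixAt_smul (r : ℂ) (b : smoothTorus θ) (t : UnitAddTorus (Fin d)) :
    matrixAt Φ (r • b) t = r • matrixAt Φ b t :=
  map_smul (evalMat Φ t) r (toC b)

/-- A continuous homomorphism commutes with the exponential. The norm on matrices is an auxiliary
choice. -/
theorem matrixAt_expT (x : smoothTorus θ) (r : ℝ) (t : UnitAddTorus (Fin d)) :
    matrixAt Φ (expT x r []) t = NormedSpace.exp (((-r : ℝ) : ℂ) • matrixAt Φ x t) := by
  have : IsClosed (cTorus θ : Set (Op d)) := isClosed_cTorus θ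
  let : NormedAlgebra ℚ (cTorus θ) := .restrictScalars ℚ ℂ (cTorus θ)
  have h1 : toC (expT x r []) = NormedSpace.exp (((-r : ℝ) : ℂ) • toC x) := by
    apply Subtype.ext
    change (expT x r [] : Op d) = (cTorus θ).subtype _
    rw [NormedSpace.map_exp (cTorus θ).subtype continuous_subtype_val, expT_nil]
    rfl
  let : NormedRing (Matrix (Fin N) (Fin N) ℂ) := Matrix.linftyOpNormedRing
  let : NormedAlgebra ℚ (Matrix (Fin N) (Fin N) ℂ) := Matrix.linftyOpNormedAlgebra
  rw [← evalMat_toC, h1, NormedSpace.map_exp (evalMat Φ t) (continuous_evalMat Φ t), map_smul]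
  rfl

/-- Evaluation of `Φ(b) v` at `t`, extended to a functional on all bounded operators. -/
theorem exists_evalFunctional (t : UnitAddTorus (Fin d)) (v : Fin N → ℂ) :
    ∃ ψ : Op d →L[ℂ] (Fin N → ℂ), ∀ b : smoothTorus θ, ψ b = (matrixAt Φ b t).mulVec v := by
  let S : Submodule ℂ (Op d) := (cTorus θ).toSubalgebra.toSubmodule
  let f : S →L[ℂ] (Fin N → ℂ) :=
    { toFun := fun b => (evalMat Φ t ⟨b.1, b.2⟩).mulVec v
      map_add' := fun b c => by
        rw [← Matrix.add_mulVec, ← map_add]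
        rfl
      map_smul' := fun r b => by
        rw [RingHom.id_apply, ← Matrix.smul_mulVec, ← map_smul]
        rfl
      cont := by
        have h : Continuous fun b : S => evalMat Φ t ⟨b.1, b.2⟩ :=
          (continuous_evalMat Φ t).comp (continuous_subtype_val.subtype_mk _)
        exact h.matrix_mulVec continuous_const }
  -- Hahn–Banach in each of the finitely many coordinates. On all of `Op d` the functional can be
  -- interchanged with operator-valued integrals.
  obtain ⟨ψ, hψ⟩ := f.exist_extension_of_finiteDimensional_range
  exact ⟨ψ, fun b => (DFunLike.congr_fun hψ ⟨b.1, b.2.1⟩).symm⟩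

/-! ### Sections -/

/-- The section `Φ(b) v`. -/
def sec (v : Fin N → ℂ) (b : smoothTorus θ) : Sec d N := fun t => (matrixAt Φ b t).mulVec v

variable (v : Fin N → ℂ)

theorem sec_add (b c : smoothTorus θ) : sec Φ v (b + c) = sec Φ v b + sec Φ v c := by
  funext t
  simp only [sec, matrixAt_add, Matrix.add_mulVec, Pi.add_apply]

theorem sec_smul (r : ℂ) (b : smoothTorus θ) : sec Φ v (r • b) = r • sec Φ v b := by
  funext t
  simp only [sec, matrixAt_smul, Matrix.smul_mulVec, Pi.smul_apply]

/-- `b ↦ Φ(b) v` as a linear map. -/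
def secLinear : smoothTorus θ →ₗ[ℂ] Sec d N where
  toFun := sec Φ v
  map_add' := sec_add Φ v
  map_smul' := sec_smul Φ v

theorem matMul_sec (b c : smoothTorus θ) :
    matMul (matrixAt Φ b) (sec Φ v c) = sec Φ v (b * c) := by
  funext t
  simp only [matMul, sec, matrixAt_mul, Matrix.mulVec_mulVec]

theorem expMul_sec (x b : smoothTorus θ) (r : ℝ) :
    expMul (matrixAt Φ x) (-r) (sec Φ v b) = sec Φ v (expT x r [] * b) := by
  rw [← matMul_sec, expMul]
  congr 1
  funext t
  rw [matrixAt_expT]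

theorem expMul_const (x : smoothTorus θ) (r : ℝ) :
    expMul (matrixAt Φ x) (-r) (fun _ => v) = sec Φ v (expT x r []) := by
  funext t
  rw [expMul, matMul, sec, matrixAt_expT]

/-- The curve through t is lifted to a straight line in ℝ^d, where smoothness is defined. -/
theorem TorusSmooth.differentiableAt {g : UnitAddTorus (Fin d) → ℂ} (hg : TorusSmooth g)
    (i : Fin d) (t : UnitAddTorus (Fin d)) :
    DifferentiableAt ℝ (fun s : ℝ => g (t + Pi.single i (s : UnitAddCircle))) 0 := by
  choose y hy using fun j => QuotientAddGroup.mk_surjective (t j)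
  have h1 : (fun s : ℝ => g (t + Pi.single i (s : UnitAddCircle))) =
      (fun y : Fin d → ℝ => g fun i => (y i : UnitAddCircle)) ∘
        fun s : ℝ => y + Pi.single i s := by
    funext s
    simp only [Function.comp]
    congr 1
    funext j
    rw [Pi.add_apply, Pi.add_apply, AddCircle.coe_add]
    congr 1
    · exact (hy j).symm
    · by_cases h : j = i
      · subst h; simp
      · simp [Pi.single_eq_of_ne h]
  rw [h1]
  refine DifferentiableAt.comp _ ((hg.differentiable (by simp)) _) ?_
  exact (differentiableAt_const _).add
    (ContinuousLinearMap.single ℝ (fun _ : Fin d => ℝ) i).differentiableAt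

variable {Φ}

theorem torusD_sec (hΦ : PreservesSmooth Φ) (i : Fin d) (b : smoothTorus θ) :
    torusD i (sec Φ v b) = sec Φ v (D θ i b) := by
  funext t
  have hd : ∀ p q, HasDerivAt (fun s : ℝ => Φ (toC b) p q (t + Pi.single i (s : UnitAddCircle)))
      (deriv (fun s : ℝ => Φ (toC b) p q (t + Pi.single i (s : UnitAddCircle))) 0) 0 := fun p q =>
    ((hΦ b p q).1.differentiableAt i t).hasDerivAt
  have h1 : HasDerivAt (fun s : ℝ => sec Φ v b (t + Pi.single i (s : UnitAddCircle)))
      (fun p => ∑ q, deriv (fun s : ℝ => Φ (toC b) p q (t + Pi.single i (s : UnitAddCircle))) 0 *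
        v q) 0 := by
    rw [hasDerivAt_pi]
    intro p
    exact HasDerivAt.fun_sum (u := Finset.univ) fun q _ => (hd p q).mul_const (v q)
  rw [torusD, h1.deriv]
  funext p
  simp only [Pi.smul_apply, smul_eq_mul, Finset.mul_sum, ← mul_assoc]
  refine Finset.sum_congr rfl fun q _ => ?_
  congr 1
  exact ((hΦ b p q).2 i t).symm

end

end NCTorus

namespace NCTorus

noncomputable section

variable {d N m : ℕ} {θ : Matrix (Fin d) (Fin d) ℝ}

/-! ### Differential operators as images of formal ones -/

/-- The action on `g` is linear in the operator. -/
def actAt (g : smoothTorus θ) : FormalOp θ →ₗ[ℂ] smoothTorus θ where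
  toFun B := act B g
  map_add' B B' := act_add B B' g
  map_smul' c B := act_smul c B g

theorem act_sum {ι : Type*} (s : Finset ι) (B : ι → FormalOp θ) (g : smoothTorus θ) :
    act (∑ i ∈ s, B i) g = ∑ i ∈ s, act (B i) g :=
  map_sum (actAt g) B s

theorem act_single (α : Fin d → ℕ) (b g : smoothTorus θ) :
    act (Finsupp.single α b) g = b * DSeq (idx α) g := by
  rw [act_apply, Finsupp.sum_single_index]
  ext1
  simp

theorem act_formalA (x : smoothTorus θ) (a : Fin d → smoothTorus θ) (i : Fin d)
    (g : smoothTorus θ) : act (formalA x a i) g = (2 : ℂ) • (x * D θ i g) + a i * g := by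
  rw [formalA, act_add, act_single, act_single_zero, idx_single]
  congr 1

theorem act_formalP (x : smoothTorus θ) (a : Fin d → smoothTorus θ) (a₀ g : smoothTorus θ) :
    act (formalP x a a₀) g =
      x * ∑ i, D θ i (D θ i g) + ∑ i, a i * D θ i g + a₀ * g := by
  rw [formalP, act_add, act_add, act_sum, act_sum, act_single_zero]
  congr 2
  · rw [← lmul_apply, map_sum]
    refine Finset.sum_congr rfl fun i _ => ?_
    rw [act_single, idx_single]
    simp [List.replicate, DSeq_cons, DSeq_nil]
  · refine Finset.sum_congr rfl fun i _ => ?_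
    rw [act_single, idx_single]
    simp [DSeq_cons, DSeq_nil]

/-- A linear map that intertwines the multiplications and the derivations intertwines V(ξ) and P. It
is applied to b ↦ Φ(b)v for the Iochum–Masson side and to the inclusion into `Op d` for the
resolvent side. -/
theorem opW_map {M : Type*} [AddCommGroup M] [Module ℂ M] {X : M → M} {A : Fin d → M → M}
    {A₀ : M → M} {del : Fin d → M → M} {x : smoothTorus θ} {a : Fin d → smoothTorus θ}
    {a₀ : smoothTorus θ} (φ : smoothTorus θ →ₗ[ℂ] M) (hX : ∀ g, X (φ g) = φ (x * g))
    (hA : ∀ i g, A i (φ g) = φ (a i * g)) (hA₀ : ∀ g, A₀ (φ g) = φ (a₀ * g))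
    (hdel : ∀ i g, del i (φ g) = φ (D θ i g)) (𝒜 : Finset (Fin m))
    (ξ : EuclideanSpace ℝ (Fin d)) (j : Fin m) (g : smoothTorus θ) :
    opW X A A₀ del 𝒜 ξ j (φ g) = φ (act (formalWAt x a a₀ 𝒜 ξ j) g) := by
  rw [opW, formalWAt]
  split_ifs
  · rw [act_sum, map_sum, opV]
    refine Finset.sum_congr rfl fun i _ => ?_
    rw [act_smul, act_formalA, map_smul, map_add, map_smul, hdel, hX, hA]
  · rw [act_formalP, map_add, map_add, map_sum, opP, hA₀, ← hX, map_sum]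
    simp only [hdel, hA]

section Sections

variable {Φ : cTorus θ →⋆ₐ[ℂ] Matrix (Fin N) (Fin N) C(UnitAddTorus (Fin d), ℂ)}

theorem imW_sec (hΦ : PreservesSmooth Φ) (x : smoothTorus θ) (a : Fin d → smoothTorus θ)
    (a₀ : smoothTorus θ) (𝒜 : Finset (Fin m)) (ξ : EuclideanSpace ℝ (Fin d)) (v : Fin N → ℂ)
    (j : Fin m) (g : smoothTorus θ) :
    imW Φ x a a₀ 𝒜 ξ j (sec Φ v g) = sec Φ v (act (formalWAt x a a₀ 𝒜 ξ j) g) :=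
  opW_map (secLinear Φ v) (matMul_sec Φ v x) (fun i => matMul_sec Φ v (a i)) (matMul_sec Φ v a₀)
    (torusD_sec v hΦ) 𝒜 ξ j g

theorem foldr_expMul (x : smoothTorus θ) (v : Fin N → ℂ) {B : Fin m → Sec d N → Sec d N}
    {Bf : Fin m → FormalOp θ} (hB : ∀ j g, B j (sec Φ v g) = sec Φ v (act (Bf j) g))
    (r : Fin (m + 1) → ℝ) :
    (List.ofFn fun (j : Fin m) (g : Sec d N) =>
      expMul (matrixAt Φ x) (-r j.castSucc) (B j g)).foldr (fun T g => T g)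
        (expMul (matrixAt Φ x) (-r (Fin.last m)) fun _ => v) = sec Φ v (heatProd x r Bf) := by
  induction m with
  | zero => exact expMul_const Φ v x _
  | succ m ih =>
    have := ih (B := fun j => B j.succ) (Bf := fun j => Bf j.succ) (fun j => hB j.succ)
      fun j => r j.succ
    rw [List.ofFn_succ, List.foldr_cons, heatProd_succ, ← expMul_sec, ← hB, ← this]
    rfl

theorem imIntegrand_eq (hΦ : PreservesSmooth Φ) (x : smoothTorus θ) (a : Fin d → smoothTorus θ)
    (a₀ : smoothTorus θ) (𝒜 : Finset (Fin m)) (ξ : EuclideanSpace ℝ (Fin d)) (v : Fin N → ℂ)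
    (s : Fin m → ℝ) :
    imIntegrand (matrixAt Φ x) ξ (imW Φ x a a₀ 𝒜 ξ) v s =
      sec Φ v (heatProd x (fun j => wt s j * ‖ξ‖ ^ 2) (formalWAt x a a₀ 𝒜 ξ)) := by
  have h : ∀ j : Fin (m + 1), (extSeq s j.succ - extSeq s j.castSucc) * ‖ξ‖ ^ 2 =
      -(wt s j * ‖ξ‖ ^ 2) := fun j => by
    rw [wt]
    ring
  simp only [imIntegrand, h]
  exact foldr_expMul x v (imW_sec hΦ x a a₀ 𝒜 ξ v) fun j => wt s j * ‖ξ‖ ^ 2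

variable {x : smoothTorus θ} {k : ℕ} {𝒜 : Finset (Fin m)}

theorem inv_norm_pow_mul_neg_sq_pow {ξ : EuclideanSpace ℝ (Fin d)} (hξ : ξ ≠ 0) (m : ℕ) :
    (‖ξ‖ ^ (2 * m))⁻¹ * (-‖ξ‖ ^ 2) ^ m = (-1) ^ m := by
  rw [neg_pow, ← pow_mul, mul_left_comm, inv_mul_cancel₀, mul_one]
  exact pow_ne_zero _ (norm_ne_zero_iff.2 hξ)

theorem integrableOn_imIntegrand (hΦ : PreservesSmooth Φ) (x : smoothTorus θ)
    (a : Fin d → smoothTorus θ) (a₀ : smoothTorus θ) (𝒜 : Finset (Fin m)) (v : Fin N → ℂ)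
    (t : UnitAddTorus (Fin d)) (ξ : EuclideanSpace ℝ (Fin d)) :
    IntegrableOn (fun s => imIntegrand (matrixAt Φ x) ξ (imW Φ x a a₀ 𝒜 ξ) v s t) (simplex m) := by
  obtain ⟨ψ, hψ⟩ := exists_evalFunctional Φ t v
  simp only [imIntegrand_eq hΦ, sec, ← hψ]
  exact ψ.integrable_comp
    ((smoothCts_heatProd_wt x _ _).smoothIntegrable (isCompact_simplex m)).integrable

/-- The sign arises as (-1)^m = |ξ|^{-2m} (-|ξ|²)^m, the second factor being the prefactor of the
simplex formula; hence ξ ≠ 0. -/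
theorem smul_imF_eq (hΦ : PreservesSmooth Φ) (x : smoothTorus θ)
    (a : Fin d → smoothTorus θ) (a₀ : smoothTorus θ) (𝒜 : Finset (Fin m)) {v : Fin N → ℂ}
    {t : UnitAddTorus (Fin d)} {ψ : Op d →L[ℂ] (Fin N → ℂ)}
    (hψ : ∀ b : smoothTorus θ, ψ b = (matrixAt Φ b t).mulVec v)
    {ξ : EuclideanSpace ℝ (Fin d)} (hξ : ξ ≠ 0) :
    (-1 : ℂ) ^ m • imF (matrixAt Φ x) ξ (imW Φ x a a₀ 𝒜 ξ) v t =
      ψ ((((‖ξ‖ ^ (2 * m))⁻¹ : ℝ) : ℂ) •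
        (chain x (‖ξ‖ ^ 2) (List.ofFn (formalWAt x a a₀ 𝒜 ξ)) : Op d)) := by
  rw [← smul_setIntegral_heatProd, smul_smul, ← Complex.ofReal_mul,
    inv_norm_pow_mul_neg_sq_pow hξ, map_smul, ← ψ.integral_comp_comm
      ((smoothCts_heatProd_wt x _ _).smoothIntegrable (isCompact_simplex m)).integrable]
  simp only [imF, imIntegrand_eq hΦ, sec, hψ]
  push_cast
  rfl

theorem integrable_smul_imF_and_integral [NeZero d] (hΦ : PreservesSmooth Φ)
    (hx : (x : Op d).IsPositive) (hxu : IsUnit (x : Op d)) (a : Fin d → smoothTorus θ)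
    (a₀ : smoothTorus θ) (hk : Even k) (hm : k ≤ 2 * m) (h𝒜 : 𝒜.card = 2 * m - k)
    {v : Fin N → ℂ} {t : UnitAddTorus (Fin d)} {ψ : Op d →L[ℂ] (Fin N → ℂ)}
    (hψ : ∀ b : smoothTorus θ, ψ b = (matrixAt Φ b t).mulVec v) {F : ℝ → ℝ}
    (hF : IsPowerPrimitive k d F) :
    Integrable (fun ξ => (-1 : ℂ) ^ m • imF (matrixAt Φ x) ξ (imW Φ x a a₀ 𝒜 ξ) v t) ∧
      ∫ ξ, (-1 : ℂ) ^ m • imF (matrixAt Φ x) ξ (imW Φ x a a₀ 𝒜 ξ) v t =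
        ψ (mainSummand θ x a a₀ k F 𝒜) := by
  have h0 : ∀ᵐ ξ : EuclideanSpace ℝ (Fin d), ξ ≠ 0 := by
    simp [ae_iff]
  have hint : Integrable fun ξ : EuclideanSpace ℝ (Fin d) => (((‖ξ‖ ^ (2 * m))⁻¹ : ℝ) : ℂ) •
      (chain x (‖ξ‖ ^ 2) (List.ofFn (formalWAt x a a₀ 𝒜 ξ)) : Op d) :=
    (smoothIntegrable_formalWAt hx hxu a a₀ hk hm h𝒜).integrable
  have hae : ∀ᵐ ξ : EuclideanSpace ℝ (Fin d),
      ψ ((((‖ξ‖ ^ (2 * m))⁻¹ : ℝ) : ℂ) •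
        (chain x (‖ξ‖ ^ 2) (List.ofFn (formalWAt x a a₀ 𝒜 ξ)) : Op d)) =
      (-1 : ℂ) ^ m • imF (matrixAt Φ x) ξ (imW Φ x a a₀ 𝒜 ξ) v t :=
    h0.mono fun ξ hξ => (smul_imF_eq hΦ x a a₀ 𝒜 hψ hξ).symm
  refine ⟨(ψ.integrable_comp hint).congr hae, ?_⟩
  rw [mainSummand_eq_integral hF hx hxu a a₀ hk hm h𝒜, ← ψ.integral_comp_comm hint]
  exact (integral_congr_ae hae).symm

theorem mainSummand_mem [NeZero d] (hx : (x : Op d).IsPositive) (hxu : IsUnit (x : Op d))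
    (a : Fin d → smoothTorus θ) (a₀ : smoothTorus θ) (hk : Even k) (hm : k ≤ 2 * m)
    (h𝒜 : 𝒜.card = 2 * m - k) {F : ℝ → ℝ} (hF : IsPowerPrimitive k d F) :
    mainSummand θ x a a₀ k F 𝒜 ∈ smoothTorus θ := by
  rw [mainSummand_eq_integral hF hx hxu a a₀ hk hm h𝒜]
  exact (smoothIntegrable_formalWAt hx hxu a a₀ hk hm h𝒜).mem

end Sections

end

end NCTorus

namespace NCTorus

noncomputable section

/-! ### Inversion of the Fourier–Laplace transform on the half-line -/

section HalfLine

variable {E : Type*} [NormedAddCommGroup E] {c : ℝ} {f f' f'' : ℝ → E}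

/-- Continuous functions that decay exponentially on the half-line. -/
def ExpDecay (c : ℝ) (f : ℝ → E) : Prop :=
  Continuous f ∧ ∃ C, 0 ≤ C ∧ ∀ u, 0 ≤ u → ‖f u‖ ≤ C * Real.exp (-(c * u))

theorem ExpDecay.add (hf : ExpDecay c f) (hg : ExpDecay c f') :
    ExpDecay c fun u => f u + f' u := by
  obtain ⟨h1, C, hC0, hC⟩ := hf
  obtain ⟨h2, C', hC0', hC'⟩ := hg
  refine ⟨h1.add h2, C + C', by positivity, fun u hu => (norm_add_le _ _).trans ?_⟩
  rw [add_mul]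
  exact add_le_add (hC u hu) (hC' u hu)

theorem ExpDecay.mono {c' : ℝ} (h : c' ≤ c) (hf : ExpDecay c f) : ExpDecay c' f := by
  obtain ⟨h1, C, hC0, hC⟩ := hf
  refine ⟨h1, C, hC0, fun u hu => (hC u hu).trans ?_⟩
  gcongr

theorem ExpDecay.integrableOn (hc : 0 < c) (hf : ExpDecay c f) : IntegrableOn f (Set.Ioi 0) := by
  obtain ⟨h1, C, hC0, hC⟩ := hf
  refine Integrable.mono' ((exp_neg_integrableOn_Ioi 0 hc).const_mul C)
    h1.aestronglyMeasurable ((ae_restrict_mem measurableSet_Ioi).mono fun u hu => ?_)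
  simpa only [neg_mul] using hC u (le_of_lt hu)

theorem ExpDecay.tendsto (hc : 0 < c) (hf : ExpDecay c f) : Tendsto f atTop (𝓝 0) := by
  obtain ⟨h1, C, hC0, hC⟩ := hf
  refine squeeze_zero_norm' (a := fun u => C * Real.exp (-(c * u)))
    ((eventually_ge_atTop 0).mono hC) ?_
  have h2 : Tendsto (fun u : ℝ => Real.exp (-(c * u))) atTop (𝓝 0) :=
    Real.tendsto_exp_neg_atTop_nhds_zero.comp (tendsto_id.const_mul_atTop hc)
  simpa using h2.const_mul C

variable [NormedSpace ℂ E]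

theorem ExpDecay.id_smul (hc : 0 < c) (hf : ExpDecay c f) :
    ExpDecay (c / 2) fun u => (u : ℂ) • f u := by
  obtain ⟨h1, C, hC0, hC⟩ := hf
  obtain ⟨C', hC0', hC'⟩ := pow_le_mul_exp (half_pos hc) 1
  refine ⟨Complex.continuous_ofReal.smul h1, C' * C, by positivity, fun u hu => ?_⟩
  rw [norm_smul, Complex.norm_real, Real.norm_of_nonneg hu]
  have h2 := hC' u hu
  rw [pow_one] at h2
  have h3 : Real.exp (c / 2 * u) * Real.exp (-(c * u)) = Real.exp (-(c / 2 * u)) := by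
    rw [← Real.exp_add]
    congr 1
    ring
  calc u * ‖f u‖ ≤ (C' * Real.exp (c / 2 * u)) * (C * Real.exp (-(c * u))) :=
        mul_le_mul h2 (hC u hu) (norm_nonneg _) (by positivity)
    _ = C' * C * (Real.exp (c / 2 * u) * Real.exp (-(c * u))) := by ring
    _ = _ := by rw [h3]

/-- `∫₀^∞ e^{-ilu} f(u) du`. -/
def halfFourier (f : ℝ → E) (l : ℝ) : E :=
  ∫ u in Set.Ioi (0 : ℝ), Complex.exp (-(Complex.I * l * u)) • f u

theorem norm_exp_neg_I_mul (l u : ℝ) : ‖Complex.exp (-(Complex.I * l * u))‖ = 1 := by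
  have : -(Complex.I * l * u) = ((-(l * u) : ℝ) : ℂ) * Complex.I := by
    push_cast
    ring
  rw [this, Complex.norm_exp_ofReal_mul_I]

theorem continuous_exp_neg_I_mul (l : ℝ) :
    Continuous fun u : ℝ => Complex.exp (-(Complex.I * l * u)) := by fun_prop

theorem IntegrableOn.exp_smul (l : ℝ) (hf : IntegrableOn f (Set.Ioi 0)) :
    IntegrableOn (fun u : ℝ => Complex.exp (-(Complex.I * l * u)) • f u) (Set.Ioi 0) :=
  hf.bdd_smul 1 (continuous_exp_neg_I_mul l).aestronglyMeasurable
    (.of_forall fun u => (norm_exp_neg_I_mul l u).le)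

theorem norm_halfFourier_le (f : ℝ → E) (l : ℝ) :
    ‖halfFourier f l‖ ≤ ∫ u in Set.Ioi (0 : ℝ), ‖f u‖ := by
  refine (norm_integral_le_integral_norm _).trans_eq ?_
  simp only [norm_smul, norm_exp_neg_I_mul, one_mul]

theorem hasDerivAt_halfFourier (hc : 0 < c) (hf : ExpDecay c f) (l : ℝ) :
    HasDerivAt (halfFourier f) (-(Complex.I • halfFourier (fun u => (u : ℂ) • f u) l)) l := by
  have hg := hf.id_smul hc
  have h := (hasDerivAt_integral_of_dominated_loc_of_deriv_le (𝕜 := ℝ)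
    (μ := volume.restrict (Set.Ioi (0 : ℝ)))
    (F := fun l u => Complex.exp (-(Complex.I * l * u)) • f u)
    (F' := fun l u => -(Complex.I • Complex.exp (-(Complex.I * l * u)) • (u : ℂ) • f u))
    (x₀ := l) (bound := fun u => ‖(u : ℂ) • f u‖) (s := Set.univ) univ_mem
    (.of_forall fun l => ((continuous_exp_neg_I_mul l).smul hf.1).aestronglyMeasurable)
    (IntegrableOn.exp_smul l (hf.integrableOn hc))
    (((continuous_exp_neg_I_mul l).smul hg.1).const_smul Complex.I).neg.aestronglyMeasurable
    (.of_forall fun u l _ => ?_) (hg.integrableOn (half_pos hc)).norm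
    (.of_forall fun u l _ => ?_)).2
  · rw [integral_neg, integral_smul] at h
    exact h
  · rw [norm_neg, norm_smul, norm_smul, Complex.norm_I, norm_exp_neg_I_mul, one_mul, one_mul]
  · have h2 : HasDerivAt (fun l : ℝ => -(Complex.I * (l : ℂ) * u)) (-(Complex.I * 1 * u)) l :=
      (((Complex.ofRealCLM.hasDerivAt).const_mul Complex.I).mul_const (u : ℂ)).neg
    refine (h2.cexp.smul_const (f u)).congr_deriv ?_
    rw [smul_smul, smul_smul, ← neg_smul]
    congr 1
    ring

theorem continuous_halfFourier (hc : 0 < c) (hf : ExpDecay c f) : Continuous (halfFourier f) :=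
  continuous_iff_continuousAt.2 fun l => (hasDerivAt_halfFourier hc hf l).continuousAt

variable [CompleteSpace E]

/-- Integration by parts; the boundary term f(0) at the origin survives. -/
theorem I_mul_smul_halfFourier (hc : 0 < c) (hf : ExpDecay c f) (hf' : ExpDecay c f')
    (h : ∀ u, HasDerivAt f (f' u) u) (l : ℝ) :
    (Complex.I * l) • halfFourier f l = f 0 + halfFourier f' l := by
  have h1 : ∀ u : ℝ, HasDerivAt (fun u : ℝ => Complex.exp (-(Complex.I * l * u)) • f u)
      (Complex.exp (-(Complex.I * l * u)) • f' u -
        (Complex.I * l) • Complex.exp (-(Complex.I * l * u)) • f u) u := by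
    intro u
    have h2 : HasDerivAt (fun u : ℝ => -(Complex.I * l * (u : ℂ))) (-(Complex.I * l * 1)) u :=
      ((Complex.ofRealCLM.hasDerivAt).const_mul (Complex.I * (l : ℂ))).neg
    refine (h2.cexp.smul (h u)).congr_deriv ?_
    rw [smul_smul, sub_eq_add_neg, ← neg_smul, mul_one, mul_comm]
    congr 2
    ring
  have hi := IntegrableOn.exp_smul l (hf.integrableOn hc)
  have hi' := IntegrableOn.exp_smul l (hf'.integrableOn hc)
  have hi2 : IntegrableOn (fun u : ℝ =>
      (Complex.I * l) • Complex.exp (-(Complex.I * l * u)) • f u) (Set.Ioi 0) :=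
    hi.smul (Complex.I * (l : ℂ))
  have h3 := integral_Ioi_of_hasDerivAt_of_tendsto' (a := 0) (m := 0)
    (f := fun u : ℝ => Complex.exp (-(Complex.I * l * u)) • f u)
    (fun u _ => h1 u) (hi'.sub hi2) ?_
  · rw [integral_sub hi' hi2, integral_smul] at h3
    rw [halfFourier, halfFourier]
    have h4 : Complex.exp (-(Complex.I * l * ((0 : ℝ) : ℂ))) • f 0 = f 0 := by simp
    rw [h4, zero_sub] at h3
    rw [sub_eq_iff_eq_add] at h3
    rw [h3]
    abel
  · refine squeeze_zero_norm (fun u => ?_) (tendsto_zero_iff_norm_tendsto_zero.1 (hf.tendsto hc))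
    rw [norm_smul, norm_exp_neg_I_mul, one_mul]

theorem tendsto_halfFourier (hc : 0 < c) (hf : ExpDecay c f) (hf' : ExpDecay c f')
    (h : ∀ u, HasDerivAt f (f' u) u) {F : Filter ℝ} (hF : Tendsto (fun l => |l|) F atTop) :
    Tendsto (halfFourier f) F (𝓝 0) := by
  have hb : ∀ᶠ l in F, ‖halfFourier f l‖ ≤
      (‖f 0‖ + ∫ u in Set.Ioi (0 : ℝ), ‖f' u‖) * |l|⁻¹ := by
    filter_upwards [hF.eventually (eventually_gt_atTop 0)] with l hl
    have h1 := congrArg norm (I_mul_smul_halfFourier hc hf hf' h l)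
    rw [norm_smul, norm_mul, Complex.norm_I, one_mul, Complex.norm_real, Real.norm_eq_abs] at h1
    rw [← div_eq_mul_inv, le_div_iff₀ hl, mul_comm, h1]
    exact (norm_add_le _ _).trans (add_le_add le_rfl (norm_halfFourier_le _ _))
  refine squeeze_zero_norm' hb ?_
  simpa using (tendsto_inv_atTop_zero.comp hF).const_mul _

/-- Unlike f, the function u f(u) vanishes at 0 and its extension by zero has no jump. A second
integration by parts gives decay of order l⁻², while f itself only gives l⁻¹. -/
theorem integrable_halfFourier_id_smul (hc : 0 < c) (hf : ExpDecay c f) (hf' : ExpDecay c f')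
    (hf'' : ExpDecay c f'') (h : ∀ u, HasDerivAt f (f' u) u)
    (h' : ∀ u, HasDerivAt f' (f'' u) u) :
    Integrable (halfFourier fun u => (u : ℂ) • f u) := by
  have hof : ∀ u : ℝ, HasDerivAt (fun u : ℝ => (u : ℂ)) 1 u := fun u =>
    Complex.ofRealCLM.hasDerivAt
  have hc2 := half_pos hc
  have hle : c / 2 ≤ c := by linarith
  have hg := hf.id_smul hc
  have hg' : ExpDecay (c / 2) fun u => (u : ℂ) • f' u + f u := (hf'.id_smul hc).add (hf.mono hle)
  have hg'' : ExpDecay (c / 2) fun u => ((u : ℂ) • f'' u + f' u) + f' u :=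
    ((hf''.id_smul hc).add (hf'.mono hle)).add (hf'.mono hle)
  have h1 : ∀ u : ℝ, HasDerivAt (fun u : ℝ => (u : ℂ) • f u) ((u : ℂ) • f' u + f u) u := fun u => by
    have := (hof u).smul (h u)
    simp only [one_smul] at this
    exact this
  have h2 : ∀ u : ℝ, HasDerivAt (fun u : ℝ => (u : ℂ) • f' u + f u)
      (((u : ℂ) • f'' u + f' u) + f' u) u := fun u => by
    have := (hof u).smul (h' u)
    simp only [one_smul] at this
    exact this.add (h u)
  set A := ∫ u in Set.Ioi (0 : ℝ), ‖(u : ℂ) • f u‖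
  set B := ‖f 0‖ + ∫ u in Set.Ioi (0 : ℝ), ‖((u : ℂ) • f'' u + f' u) + f' u‖
  refine (integrable_inv_one_add_sq.const_mul (A + B)).mono'
    (continuous_halfFourier hc2 hg).aestronglyMeasurable (.of_forall fun l => ?_)
  have e1 := I_mul_smul_halfFourier hc2 hg hg' h1 l
  have e2 := I_mul_smul_halfFourier hc2 hg' hg'' h2 l
  simp only [Complex.ofReal_zero, zero_smul, zero_add] at e1 e2
  rw [← e1] at e2
  have e3 := congrArg norm e2
  rw [norm_smul, norm_smul, norm_mul, Complex.norm_I, one_mul, Complex.norm_real,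
    Real.norm_eq_abs, ← mul_assoc, abs_mul_abs_self] at e3
  have e4 : l * l * ‖halfFourier (fun u => (u : ℂ) • f u) l‖ ≤ B := by
    rw [e3]
    exact (norm_add_le _ _).trans (add_le_add le_rfl (norm_halfFourier_le _ _))
  have e5 := norm_halfFourier_le (fun u : ℝ => (u : ℂ) • f u) l
  rw [← div_eq_mul_inv, le_div_iff₀ (by positivity)]
  calc _ = ‖halfFourier (fun u => (u : ℂ) • f u) l‖ +
        l * l * ‖halfFourier (fun u => (u : ℂ) • f u) l‖ := by ring
    _ ≤ _ := add_le_add e5 e4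

open FourierTransform in
-- Fourier inversion for u f(u), extended by 0 to the negative half-line, at its continuity point u
-- = 1, where the factor u is 1; the frequency is rescaled by 2π.
theorem integral_exp_smul_halfFourier_id_smul (hc : 0 < c) (hf : ExpDecay c f)
    (hi : Integrable (halfFourier fun u => (u : ℂ) • f u)) :
    ∫ l : ℝ, Complex.exp (Complex.I * l) • halfFourier (fun u => (u : ℂ) • f u) l =
      (2 * Real.pi : ℂ) • f 1 := by
  have hg := hf.id_smul hc
  let G : ℝ → E := (Set.Ioi 0).indicator fun u => (u : ℂ) • f u
  have hG : Integrable G := (integrable_indicator_iff measurableSet_Ioi).2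
    (hg.integrableOn (half_pos hc))
  have hFG : 𝓕 G = fun y => halfFourier (fun u => (u : ℂ) • f u) (2 * Real.pi * y) := by
    funext y
    rw [Real.fourier_eq', halfFourier, ← integral_indicator measurableSet_Ioi]
    refine integral_congr_ae (.of_forall fun u => ?_)
    simp only [G]
    by_cases hu : u ∈ Set.Ioi (0 : ℝ)
    · rw [Set.indicator_of_mem hu, Set.indicator_of_mem hu]
      congr 2
      simp
      ring
    · rw [Set.indicator_of_notMem hu, Set.indicator_of_notMem hu, smul_zero]
  have hpi : 2 * Real.pi ≠ 0 := by positivity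
  have hFi : Integrable (𝓕 G) := by
    rw [hFG]
    exact hi.comp_mul_left' hpi
  have hGc : ContinuousAt G 1 := by
    have : G =ᶠ[𝓝 1] fun u => (u : ℂ) • f u := by
      filter_upwards [Ioi_mem_nhds zero_lt_one] with u hu
      exact Set.indicator_of_mem hu _
    exact hg.1.continuousAt.congr this.symm
  have hinv := hG.fourierInv_fourier_eq hFi hGc
  have hG1 : G 1 = f 1 := by
    have : (1 : ℝ) ∈ Set.Ioi (0 : ℝ) := Set.mem_Ioi.2 zero_lt_one
    simp only [G]
    rw [Set.indicator_of_mem this]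
    simp
  rw [hG1, Real.fourierInv_eq', hFG] at hinv
  have hcv := Measure.integral_comp_mul_left
    (fun l : ℝ => Complex.exp (Complex.I * l) • halfFourier (fun u => (u : ℂ) • f u) l)
    (2 * Real.pi)
  have h3 : ∫ y : ℝ, Complex.exp (Complex.I * ((2 * Real.pi * y : ℝ) : ℂ)) •
      halfFourier (fun u => (u : ℂ) • f u) (2 * Real.pi * y) = f 1 := by
    rw [← hinv]
    refine integral_congr_ae (.of_forall fun y => ?_)
    simp only []
    congr 2
    simp
    ring
  rw [h3, abs_of_nonneg (by positivity)] at hcv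
  rw [hcv, ← Complex.coe_smul, smul_smul]
  have : (2 * Real.pi : ℂ) * (((2 * Real.pi)⁻¹ : ℝ) : ℂ) = 1 := by
    push_cast
    exact mul_inv_cancel₀ (by exact_mod_cast hpi)
  rw [this, one_smul]

/-- The inversion formula, with the integral over `ℝ` taken as a principal value. -/
theorem tendsto_integral_exp_smul_halfFourier (hc : 0 < c) (hf : ExpDecay c f)
    (hf' : ExpDecay c f') (hf'' : ExpDecay c f'') (h : ∀ u, HasDerivAt f (f' u) u)
    (h' : ∀ u, HasDerivAt f' (f'' u) u) :
    Tendsto (fun N : ℝ => ∫ l in (-N)..N, Complex.exp (Complex.I * l) • halfFourier f l) atTop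
      (𝓝 ((2 * Real.pi : ℂ) • f 1)) := by
  have hg := hf.id_smul hc
  have hi := integrable_halfFourier_id_smul hc hf hf' hf'' h h'
  have hexp : Continuous fun l : ℝ => Complex.exp (Complex.I * l) := by fun_prop
  have hexpn : ∀ l : ℝ, ‖Complex.exp (Complex.I * l)‖ = 1 := fun l => by
    rw [mul_comm, Complex.norm_exp_ofReal_mul_I]
  have hFc := continuous_halfFourier hc hf
  have hgc := continuous_halfFourier (half_pos hc) hg
  -- Multiplication by u is differentiation in l, so this derivative is the difference between the
  -- integrands for f and for u f(u), up to a factor i.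
  have hd : ∀ l : ℝ, HasDerivAt (fun l : ℝ => Complex.exp (Complex.I * l) • halfFourier f l)
      (Complex.I • (Complex.exp (Complex.I * l) • halfFourier f l) -
        Complex.I • (Complex.exp (Complex.I * l) • halfFourier (fun u => (u : ℂ) • f u) l)) l := by
    intro l
    have h2 : HasDerivAt (fun l : ℝ => Complex.I * (l : ℂ)) (Complex.I * 1) l :=
      (Complex.ofRealCLM.hasDerivAt).const_mul Complex.I
    refine (h2.cexp.smul (hasDerivAt_halfFourier hc hf l)).congr_deriv ?_
    rw [smul_neg, smul_smul, smul_smul, smul_smul, mul_one, mul_comm Complex.I, mul_comm]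
    abel
  -- The principal value for f is thus reduced to the absolutely convergent integral for u f(u),
  -- with boundary terms that vanish as N → ∞.
  have hparts : ∀ N : ℝ, ∫ l in (-N)..N, Complex.exp (Complex.I * l) • halfFourier f l =
      (∫ l in (-N)..N, Complex.exp (Complex.I * l) • halfFourier (fun u => (u : ℂ) • f u) l) +
        (-Complex.I) • (Complex.exp (Complex.I * N) • halfFourier f N -
          Complex.exp (Complex.I * (-N : ℝ)) • halfFourier f (-N)) := by
    intro N
    have i1 : IntervalIntegrable (fun l : ℝ => Complex.exp (Complex.I * l) • halfFourier f l)
      volume (-N) N := (hexp.smul hFc).intervalIntegrable _ _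
    have i2 : IntervalIntegrable (fun l : ℝ => Complex.exp (Complex.I * l) •
      halfFourier (fun u => (u : ℂ) • f u) l) volume (-N) N :=
      (hexp.smul hgc).intervalIntegrable _ _
    have j1 : IntervalIntegrable (fun l : ℝ => Complex.I • Complex.exp (Complex.I * l) •
      halfFourier f l) volume (-N) N := i1.smul Complex.I
    have j2 : IntervalIntegrable (fun l : ℝ => Complex.I • Complex.exp (Complex.I * l) •
      halfFourier (fun u => (u : ℂ) • f u) l) volume (-N) N := i2.smul Complex.I
    have e := intervalIntegral.integral_eq_sub_of_hasDerivAt (a := -N) (b := N) (fun l _ => hd l)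
      (j1.sub j2)
    rw [intervalIntegral.integral_sub j1 j2,
      intervalIntegral.integral_smul, intervalIntegral.integral_smul] at e
    rw [← e, smul_sub, smul_smul, smul_smul]
    simp
  have hlim : ∀ F : Filter ℝ, Tendsto (fun l => |l|) F atTop →
      Tendsto (fun l : ℝ => Complex.exp (Complex.I * l) • halfFourier f l) F (𝓝 0) := fun F hF => by
    refine squeeze_zero_norm (fun l => ?_)
      (tendsto_zero_iff_norm_tendsto_zero.1 (tendsto_halfFourier hc hf hf' h hF))
    rw [norm_smul, hexpn, one_mul]
  have l1 := hlim atTop tendsto_abs_atTop_atTop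
  have l2 := (hlim atBot tendsto_abs_atBot_atTop).comp tendsto_neg_atTop_atBot
  have l3 : Tendsto (fun N : ℝ => ∫ l in (-N)..N,
      Complex.exp (Complex.I * l) • halfFourier (fun u => (u : ℂ) • f u) l) atTop
      (𝓝 ((2 * Real.pi : ℂ) • f 1)) := by
    rw [← integral_exp_smul_halfFourier_id_smul hc hf hi]
    refine intervalIntegral_tendsto_integral ?_ tendsto_neg_atTop_atBot tendsto_id
    exact hi.bdd_smul 1 hexp.aestronglyMeasurable (.of_forall fun l => (hexpn l).le)
  have l4 := l3.add ((l1.sub l2).const_smul (-Complex.I))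
  simp only [sub_zero, smul_zero, add_zero] at l4
  refine l4.congr fun N => ?_
  rw [hparts N]
  rfl

end HalfLine

end

end NCTorus

namespace NCTorus

noncomputable section

variable {d : ℕ} {θ : Matrix (Fin d) (Fin d) ℝ}

/-! ### Differentiable families with exponential decay -/

section ExpSmooth

variable {E : Type*} [NormedAddCommGroup E] {c : ℝ}

theorem expDecay_zero : ExpDecay c fun _ : ℝ => (0 : E) :=
  ⟨continuous_const, 0, le_rfl, fun u _ => by simp⟩

theorem ExpDecay.comp_mul_left {h : ℝ} (hh : 0 ≤ h) {f : ℝ → E} (hf : ExpDecay c f) :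
    ExpDecay (c * h) fun u => f (h * u) := by
  obtain ⟨h1, C, hC0, hC⟩ := hf
  refine ⟨h1.comp (continuous_const.mul continuous_id), C, hC0, fun u hu => ?_⟩
  rw [mul_assoc]
  exact hC _ (mul_nonneg hh hu)

variable [NormedSpace ℝ E]

/-- Functions that decay exponentially on the half-line with their first `n` derivatives. -/
def ExpSmooth (c : ℝ) : ℕ → (ℝ → E) → Prop
  | 0, f => ExpDecay c f
  | n + 1, f => ExpDecay c f ∧ ∃ f', (∀ u, HasDerivAt f (f' u) u) ∧ ExpSmooth c n f'

theorem ExpSmooth.expDecay {n : ℕ} {f : ℝ → E} (h : ExpSmooth c n f) : ExpDecay c f := by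
  cases n with
  | zero => exact h
  | succ n => exact h.1

theorem ExpDecay.clm_comp {E' : Type*} [NormedAddCommGroup E'] [NormedSpace ℝ E'] {f : ℝ → E}
    (T : E →L[ℝ] E') (h : ExpDecay c f) : ExpDecay c fun u => T (f u) := by
  obtain ⟨h1, C, hC0, hC⟩ := h
  refine ⟨T.continuous.comp h1, ‖T‖ * C, by positivity, fun u hu => (T.le_opNorm _).trans ?_⟩
  rw [mul_assoc]
  exact mul_le_mul_of_nonneg_left (hC u hu) (norm_nonneg _)

theorem ExpSmooth.add {n : ℕ} {f g : ℝ → E} (hf : ExpSmooth c n f) (hg : ExpSmooth c n g) :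
    ExpSmooth c n fun u => f u + g u := by
  induction n generalizing f g with
  | zero => exact ExpDecay.add hf hg
  | succ n ih =>
    obtain ⟨h1, f', hf', hf''⟩ := hf
    obtain ⟨h2, g', hg', hg''⟩ := hg
    exact ⟨h1.add h2, _, fun u => (hf' u).add (hg' u), ih hf'' hg''⟩

theorem ExpSmooth.clm_comp {E' : Type*} [NormedAddCommGroup E'] [NormedSpace ℝ E'] {n : ℕ}
    {f : ℝ → E} (T : E →L[ℝ] E') (h : ExpSmooth c n f) : ExpSmooth c n fun u => T (f u) := by
  induction n generalizing f with
  | zero => exact ExpDecay.clm_comp T h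
  | succ n ih =>
    obtain ⟨h1, f', hf', hf''⟩ := h
    exact ⟨h1.clm_comp T, _, fun u => T.hasFDerivAt.comp_hasDerivAt u (hf' u), ih hf''⟩

theorem expSmooth_zero (n : ℕ) : ExpSmooth c n fun _ : ℝ => (0 : E) := by
  induction n with
  | zero => exact expDecay_zero
  | succ n ih => exact ⟨expDecay_zero, _, fun u => hasDerivAt_const u 0, ih⟩

theorem ExpSmooth.comp_mul_left {h : ℝ} (hh : 0 ≤ h) {n : ℕ} {f : ℝ → E}
    (hf : ExpSmooth c n f) : ExpSmooth (c * h) n fun u => f (h * u) := by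
  induction n generalizing f with
  | zero => exact ExpDecay.comp_mul_left hh hf
  | succ n ih =>
    obtain ⟨h1, f', hf', hf''⟩ := hf
    refine ⟨h1.comp_mul_left hh, fun u => h • f' (h * u), fun u => ?_,
      (ih hf'').clm_comp (h • ContinuousLinearMap.id ℝ E)⟩
    have h2 : HasDerivAt (fun u : ℝ => h * u) h u := by
      simpa using (hasDerivAt_id u).const_mul h
    exact (hf' (h * u)).scomp u h2

/-- Functions with `n` exponentially decaying derivatives. -/
def expSmoothSubgroup (E : Type*) [NormedAddCommGroup E] [NormedSpace ℝ E] (c : ℝ) (n : ℕ) :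
    AddSubgroup (ℝ → E) where
  carrier := {f | ExpSmooth c n f}
  zero_mem' := expSmooth_zero n
  add_mem' := fun hf hg => ExpSmooth.add hf hg
  neg_mem' := fun hf => ExpSmooth.clm_comp (-ContinuousLinearMap.id ℝ E) hf

end ExpSmooth

section Chain

variable {x : smoothTorus θ} {c : ℝ}

/-- Left multiplication, as a real-linear map. -/
def mulLeftReal (b : Op d) : Op d →L[ℝ] Op d := ContinuousLinearMap.mul ℝ (Op d) b

/-- By the differential equation the derivative is again a combination of functions `expT`, so one
decay estimate for all lists yields all derivatives. -/
theorem expSmooth_expT (hc0 : 0 < c)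
    (hc : ∀ t, 0 ≤ t → ‖heat (x : Op d) t‖ ≤ Real.exp (-(c * t))) (n : ℕ)
    (w : List (smoothTorus θ)) : ExpSmooth (c / 2) n fun t => (expT x t w : Op d) := by
  have h0 : ∀ w : List (smoothTorus θ), ExpDecay (c / 2) fun t => (expT x t w : Op d) :=
    fun w => by
      obtain ⟨C, hC0, hC⟩ := norm_tMap_le (θ := θ) hc0 hc (n := 0) (Bs := []) (w := w) (Nat.zero_le _)
      refine ⟨continuous_expT x w, C, hC0, fun t ht => ?_⟩
      have h1 := hC t ht
      rw [pow_zero, one_mul] at h1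
      exact h1
  induction n generalizing w with
  | zero => exact h0 w
  | succ n ih =>
    refine ⟨h0 w, _, hasDerivAt_expT x w, ?_⟩
    cases w with
    | nil => exact (ih []).clm_comp (-mulLeftReal (x : Op d))
    | cons b w =>
      have h1 := ((ih (b :: w)).clm_comp (-mulLeftReal (x : Op d))).add
        ((ih w).clm_comp (-mulLeftReal (b : Op d)))
      have h2 : (fun t => (heatRhs x (expT x t) (b :: w) : Op d)) = fun t =>
          (-mulLeftReal (x : Op d)) (expT x t (b :: w) : Op d) +
            (-mulLeftReal (b : Op d)) (expT x t w : Op d) := by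
        funext t
        rw [heatRhs, sub_eq_add_neg]
        rfl
      rw [h2]
      exact h1

theorem DSeq_chain_mem {S : AddSubgroup (ℝ → Op d)}
    (h : ∀ w : List (smoothTorus θ), (fun t => (expT x t w : Op d)) ∈ S) (L : List (Fin d))
    (Bs : List (FormalOp θ)) : (fun t => (DSeq L (chain x t Bs) : Op d)) ∈ S := by
  have h1 : ∀ w : List (smoothTorus θ), (fun t => (DSeq L (expT x t w) : Op d)) ∈ S := fun w => by
    have h2 := leibSeq_mem (S := S) (n := 0) x L (K := fun w t => (expT x t w : Op d))
      (fun w _ => h w) (w := w) (Nat.zero_le _)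
    have h3 : (leibSeq x L (fun w t => (expT x t w : Op d)) w) =
        fun t => (DSeq L (expT x t w) : Op d) := by
      funext t
      rw [(isLeib_expT x t).DSeq_eq]
      exact (map_leibSeq (Pi.evalAddMonoidHom (fun _ : ℝ => Op d) t) x L _ w).trans
        (map_leibSeq (smoothTorus θ).subtype.toAddMonoidHom x L (expT x t) w).symm
    rwa [h3] at h2
  have h2 := tMap_mem (S := S) (n := 0) x (K := fun w t => (DSeq L (expT x t w) : Op d))
    (fun w _ => h1 w) (Bs := Bs.reverse) (w := []) (Nat.zero_le _)
  have h3 : tMap x (fun w t => (DSeq L (expT x t w) : Op d)) Bs.reverse [] =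
      fun t => (DSeq L (chain x t Bs) : Op d) := by
    funext t
    exact (map_tMap (Pi.evalAddMonoidHom (fun _ : ℝ => Op d) t) x _ Bs.reverse []).trans
      (map_tMap ((smoothTorus θ).subtype.toAddMonoidHom.comp (DSeq L).toAddMonoidHom) x
        (expT x t) Bs.reverse []).symm
  rwa [h3] at h2

theorem expSmooth_DSeq_chain (hc0 : 0 < c)
    (hc : ∀ t, 0 ≤ t → ‖heat (x : Op d) t‖ ≤ Real.exp (-(c * t))) {h : ℝ} (hh : 0 ≤ h) (n : ℕ)
    (L : List (Fin d)) (Bs : List (FormalOp θ)) :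
    ExpSmooth (c / 2 * h) n fun u => (DSeq L (chain x (h * u) Bs) : Op d) :=
  ExpSmooth.comp_mul_left hh
    (DSeq_chain_mem (S := expSmoothSubgroup (Op d) (c / 2) n) (expSmooth_expT hc0 hc n) L Bs)

theorem expDecay_act_chain (hc0 : 0 < c)
    (hc : ∀ t, 0 ≤ t → ‖heat (x : Op d) t‖ ≤ Real.exp (-(c * t))) {h : ℝ} (hh : 0 ≤ h)
    (B : FormalOp θ) (Bs : List (FormalOp θ)) :
    ExpDecay (c / 2 * h) fun u => (act B (chain x (h * u) Bs) : Op d) := by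
  have h1 : (fun u => (act B (chain x (h * u) Bs) : Op d)) = ∑ α ∈ B.support, fun u =>
      mulLeftReal (B α : Op d) (DSeq (idx α) (chain x (h * u) Bs) : Op d) := by
    funext u
    rw [act_apply, Finsupp.sum, AddSubmonoidClass.coe_finsetSum, Finset.sum_apply]
    rfl
  rw [h1]
  exact sum_mem (S := expSmoothSubgroup (Op d) (c / 2 * h) 0) fun α _ =>
    ((expSmooth_DSeq_chain hc0 hc hh 0 (idx α) Bs).clm_comp (mulLeftReal (B α : Op d)))

theorem smoothIntegrable_exp_smul_chain (hc0 : 0 < c)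
    (hc : ∀ t, 0 ≤ t → ‖heat (x : Op d) t‖ ≤ Real.exp (-(c * t))) {h : ℝ} (hh : 0 < h) (l : ℝ)
    (Bs : List (FormalOp θ)) :
    SmoothIntegrable (volume.restrict (Set.Ioi (0 : ℝ))) fun u : ℝ =>
      Complex.exp (-(Complex.I * l * u)) • chain x (h * u) Bs := fun L => by
  simp only [map_smul, Submodule.coe_smul]
  exact IntegrableOn.exp_smul l
    ((expSmooth_DSeq_chain hc0 hc hh.le 0 L Bs).expDecay.integrableOn (by positivity))

/-- `∫₀^∞ e^{-ilu} 𝐓_{e^{-hu·}}(𝐁₁, …, 𝐁_m) du`. -/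
def laplaceChain (x : smoothTorus θ) (h l : ℝ) (Bs : List (FormalOp θ)) : Op d :=
  halfFourier (fun u => (chain x (h * u) Bs : Op d)) l

/-- `act B` is defined on smooth elements only, so a smooth representative of the transform is
produced, along with the passage of `B` under the integral. -/
theorem exists_act_laplaceChain (hc0 : 0 < c)
    (hc : ∀ t, 0 ≤ t → ‖heat (x : Op d) t‖ ≤ Real.exp (-(c * t))) {h : ℝ} (hh : 0 < h) (l : ℝ)
    (Bs : List (FormalOp θ)) :
    ∃ b : smoothTorus θ, (b : Op d) = laplaceChain x h l Bs ∧
      ∀ B : FormalOp θ, (act B b : Op d) =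
        halfFourier (fun u => (act B (chain x (h * u) Bs) : Op d)) l := by
  refine ⟨⟨_, (smoothIntegrable_exp_smul_chain hc0 hc hh l Bs).mem⟩, rfl, fun B => ?_⟩
  rw [(smoothIntegrable_exp_smul_chain hc0 hc hh l Bs).act_integral]
  simp only [map_smul, Submodule.coe_smul]
  rfl

theorem halfFourier_clm_comp {f : ℝ → Op d} {c' : ℝ} (hc' : 0 < c') (hf : ExpDecay c' f)
    (T : Op d →L[ℂ] Op d) (l : ℝ) : halfFourier (fun u => T (f u)) l = T (halfFourier f l) := by
  have h := T.integral_comp_comm (IntegrableOn.exp_smul l (hf.integrableOn hc'))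
  simp only [map_smul] at h
  exact h

theorem hasDerivAt_comp_mul_left {f : ℝ → Op d} {f' : Op d} {h u : ℝ}
    (hf : HasDerivAt f f' (h * u)) : HasDerivAt (fun u => f (h * u)) ((h : ℂ) • f') u := by
  have h2 : HasDerivAt (fun u : ℝ => h * u) h u := by
    simpa using (hasDerivAt_id u).const_mul h
  rw [Complex.coe_smul]
  exact hf.scomp u h2

theorem ExpDecay.clm_comp_complex {f : ℝ → Op d} {c' : ℝ} (hf : ExpDecay c' f)
    (T : Op d →L[ℂ] Op d) : ExpDecay c' fun u => T (f u) :=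
  ExpDecay.clm_comp (T.restrictScalars ℝ) hf

theorem expDecay_chain (hc0 : 0 < c)
    (hc : ∀ t, 0 ≤ t → ‖heat (x : Op d) t‖ ≤ Real.exp (-(c * t))) {h : ℝ} (hh : 0 ≤ h)
    (Bs : List (FormalOp θ)) : ExpDecay (c / 2 * h) fun u => (chain x (h * u) Bs : Op d) :=
  (expSmooth_DSeq_chain hc0 hc hh 0 [] Bs).expDecay

/-- The transform of y' = -hxy, y(0) = 1. The other order of the factors, proved next, uses y' =
-hyx instead. -/
theorem resolvent_mul_laplaceChain_nil (hc0 : 0 < c)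
    (hc : ∀ t, 0 ≤ t → ‖heat (x : Op d) t‖ ≤ Real.exp (-(c * t))) {h : ℝ} (hh : 0 < h) (l : ℝ) :
    ((h : ℂ) • (x : Op d) + (Complex.I * l) • 1) * laplaceChain x h l [] = 1 := by
  let T : Op d →L[ℂ] Op d := ContinuousLinearMap.mul ℂ (Op d) (-((h : ℂ) • (x : Op d)))
  have hT : ∀ y, T y = -((h : ℂ) • ((x : Op d) * y)) := fun y => by
    rw [← smul_mul_assoc, ← neg_mul]
    rfl
  have hf := expDecay_chain hc0 hc hh.le []
  have h1 := I_mul_smul_halfFourier (by positivity) hf (hf.clm_comp_complex T) (fun u => by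
    have h2 := hasDerivAt_comp_mul_left (hasDerivAt_expT x [] (h * u))
    exact h2.congr_deriv ((smul_neg _ _).trans (hT _).symm)) l
  rw [halfFourier_clm_comp (by positivity) hf, mul_zero, chain_nil, heat_zero] at h1
  rw [add_mul, smul_mul_assoc, smul_mul_assoc, one_mul, laplaceChain, h1, hT]
  abel

theorem laplaceChain_nil_mul_resolvent (hc0 : 0 < c)
    (hc : ∀ t, 0 ≤ t → ‖heat (x : Op d) t‖ ≤ Real.exp (-(c * t))) {h : ℝ} (hh : 0 < h) (l : ℝ) :
    laplaceChain x h l [] * ((h : ℂ) • (x : Op d) + (Complex.I * l) • 1) = 1 := by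
  let T : Op d →L[ℂ] Op d := 
    (ContinuousLinearMap.mul ℂ (Op d)).flip (-((h : ℂ) • (x : Op d)))
  have hT : ∀ y, T y = -((h : ℂ) • (y * (x : Op d))) := fun y => by
    rw [← mul_smul_comm, ← mul_neg]
    rfl
  have hf := expDecay_chain hc0 hc hh.le []
  have h1 := I_mul_smul_halfFourier (by positivity) hf (hf.clm_comp_complex T) (fun u => by
    have h2 := hasDerivAt_comp_mul_left (hasDerivAt_heat (x : Op d) (h * u))
    simp only [chain_nil]
    exact h2.congr_deriv (by rw [hT, smul_neg])) l
  rw [halfFourier_clm_comp (by positivity) hf, mul_zero, chain_nil, heat_zero] at h1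
  rw [mul_add, mul_smul_comm, mul_smul_comm, mul_one, laplaceChain, h1, hT]
  abel

theorem inverse_resolvent (hc0 : 0 < c)
    (hc : ∀ t, 0 ≤ t → ‖heat (x : Op d) t‖ ≤ Real.exp (-(c * t))) {h : ℝ} (hh : 0 < h) (l : ℝ) :
    Ring.inverse ((h : ℂ) • (x : Op d) + (Complex.I * l) • 1) = laplaceChain x h l [] :=
  Ring.inverse_unit (⟨_, _, resolvent_mul_laplaceChain_nil hc0 hc hh l,
    laplaceChain_nil_mul_resolvent hc0 hc hh l⟩ : (Op d)ˣ)

/-- The transform of the differential equation of `chain`: the initial value is 0, so the resolvent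
is applied to -h times the transformed inhomogeneity. -/
theorem laplaceChain_cons (hc0 : 0 < c)
    (hc : ∀ t, 0 ≤ t → ‖heat (x : Op d) t‖ ≤ Real.exp (-(c * t))) {h : ℝ} (hh : 0 < h) (l : ℝ)
    (B : FormalOp θ) {Bs : List (FormalOp θ)} {b : smoothTorus θ}
    (hb : (act B b : Op d) = halfFourier (fun u => (act B (chain x (h * u) Bs) : Op d)) l) :
    laplaceChain x h l (B :: Bs) =
      (-h : ℂ) • (laplaceChain x h l [] * (act B b : Op d)) := by
  let T : Op d →L[ℂ] Op d := ContinuousLinearMap.mul ℂ (Op d) (-((h : ℂ) • (x : Op d)))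
  have hT : ∀ y, T y = -((h : ℂ) • ((x : Op d) * y)) := fun y => by
    rw [← smul_mul_assoc, ← neg_mul]
    rfl
  let T' : Op d →L[ℂ] Op d := (-h : ℂ) • ContinuousLinearMap.id ℂ (Op d)
  have hT' : ∀ y, T' y = -((h : ℂ) • y) := fun y => neg_smul (h : ℂ) y
  have hc' : 0 < c / 2 * h := by positivity
  have hf := expDecay_chain hc0 hc hh.le (B :: Bs)
  have hg := expDecay_act_chain hc0 hc hh.le B Bs
  have hf1 := hf.clm_comp_complex T
  have hg1 := hg.clm_comp_complex T'
  have h1 := I_mul_smul_halfFourier hc' hf (hf1.add hg1) (fun u => by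
    refine (hasDerivAt_comp_mul_left (hasDerivAt_chain x B Bs (h * u))).congr_deriv ?_
    rw [hT, hT', smul_sub, smul_neg, sub_eq_add_neg]) l
  have h2 : halfFourier (fun u => T (chain x (h * u) (B :: Bs) : Op d) +
      T' (act B (chain x (h * u) Bs) : Op d)) l =
      halfFourier (fun u => T (chain x (h * u) (B :: Bs) : Op d)) l +
        halfFourier (fun u => T' (act B (chain x (h * u) Bs) : Op d)) l := by
    simp only [halfFourier, smul_add]
    exact integral_add (IntegrableOn.exp_smul l (hf1.integrableOn hc'))
      (IntegrableOn.exp_smul l (hg1.integrableOn hc'))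
  rw [h2, halfFourier_clm_comp hc' hf, halfFourier_clm_comp hc' hg, mul_zero, chain_zero_cons,
    ← hb] at h1
  have h3 : ((h : ℂ) • (x : Op d) + (Complex.I * l) • 1) * laplaceChain x h l (B :: Bs) =
      (-h : ℂ) • (act B b : Op d) := by
    rw [add_mul, smul_mul_assoc, smul_mul_assoc, one_mul, laplaceChain, h1, hT, hT', neg_smul,
      ZeroMemClass.coe_zero]
    abel
  rw [← mul_smul_comm, ← h3, ← mul_assoc, laplaceChain_nil_mul_resolvent hc0 hc hh l, one_mul]

theorem laplaceChain_ofFn (hc0 : 0 < c)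
    (hc : ∀ t, 0 ≤ t → ‖heat (x : Op d) t‖ ≤ Real.exp (-(c * t))) {h : ℝ} (hh : 0 < h) (l : ℝ)
    {m : ℕ} {W : Fin m → FormalOp θ} {T : Fin m → Op d → Op d}
    (hT : ∀ j (b : smoothTorus θ), T j b = act (W j) b) :
    laplaceChain x h l (List.ofFn W) = (-h : ℂ) ^ m • (laplaceChain x h l [] *
      (List.ofFn fun j g => T j (laplaceChain x h l [] * g)).foldr (fun T g => T g) 1) := by
  induction m with
  | zero => simp
  | succ m ih =>
    obtain ⟨b, hb, hb'⟩ := exists_act_laplaceChain hc0 hc hh l (List.ofFn fun j => W j.succ)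
    -- The operators `T j` are known on smooth elements only. The inner product of resolvents is
    -- recognised as smooth by dividing the smooth element `b` by (-h)^m.
    have h0 : ((-h : ℂ) ^ m) ≠ 0 := pow_ne_zero _ (by simpa using hh.ne')
    have h1 := ih (W := fun j => W j.succ) (T := fun j => T j.succ) fun j => hT j.succ
    rw [← hb] at h1
    rw [List.ofFn_succ, List.ofFn_succ, List.foldr_cons, laplaceChain_cons hc0 hc hh l _ (hb' _)]
    beta_reduce
    rw [(inv_smul_eq_iff₀ h0).2 h1 |>.symm, ← Submodule.coe_smul, hT, map_smul, Submodule.coe_smul,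
      mul_smul_comm, smul_smul, pow_succ', mul_assoc, mul_inv_cancel₀ h0, mul_one]

end Chain

end

end NCTorus

namespace NCTorus

noncomputable section

variable {d : ℕ} {θ : Matrix (Fin d) (Fin d) ℝ}

/-! ### Local invariants -/

section General

variable {E : Type*} [NormedAddCommGroup E]

theorem integrable_sum_sum_and_integral [NormedSpace ℝ E] {α ι : Type*} {κ : ι → Type*}
    [MeasurableSpace α] (μ : Measure α) (s : Finset ι) (t : ∀ i, Finset (κ i))
    (f : ∀ i, κ i → α → E) (hf : ∀ i ∈ s, ∀ j ∈ t i, Integrable (f i j) μ) :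
    Integrable (fun a => ∑ i ∈ s, ∑ j ∈ t i, f i j a) μ ∧
      ∫ a, ∑ i ∈ s, ∑ j ∈ t i, f i j a ∂μ = ∑ i ∈ s, ∑ j ∈ t i, ∫ a, f i j a ∂μ := by
  have h := fun i hi => integrable_finsetSum _ (hf i hi)
  exact ⟨integrable_finsetSum _ h, (integral_finsetSum _ h).trans
    (Finset.sum_congr rfl fun i hi => integral_finsetSum _ (hf i hi))⟩

variable [NormedSpace ℂ E]

theorem halfFourier_sum_sum {ι : Type*} {κ : ι → Type*} (s : Finset ι) (t : ∀ i, Finset (κ i))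
    (r : ι → ℂ) (f : ∀ i, κ i → ℝ → E)
    (hf : ∀ i ∈ s, ∀ j ∈ t i, IntegrableOn (f i j) (Set.Ioi 0)) (l : ℝ) :
    halfFourier (fun u => ∑ i ∈ s, ∑ j ∈ t i, r i • f i j u) l =
      ∑ i ∈ s, ∑ j ∈ t i, r i • halfFourier (f i j) l := by
  simp only [halfFourier, Finset.smul_sum, ← integral_smul]
  simp only [smul_comm (r _)]
  exact (integrable_sum_sum_and_integral (volume.restrict (Set.Ioi (0 : ℝ))) s t _
    fun i hi j hj => IntegrableOn.exp_smul l ((hf i hi j hj).smul (r i))).2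

theorem tendsto_integral_apply_halfFourier_mul_exp [CompleteSpace E] {c : ℝ} (hc : 0 < c)
    {f : ℝ → E} (hf : ExpSmooth c 2 f) (φ : E →L[ℂ] ℂ) :
    Tendsto (fun N : ℝ => (1 / (2 * Real.pi) : ℂ) * ∫ l in (-N)..N,
      φ (halfFourier f l) * Complex.exp (Complex.I * l)) atTop (𝓝 (φ (f 1))) := by
  obtain ⟨h0, f', hf', h1, f'', hf'', h2⟩ := hf
  have hlim := ((φ.continuous.tendsto _).comp
    (tendsto_integral_exp_smul_halfFourier hc h0 h1 h2 hf' hf'')).const_mul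
      (1 / (2 * Real.pi) : ℂ)
  have hexp : Continuous fun l : ℝ => Complex.exp (Complex.I * l) := by fun_prop
  rw [map_smul, smul_eq_mul, ← mul_assoc, one_div_mul_cancel (by simp [Real.pi_ne_zero]),
    one_mul] at hlim
  refine hlim.congr fun N => ?_
  have hi : IntervalIntegrable (fun l : ℝ => Complex.exp (Complex.I * l) • halfFourier f l)
      volume (-N) N := (hexp.smul (continuous_halfFourier hc h0)).intervalIntegrable _ _
  rw [Function.comp_apply, ← φ.intervalIntegral_comp_comm hi]
  simp only [map_smul, smul_eq_mul, mul_comm (Complex.exp _)]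

end General

section LocalInvariant

variable {x : smoothTorus θ}

theorem exists_norm_heat_le (hx : (x : Op d).IsPositive) (hxu : IsUnit (x : Op d)) :
    ∃ c, 0 < c ∧ ∀ t, 0 ≤ t → ‖heat (x : Op d) t‖ ≤ Real.exp (-(c * t)) := by
  obtain ⟨c, hc0, hc⟩ := exists_spectrum_lower_bound hx hxu
  exact ⟨c, hc0, fun t ht => norm_heat_le hx.isSelfAdjoint hc ht⟩

/-- `Corr_k(s)`. -/
def corr (x : smoothTorus θ) (a : Fin d → smoothTorus θ) (a₀ : smoothTorus θ) (k : ℕ)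
    (s : EuclideanSpace ℝ (Fin d)) (h : ℝ) : Op d :=
  ∑ m ∈ Finset.Icc (k / 2) k, ∑ 𝒜 ∈ Finset.powersetCard (2 * m - k) (Finset.univ : Finset (Fin m)),
    (((‖s‖ ^ (2 * m))⁻¹ : ℝ) : ℂ) • (chain x h (List.ofFn (formalWAt x a a₀ 𝒜 s)) : Op d)

/-- Each summand is a transformed `chain` with h = |s|²; the factor (-|s|²)^m that this creates
turns |s|^{-2m} into the sign (-1)^m. -/
theorem resolventCorr_eq {c : ℝ} (hc0 : 0 < c)
    (hc : ∀ t, 0 ≤ t → ‖heat (x : Op d) t‖ ≤ Real.exp (-(c * t))) (a : Fin d → smoothTorus θ)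
    (a₀ : smoothTorus θ) (k : ℕ) {s : EuclideanSpace ℝ (Fin d)} (hs : s ≠ 0) (l : ℝ) :
    resolventCorr θ x a a₀ k s (Complex.I * l) =
      halfFourier (fun u => corr x a a₀ k s (‖s‖ ^ 2 * u)) l := by
  have hh : 0 < ‖s‖ ^ 2 := by positivity
  have h0 := halfFourier_sum_sum (E := Op d) (Finset.Icc (k / 2) k)
    (fun m => Finset.powersetCard (2 * m - k) (Finset.univ : Finset (Fin m)))
    (fun m => (((‖s‖ ^ (2 * m))⁻¹ : ℝ) : ℂ))
    (fun m 𝒜 u => (chain x (‖s‖ ^ 2 * u) (List.ofFn (formalWAt x a a₀ 𝒜 s)) : Op d))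
    (fun _ _ _ _ => (expDecay_chain hc0 hc hh.le _).integrableOn (by positivity)) l
  refine Eq.trans ?_ h0.symm
  simp only [resolventCorr]
  rw [inverse_resolvent hc0 hc hh, Finset.mul_sum]
  refine Finset.sum_congr rfl fun m _ => ?_
  rw [Finset.mul_sum]
  refine Finset.sum_congr rfl fun 𝒜 _ => ?_
  have h1 := laplaceChain_ofFn hc0 hc hh l (W := formalWAt x a a₀ 𝒜 s)
    (opW_map (smoothTorus θ).subtype (X := fun g => (x : Op d) * g)
      (A := fun i g => (a i : Op d) * g) (A₀ := fun g => (a₀ : Op d) * g) (del := derivOp θ)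
      (fun _ => rfl) (fun _ _ => rfl) (fun _ => rfl) (fun _ _ => rfl) 𝒜 s)
  change _ = (((‖s‖ ^ (2 * m))⁻¹ : ℝ) : ℂ) • laplaceChain x (‖s‖ ^ 2) l _
  rw [h1, smul_smul, mul_smul_comm]
  congr 1
  have h2 := inv_norm_pow_mul_neg_sq_pow hs m
  exact_mod_cast h2.symm

theorem tendsto_integral_resolventCorr {c : ℝ} (hc0 : 0 < c)
    (hc : ∀ t, 0 ≤ t → ‖heat (x : Op d) t‖ ≤ Real.exp (-(c * t))) (a : Fin d → smoothTorus θ)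
    (a₀ : smoothTorus θ) (k : ℕ) {s : EuclideanSpace ℝ (Fin d)} (hs : s ≠ 0) (u w : L2 d) :
    Tendsto (fun N : ℝ => (1 / (2 * Real.pi) : ℂ) * ∫ l in (-N)..N,
      inner ℂ w (resolventCorr θ x a a₀ k s (Complex.I * l) u) * Complex.exp (Complex.I * l))
      atTop (𝓝 (inner ℂ w (corr x a a₀ k s (‖s‖ ^ 2) u))) := by
  have hh : 0 < ‖s‖ ^ 2 := by positivity
  have hF : ExpSmooth (c / 2 * ‖s‖ ^ 2) 2 fun u => corr x a a₀ k s (‖s‖ ^ 2 * u) := by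
    have h1 : (fun u => corr x a a₀ k s (‖s‖ ^ 2 * u)) = ∑ m ∈ Finset.Icc (k / 2) k,
        ∑ 𝒜 ∈ Finset.powersetCard (2 * m - k) (Finset.univ : Finset (Fin m)),
          fun u => (((‖s‖ ^ (2 * m))⁻¹ : ℝ) : ℂ) •
            (chain x (‖s‖ ^ 2 * u) (List.ofFn (formalWAt x a a₀ 𝒜 s)) : Op d) := by
      funext u
      simp only [corr, Finset.sum_apply]
    rw [h1]
    refine sum_mem (S := expSmoothSubgroup (Op d) (c / 2 * ‖s‖ ^ 2) 2) fun m _ =>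
      sum_mem (S := expSmoothSubgroup (Op d) (c / 2 * ‖s‖ ^ 2) 2) fun 𝒜 _ => ?_
    exact (expSmooth_DSeq_chain hc0 hc hh.le 2 [] _).clm_comp
      (((((‖s‖ ^ (2 * m))⁻¹ : ℝ) : ℂ) • ContinuousLinearMap.id ℂ (Op d)).restrictScalars ℝ)
  let φ : Op d →L[ℂ] ℂ := (innerSL ℂ w).comp (ContinuousLinearMap.apply ℂ (L2 d) u)
  have hφ : ∀ T : Op d, inner ℂ w (T u) = φ T := fun _ => rfl
  have hlim := tendsto_integral_apply_halfFourier_mul_exp (by positivity) hF φ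
  rw [mul_one] at hlim
  simp only [hφ, resolventCorr_eq hc0 hc a a₀ k hs]
  exact hlim

theorem le_two_mul_of_mem_Icc {k m : ℕ} (hk : Even k) (hm : m ∈ Finset.Icc (k / 2) k) :
    k ≤ 2 * m := by
  obtain ⟨r, rfl⟩ := hk
  have := (Finset.mem_Icc.1 hm).1
  omega

theorem integrable_corr_and_integral [NeZero d] (hx : (x : Op d).IsPositive)
    (hxu : IsUnit (x : Op d)) (a : Fin d → smoothTorus θ) (a₀ : smoothTorus θ) {k : ℕ}
    (hk : Even k) {F : ℝ → ℝ} (hF : IsPowerPrimitive k d F) :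
    Integrable (fun s : EuclideanSpace ℝ (Fin d) => corr x a a₀ k s (‖s‖ ^ 2)) ∧
      ∫ s : EuclideanSpace ℝ (Fin d), corr x a a₀ k s (‖s‖ ^ 2) = mainFormula θ x a a₀ k F := by
  obtain ⟨h1, h2⟩ := integrable_sum_sum_and_integral (E := Op d) volume (Finset.Icc (k / 2) k)
    (fun m => Finset.powersetCard (2 * m - k) (Finset.univ : Finset (Fin m)))
    (fun m 𝒜 (s : EuclideanSpace ℝ (Fin d)) => (((‖s‖ ^ (2 * m))⁻¹ : ℝ) : ℂ) •
      (chain x (‖s‖ ^ 2) (List.ofFn (formalWAt x a a₀ 𝒜 s)) : Op d))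
    fun m hm 𝒜 h𝒜 => (smoothIntegrable_formalWAt hx hxu a a₀ hk (le_two_mul_of_mem_Icc hk hm)
      (Finset.mem_powersetCard.1 h𝒜).2).integrable
  refine ⟨h1, h2.trans ?_⟩
  exact Finset.sum_congr rfl fun m hm => Finset.sum_congr rfl fun 𝒜 h𝒜 =>
    (mainSummand_eq_integral hF hx hxu a a₀ hk (le_two_mul_of_mem_Icc hk hm)
      (Finset.mem_powersetCard.1 h𝒜).2).symm

/-- `corr` at time |s|², the value at u = 1, serves as Corr_k(s). It is integrable in norm, so the
weak integral follows by applying matrix elements. -/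
theorem isLocalInvariant_mainFormula [NeZero d] (hx : (x : Op d).IsPositive)
    (hxu : IsUnit (x : Op d)) (a : Fin d → smoothTorus θ) (a₀ : smoothTorus θ) {k : ℕ}
    (hk : Even k) {F : ℝ → ℝ} (hF : IsPowerPrimitive k d F) :
    IsLocalInvariant θ x a a₀ k (mainFormula θ x a a₀ k F) := by
  obtain ⟨c, hc0, hc⟩ := exists_norm_heat_le hx hxu
  refine ⟨fun s => corr x a a₀ k s (‖s‖ ^ 2),
    fun s hs => tendsto_integral_resolventCorr hc0 hc a a₀ k hs, fun u w => ?_⟩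
  let φ : Op d →L[ℂ] ℂ := (innerSL ℂ w).comp (ContinuousLinearMap.apply ℂ (L2 d) u)
  have hφ : ∀ T : Op d, inner ℂ w (T u) = φ T := fun _ => rfl
  obtain ⟨hint, heq⟩ := integrable_corr_and_integral hx hxu a a₀ hk hF
  simp only [hφ]
  exact ⟨φ.integrable_comp hint, by rw [← heq, φ.integral_comp_comm hint]⟩

theorem mainFormula_mem [NeZero d] (hx : (x : Op d).IsPositive)
    (hxu : IsUnit (x : Op d)) (a : Fin d → smoothTorus θ) (a₀ : smoothTorus θ) {k : ℕ}
    (hk : Even k) {F : ℝ → ℝ} (hF : IsPowerPrimitive k d F) :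
    mainFormula θ x a a₀ k F ∈ smoothTorus θ :=
  sum_mem fun _ hm => sum_mem fun _ h𝒜 => mainSummand_mem hx hxu a a₀ hk
    (le_two_mul_of_mem_Icc hk hm) (Finset.mem_powersetCard.1 h𝒜).2 hF

end LocalInvariant

end

end NCTorus

/-! ### The theorem -/

open MeasureTheory NCTorus in
theorem theorem10p3 (d : ℕ) (hd : 2 ≤ d) (θ : Matrix (Fin d) (Fin d) ℝ)
    (hθ : θ.transpose = -θ) (N : ℕ)
    (Φ : cTorus θ →⋆ₐ[ℂ] Matrix (Fin N) (Fin N) C(UnitAddTorus (Fin d), ℂ))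
    (hΦ : Function.Injective Φ) (hΦD : PreservesSmooth Φ)
    (x : smoothTorus θ) (a : Fin d → smoothTorus θ) (a₀ : smoothTorus θ)
    (hx : (x : Op d).IsPositive) (hxu : IsUnit (x : Op d))
    (k : ℕ) (hk : Even k) (F : ℝ → ℝ) (hF : IsPowerPrimitive k d F) :
    (∀ (m : ℕ) (𝒜 : Finset (Fin m)), k ≤ 2 * m → m ≤ k → 𝒜.card = 2 * m - k →
      ∃ L : smoothTorus θ, (L : Op d) = mainSummand θ x a a₀ k F 𝒜 ∧
        ∀ (t : UnitAddTorus (Fin d)) (v : Fin N → ℂ),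
          (∀ ξ, IntegrableOn
            (fun s => imIntegrand (matrixAt Φ x) ξ (imW Φ x a a₀ 𝒜 ξ) v s t) (simplex m)) ∧
          Integrable (fun ξ => (-1 : ℂ) ^ m • imF (matrixAt Φ x) ξ (imW Φ x a a₀ 𝒜 ξ) v t) ∧
          (matrixAt Φ L t).mulVec v =
            ∫ ξ, (-1 : ℂ) ^ m • imF (matrixAt Φ x) ξ (imW Φ x a a₀ 𝒜 ξ) v t) ∧
    ∃ I : smoothTorus θ, IsLocalInvariant θ x a a₀ k I ∧ (I : Op d) = mainFormula θ x a a₀ k F ∧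
      ∀ (t : UnitAddTorus (Fin d)) (v : Fin N → ℂ),
        (matrixAt Φ I t).mulVec v =
          ∫ ξ, ∑ m ∈ Finset.Icc (k / 2) k,
            ∑ 𝒜 ∈ Finset.powersetCard (2 * m - k) (Finset.univ : Finset (Fin m)),
              (-1 : ℂ) ^ m • imF (matrixAt Φ x) ξ (imW Φ x a a₀ 𝒜 ξ) v t := by
  have : NeZero d := ⟨by omega⟩
  refine ⟨fun m 𝒜 hm _ h𝒜 => ⟨⟨_, mainSummand_mem hx hxu a a₀ hk hm h𝒜 hF⟩, rfl, fun t v => ?_⟩,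
    ⟨_, mainFormula_mem hx hxu a a₀ hk hF⟩, isLocalInvariant_mainFormula hx hxu a a₀ hk hF, rfl,
    fun t v => ?_⟩
  -- Evaluating at `t` and applying the result to `v` is a bounded functional `ψ`, which reduces the
  -- pointwise identity to the one in `Op d`.
  · obtain ⟨ψ, hψ⟩ := exists_evalFunctional Φ t v
    obtain ⟨h1, h2⟩ := integrable_smul_imF_and_integral hΦD hx hxu a a₀ hk hm h𝒜 hψ hF
    exact ⟨integrableOn_imIntegrand hΦD x a a₀ 𝒜 v t, h1, by rw [h2, ← hψ]⟩
  · obtain ⟨ψ, hψ⟩ := exists_evalFunctional Φ t v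
    have h : ∀ m ∈ Finset.Icc (k / 2) k,
        ∀ 𝒜 ∈ Finset.powersetCard (2 * m - k) (Finset.univ : Finset (Fin m)), _ ∧ _ :=
      fun m hm 𝒜 h𝒜 => integrable_smul_imF_and_integral hΦD hx hxu a a₀ hk
        (le_two_mul_of_mem_Icc hk hm) (Finset.mem_powersetCard.1 h𝒜).2 hψ hF
    rw [← hψ, integral_finsetSum _ fun m hm => integrable_finsetSum _ fun 𝒜 h𝒜 => (h m hm 𝒜 h𝒜).1]
    simp only [mainFormula, map_sum]
    refine Finset.sum_congr rfl fun m hm => ?_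
    rw [integral_finsetSum _ fun 𝒜 h𝒜 => (h m hm 𝒜 h𝒜).1]
    exact Finset.sum_congr rfl fun 𝒜 h𝒜 => (h m hm 𝒜 h𝒜).2.symm
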